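/- Let $M$ be a smooth $6$-manifold, $T\subseteq\mathbb R$ an interval with more than one point, and for $t\in T$ let $(\omega(t),\psi_+(t),\psi_-(t))$ be an $\mathrm{SU}(3)$-structure on $M$, i.e. around each point there is a smooth local coframe $e^1,\dots,e^6$ (an adapted coframe) with $\omega=e^{12}+e^{34}+e^{56}$, $\psi_+=e^{135}-e^{146}-e^{236}-e^{245}$, $\psi_-=-e^{246}+e^{235}+e^{145}+e^{136}$. Let $\ast_6$ be the Hodge star for which adapted coframes are orthonormal and oriented (it depends on $t$). The torsion forms of the structure are the functions $\sigma_0,\pi_0$, the $1$-forms $\pi_1,\nu_1$, the $2$-forms $\pi_2,\sigma_2\in\Omega^2_8=\{\sigma:\sigma\wedge\psi_+=0,\ \ast_6\sigma=-\sigma\wedge\omega\}$ and the $3$-form $\nu_3\in\Omega^3_{12}=\{\gamma:\gamma\wedge\omega=0,\ \gamma\wedge\psi_\pm=0\}$ (all smooth on $M$) with $$d_6\omega=-\tfrac32\sigma_0\psi_++\tfrac32\pi_0\psi_-+\nu_1\wedge\omega+\nu_3,\quad d_6\psi_+=\pi_0\omega^2+\pi_1\wedge\psi_+-\pi_2\wedge\omega,\quad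 d_6\psi_-=\sigma_0\omega^2+\pi_1\wedge\psi_--\sigma_2\wedge\omega,$$ where $d_6$ is the exterior derivative on $M$ and $\omega^2=\omega\wedge\omega$. Let $f:T\to\mathbb R\setminus\{0\}$ be differentiable, and assume that at each point of $M$ the forms $\omega(t),\psi_\pm(t)$ are differentiable in $t$ (derivatives at an endpoint of $T$ are one-sided). On $M\times S^1$, with $s$ the angular coordinate of $S^1$ and $\alpha^2+\beta^2=1$, consider the warped $\mathrm G_2$-structures $\varphi(t)=f(t)\,\omega(t)\wedge ds+\alpha\psi_+(t)-\beta\psi_-(t)$ with $(\alpha,\beta)=(0,1)$, that is, $$\varphi(t)=f(t)\,\omega(t)\wedge ds-\psi_-(t).$$ Let $\ast_t$ be the Hodge star induced by the $\mathrm G_2$-structure $\varphi(t)$ (coframes with $\varphi=e^{127}+e^{347}+e^{567}+e^{135}-e^{146}-e^{236}-e^{245}$ are orthonormal and oriented), let $d_7$ be the exterior derivative on $M\times S^1$, and let $\Delta_t=d_7d_7^{*}+d_7^{*}d_7$ be the Hodge Laplacian of $\varphi(t)$. Assume that $\varphi(t)$ is coclosed, $d_7(\ast_t\varphi(t))=0$,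 for all $t\in T$. Then, for every $t\in T$, $\pi_0(t)=0$ and $\pi_2(t)=0$, and the Laplacian coflow equation $$\frac{\partial}{\partial t}\big(\ast_t\varphi(t)\big)=-\Delta_t\big(\ast_t\varphi(t)\big)$$ holds at $t$ if and only if $$\begin{cases}\dfrac{\partial\omega^2(t)}{\partial t}=-3\sigma_0(t)^2\,\omega^2(t)+3\sigma_0(t)\,\sigma_2(t)\wedge\omega(t)+2\,d_6(\ast_6\nu_3(t))-3\,d_6\sigma_0(t)\wedge\psi_-(t),\\[6pt]\dfrac{f'(t)}{f(t)}\,\psi_+(t)+\dfrac{\partial\psi_+(t)}{\partial t}=-3\sigma_0(t)^2\,\psi_+(t)+2\sigma_0(t)\,\nu_3(t)+d_6\sigma_2(t)+2\,d_6\sigma_0(t)\wedge\omega(t).\end{cases}$$ -/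

import Mathlib

open Set Topology
open scoped Manifold

noncomputable section

namespace G2Coflow

/-! ### Exterior algebra of a normed space -/

section LinearAlgebra

variable {E : Type*} [NormedAddCommGroup E] [NormedSpace ℝ E]

/-- The wedge product of alternating forms, with the convention
`(α ∧ β) (v₁, …, vₙ) = ∑ sign σ · α (v_σ(1), …, v_σ(p)) · β (v_σ(p+1), …, v_σ(n))`,
the sum being over the `(p, q)`-shuffles `σ` of `n = p + q` letters. -/
def altWedge {p q n : ℕ} (h : p + q = n) (α : E [⋀^Fin p]→L[ℝ] ℝ) (β : E [⋀^Fin q]→L[ℝ] ℝ) :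
    E [⋀^Fin n]→L[ℝ] ℝ :=
  let A : E [⋀^Fin n]→ₗ[ℝ] ℝ :=
    ((LinearMap.mul' ℝ ℝ).compAlternatingMap
      (α.toAlternatingMap.domCoprod β.toAlternatingMap)).domDomCongr
        (finSumFinEquiv.trans (finCongr h))
  { A with
    cont := by
      change Continuous fun v : Fin n → E => LinearMap.mul' ℝ ℝ
        ((α.toAlternatingMap.domCoprod β.toAlternatingMap)
          fun i => v (finSumFinEquiv.trans (finCongr h) i))
      simp only [AlternatingMap.domCoprod_apply, sum_apply, map_sum]
      refine continuous_finsetSum _ fun σ _ => ?_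
      induction σ using Quotient.inductionOn' with
      | _ σ =>
        have hc : Continuous fun v : Fin n → E =>
            α (fun i => v (finSumFinEquiv.trans (finCongr h) (σ (Sum.inl i)))) *
              β (fun i => v (finSumFinEquiv.trans (finCongr h) (σ (Sum.inr i)))) :=
          (α.cont.comp (continuous_pi fun i => continuous_apply _)).mul
            (β.cont.comp (continuous_pi fun i => continuous_apply _))
        rw [AlternatingMap.domCoprod.summand_mk'']
        rcases Int.units_eq_one_or (Equiv.Perm.sign σ) with hs | hs
        · rw [hs, one_smul]
          exact hc
        · rw [hs]
          refine hc.neg.congr fun v => ?_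
          simp [MultilinearMap.domDomCongr_apply, MultilinearMap.domCoprod_apply] }

/-- The wedge product `θ₁ ∧ ⋯ ∧ θₖ` of linear forms, i.e. `(v₁, …, vₖ) ↦ det (θᵢ (vⱼ))`. -/
def wedgeOfLinear {k : ℕ} (θ : Fin k → E →L[ℝ] ℝ) : E [⋀^Fin k]→L[ℝ] ℝ :=
  ContinuousMultilinearMap.alternatization
    ((ContinuousMultilinearMap.mkPiAlgebra ℝ (Fin k) ℝ).compContinuousLinearMap θ)

variable {n : ℕ}

/-- A coframe `(e¹, …, eⁿ)` of `E`, i.e. a basis of the dual space, is a linear isomorphism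
`e : E ≃ ℝⁿ`; `eⁱ` is its `i`-th component. -/
def coframeForm (e : E ≃L[ℝ] (Fin n → ℝ)) (i : Fin n) : E →L[ℝ] ℝ :=
  (ContinuousLinearMap.proj i).comp e.toContinuousLinearMap

/-- The frame `(b₁, …, bₙ)` dual to a coframe. -/
def dualFrame (e : E ≃L[ℝ] (Fin n → ℝ)) (i : Fin n) : E :=
  e.symm (Pi.single i 1)

/-- The elementary form `e^{s₁ … sₖ} = e^{s₁} ∧ ⋯ ∧ e^{sₖ}` (indices are counted from `0`). -/
def elem (e : E ≃L[ℝ] (Fin n → ℝ)) {k : ℕ} (s : Fin k → Fin n) : E [⋀^Fin k]→L[ℝ] ℝ :=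
  wedgeOfLinear fun j => coframeForm e (s j)

/-- The Hodge star of the metric `∑ eⁱ ⊗ eⁱ` and the volume form `e^{1 … n}`:
`⋆β = 1 / (k! l!) ∑_σ sign σ · β (b_σ(1), …, b_σ(k)) · e^{σ(k+1) … σ(n)}`,
the sum being over all permutations `σ` of `n = k + l` letters. -/
def hodge (e : E ≃L[ℝ] (Fin n → ℝ)) {k l : ℕ} (h : k + l = n) (β : E [⋀^Fin k]→L[ℝ] ℝ) :
    E [⋀^Fin l]→L[ℝ] ℝ :=
  ((k.factorial : ℝ) * (l.factorial : ℝ))⁻¹ •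
    ∑ σ : Equiv.Perm (Fin n),
      (((Equiv.Perm.sign σ : ℤ) : ℝ) *
        β fun i => dualFrame e (σ (Fin.cast h (Fin.castAdd l i)))) •
      elem e fun j => σ (Fin.cast h (Fin.natAdd k j))

/-- `e` is an adapted coframe for `(ω, ψ₊, ψ₋)`. -/
def IsSU3Coframe (e : E ≃L[ℝ] (Fin 6 → ℝ)) (ω : E [⋀^Fin 2]→L[ℝ] ℝ)
    (ψp ψm : E [⋀^Fin 3]→L[ℝ] ℝ) : Prop :=
  ω = elem e ![0, 1] + elem e ![2, 3] + elem e ![4, 5] ∧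
  ψp = elem e ![0, 2, 4] - elem e ![0, 3, 5] - elem e ![1, 2, 5] - elem e ![1, 3, 4] ∧
  ψm = - elem e ![1, 3, 5] + elem e ![1, 2, 4] + elem e ![0, 3, 4] + elem e ![0, 2, 5]

/-- `e` is an adapted coframe for the `G₂`-form `φ`. -/
def IsG2Coframe (e : E ≃L[ℝ] (Fin 7 → ℝ)) (φ : E [⋀^Fin 3]→L[ℝ] ℝ) : Prop :=
  φ = elem e ![0, 1, 6] + elem e ![2, 3, 6] + elem e ![4, 5, 6]
    + elem e ![0, 2, 4] - elem e ![0, 3, 5] - elem e ![1, 2, 5] - elem e ![1, 3, 4]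

open Classical in
/-- The Hodge star on a 6-dimensional space determined by an `SU(3)`-structure `(ω, ψ₊, ψ₋)`:
adapted coframes are oriented orthonormal. As `SU(3) ⊆ SO(6)`, the choice of the adapted coframe
is immaterial. -/
def su3Hodge (ω : E [⋀^Fin 2]→L[ℝ] ℝ) (ψp ψm : E [⋀^Fin 3]→L[ℝ] ℝ) {k l : ℕ} (h : k + l = 6)
    (β : E [⋀^Fin k]→L[ℝ] ℝ) : E [⋀^Fin l]→L[ℝ] ℝ :=
  if H : ∃ e : E ≃L[ℝ] (Fin 6 → ℝ), IsSU3Coframe e ω ψp ψm then hodge H.choose h β else 0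

open Classical in
/-- The Hodge star on a 7-dimensional space determined by a `G₂`-form `φ`: adapted coframes are
oriented orthonormal. As `G₂ ⊆ SO(7)`, the choice of the adapted coframe is immaterial. -/
def g2Hodge (φ : E [⋀^Fin 3]→L[ℝ] ℝ) {k l : ℕ} (h : k + l = 7)
    (β : E [⋀^Fin k]→L[ℝ] ℝ) : E [⋀^Fin l]→L[ℝ] ℝ :=
  if H : ∃ e : E ≃L[ℝ] (Fin 7 → ℝ), IsG2Coframe e φ then hodge H.choose h β else 0

end LinearAlgebra

/-! ### Differential forms on manifolds -/

/-- (Not necessarily smooth) real differential `k`-forms on a manifold `M` modelled on `E`. All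
tangent spaces `TangentSpace I x` are, by definition, copies of `E`. -/
abbrev Form (E : Type*) [NormedAddCommGroup E] [NormedSpace ℝ E] (M : Type*) (k : ℕ) : Type _ :=
  M → E [⋀^Fin k]→L[ℝ] ℝ

section Forms

variable {E : Type*} [NormedAddCommGroup E] [NormedSpace ℝ E] {M : Type*}

/-- The wedge product of differential forms. -/
def wedge {p q n : ℕ} (α : Form E M p) (β : Form E M q) (h : p + q = n := by rfl) : Form E M n :=
  fun x => altWedge h (α x) (β x)

/-- The product of a function and a differential form. -/
def mulForm {k : ℕ} (u : M → ℝ) (α : Form E M k) : Form E M k :=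
  fun x => u x • α x

/-- A field of covectors as a differential 1-form. -/
def toOneForm (θ : M → E →L[ℝ] ℝ) : Form E M 1 :=
  fun x => ContinuousAlternatingMap.ofSubsingleton ℝ E ℝ (0 : Fin 1) (θ x)

variable {H : Type*} [TopologicalSpace H] (I : ModelWithCorners ℝ E H)
  [TopologicalSpace M] [ChartedSpace H M]

/-- The pullback of a differential form under a map of manifolds. -/
def pullback {E' : Type*} [NormedAddCommGroup E'] [NormedSpace ℝ E'] {H' : Type*}
    [TopologicalSpace H'] (I' : ModelWithCorners ℝ E' H') {M' : Type*} [TopologicalSpace M']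
    [ChartedSpace H' M'] {k : ℕ} (F : M → M') (α : Form E' M' k) : Form E M k :=
  fun x => (α (F x)).compContinuousLinearMap (mfderiv I I' F x)

/-- The local representative of a differential form in the preferred chart at `x₀`: its pullback
to the model space under the inverse of the chart. -/
def localRep {k : ℕ} (x₀ : M) (α : Form E M k) : Form E E k :=
  pullback 𝓘(ℝ, E) I (extChartAt I x₀).symm α

/-- Smoothness of a differential form on an open set `U` of a manifold without boundary. -/
def SmoothFormOn {k : ℕ} (α : Form E M k) (U : Set M) : Prop :=
  ∀ x₀ : M, ContDiffOn ℝ ((⊤ : ℕ∞) : WithTop ℕ∞) (localRep I x₀ α)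
    ((extChartAt I x₀).target ∩ (extChartAt I x₀).symm ⁻¹' U)

/-- Smoothness of a differential form on a manifold without boundary. -/
def SmoothForm {k : ℕ} (α : Form E M k) : Prop :=
  SmoothFormOn I α univ

/-- The exterior derivative of a differential form on a manifold without boundary, computed at
each point in the preferred chart at that point. -/
def extD {k : ℕ} (α : Form E M k) : Form E M (k + 1) :=
  fun x => (extDeriv (localRep I x α) (extChartAt I x x)).compContinuousLinearMap
    (mfderiv I 𝓘(ℝ, E) (extChartAt I x) x)

/-- The differential of a function, as a 1-form. -/
def diffFun (u : M → ℝ) : Form E M 1 :=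
  toOneForm fun x => mfderiv I 𝓘(ℝ, ℝ) u x

end Forms

/-! ### `SU(3)`-structures on 6-manifolds and their torsion forms -/

/-- The model space of 6-manifolds. -/
abbrev E6 : Type := EuclideanSpace ℝ (Fin 6)

section SU3

variable {M : Type*}

/-- The Hodge star `⋆₆` of differential forms determined by `(ω, ψ₊, ψ₋)`. -/
def star6 (ω : Form E6 M 2) (ψp ψm : Form E6 M 3) {k l : ℕ} (β : Form E6 M k)
    (h : k + l = 6 := by rfl) : Form E6 M l :=
  fun x => su3Hodge (ω x) (ψp x) (ψm x) h (β x)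

variable [TopologicalSpace M] [ChartedSpace E6 M]

/-- `(ω, ψ₊, ψ₋)` is an `SU(3)`-structure: around every point there is a smooth local adapted
coframe. -/
def IsSU3Structure (ω : Form E6 M 2) (ψp ψm : Form E6 M 3) : Prop :=
  ∀ x₀ : M, ∃ U : Set M, IsOpen U ∧ x₀ ∈ U ∧ ∃ e : M → (E6 ≃L[ℝ] (Fin 6 → ℝ)),
    (∀ i, SmoothFormOn (𝓡 6) (toOneForm fun x => coframeForm (e x) i) U) ∧
    ∀ x ∈ U, IsSU3Coframe (e x) (ω x) (ψp x) (ψm x)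

/-- `σ ∈ Ω²₈`: `σ ∧ ψ₊ = 0` and `⋆₆ σ = - σ ∧ ω`. -/
def IsOmega28 (ω : Form E6 M 2) (ψp ψm : Form E6 M 3) (σ : Form E6 M 2) : Prop :=
  SmoothForm (𝓡 6) σ ∧ (wedge σ ψp : Form E6 M 5) = 0 ∧
    (star6 ω ψp ψm σ : Form E6 M 4) = - wedge σ ω

/-- `γ ∈ Ω³₁₂`: `γ ∧ ω = 0` and `γ ∧ ψ₊ = γ ∧ ψ₋ = 0`. -/
def IsOmega312 (ω : Form E6 M 2) (ψp ψm γ : Form E6 M 3) : Prop :=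
  SmoothForm (𝓡 6) γ ∧ (wedge γ ω : Form E6 M 5) = 0 ∧ (wedge γ ψp : Form E6 M 6) = 0 ∧
    (wedge γ ψm : Form E6 M 6) = 0

/-- `π₀, σ₀, π₁, ν₁, π₂, σ₂, ν₃` are the torsion forms of the `SU(3)`-structure `(ω, ψ₊, ψ₋)`. -/
structure IsTorsion (ω : Form E6 M 2) (ψp ψm : Form E6 M 3) (π₀ σ₀ : M → ℝ)
    (π₁ ν₁ : Form E6 M 1) (π₂ σ₂ : Form E6 M 2) (ν₃ : Form E6 M 3) : Prop where
  smooth_π₀ : ContMDiff (𝓡 6) 𝓘(ℝ, ℝ) ((⊤ : ℕ∞) : WithTop ℕ∞) π₀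
  smooth_σ₀ : ContMDiff (𝓡 6) 𝓘(ℝ, ℝ) ((⊤ : ℕ∞) : WithTop ℕ∞) σ₀
  smooth_π₁ : SmoothForm (𝓡 6) π₁
  smooth_ν₁ : SmoothForm (𝓡 6) ν₁
  mem_π₂ : IsOmega28 ω ψp ψm π₂
  mem_σ₂ : IsOmega28 ω ψp ψm σ₂
  mem_ν₃ : IsOmega312 ω ψp ψm ν₃
  d_ω : extD (𝓡 6) ω =
    - ((3 / 2 : ℝ) • mulForm σ₀ ψp) + (3 / 2 : ℝ) • mulForm π₀ ψm + wedge ν₁ ω + ν₃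
  d_ψp : extD (𝓡 6) ψp = mulForm π₀ (wedge ω ω) + wedge π₁ ψp - wedge π₂ ω
  d_ψm : extD (𝓡 6) ψm = mulForm σ₀ (wedge ω ω) + wedge π₁ ψm - wedge σ₂ ω

end SU3

/-! ### `G₂`-forms on 7-manifolds, the Hodge Laplacian and the Laplacian coflow -/

section G2

variable {E : Type*} [NormedAddCommGroup E] [NormedSpace ℝ E] {N : Type*}

/-- The Hodge star `⋆_φ` of differential forms determined by a `G₂`-form `φ`. -/
def star7 (φ : Form E N 3) {k l : ℕ} (β : Form E N k) (h : k + l = 7 := by rfl) : Form E N l :=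
  fun x => g2Hodge (φ x) h (β x)

variable {H : Type*} [TopologicalSpace H] (I : ModelWithCorners ℝ E H)
  [TopologicalSpace N] [ChartedSpace H N]

/-- The codifferential `d^* = (-1)^{k+1} ⋆ d ⋆` of `(k+1)`-forms in dimension `7 = k + 1 + l`. -/
def codiff (φ : Form E N 3) {k l : ℕ} (h : k + 1 + l = 7) (β : Form E N (k + 1)) : Form E N k :=
  (-1 : ℝ) ^ (k + 1) • star7 φ (extD I (star7 φ β h)) (by omega)

/-- The Hodge Laplacian `Δ = d d^* + d^* d` of `φ` on 4-forms. -/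
def laplacian4 (φ : Form E N 3) (β : Form E N 4) : Form E N 4 :=
  extD I (codiff I φ (k := 3) (l := 3) rfl β) + codiff I φ (k := 4) (l := 2) rfl (extD I β)

/-- The `G₂`-form `φ` is coclosed. -/
def IsCoclosed (φ : Form E N 3) : Prop :=
  extD I (star7 φ φ : Form E N 4) = 0

/-- The Laplacian coflow equation `∂(⋆φ)/∂t = - Δ(⋆φ)` holds at the time `t ∈ T`. -/
def CoflowEquationAt (T : Set ℝ) (φ : ℝ → Form E N 3) (t : ℝ) : Prop :=
  ∀ y : N, HasDerivWithinAt (fun s => (star7 (φ s) (φ s) : Form E N 4) y)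
    (- laplacian4 I (φ t) (star7 (φ t) (φ t)) y) T t

end G2

/-! ### Warped `G₂`-structures on `M⁶ × S¹` -/

/-- The model space of `M⁶ × S¹`. -/
abbrev E7 : Type := E6 × EuclideanSpace ℝ (Fin 1)

/-- The model with corners of `M⁶ × S¹`. -/
abbrev I7 : ModelWithCorners ℝ E7 (ModelProd E6 (EuclideanSpace ℝ (Fin 1))) :=
  (𝓡 6).prod (𝓡 1)

/-- The 1-form `ds` on `S¹`, where `s` is the angular coordinate, `z = exp (i s)`: at `z`, it maps
a tangent vector `v`, seen in `ℂ`, to `Im (z̄ v)`. -/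
def angularForm : Form (EuclideanSpace ℝ (Fin 1)) Circle 1 :=
  toOneForm fun z => Complex.imCLM.comp
    ((ContinuousLinearMap.mul ℝ ℂ (starRingEnd ℂ (z : ℂ))).comp
      (mfderiv (𝓡 1) 𝓘(ℝ, ℂ) (fun w : Circle => (w : ℂ)) z))

section Warped

variable {M : Type*} [TopologicalSpace M] [ChartedSpace E6 M]

/-- Pullback of forms from `M⁶` to `M⁶ × S¹`. -/
def lift6 {k : ℕ} (α : Form E6 M k) : Form E7 (M × Circle) k :=
  pullback I7 (𝓡 6) Prod.fst α

/-- The 1-form `ds` on `M⁶ × S¹`. -/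
def ds : Form E7 (M × Circle) 1 :=
  pullback I7 (𝓡 1) Prod.snd angularForm

/-- The warped `G₂`-form `φ = f ω ∧ ds + (α ψ₊ - β ψ₋)` on `M⁶ × S¹`, with warping function `f`
constant over `M⁶`. -/
def warpedG2 (α β f : ℝ) (ω : Form E6 M 2) (ψp ψm : Form E6 M 3) : Form E7 (M × Circle) 3 :=
  f • wedge (lift6 ω) ds + (α • lift6 ψp - β • lift6 ψm)

end Warped

end G2Coflow

end

noncomputable section

namespace G2Coflow

/-! ### The wedge product of alternating forms -/

section Algebra

variable {E : Type*} [NormedAddCommGroup E] [NormedSpace ℝ E] {p q r n : ℕ}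

/-! Everything reduces from M × S¹ to M by writing forms as X + f Y ∧ ds. The G₂-metric of φ = f ω ∧
ds - ψ₋ is the product of the SU(3)-metric and (f ds)², because (ω, -ψ₋, ψ₊) is again an
SU(3)-structure, with the same metric and orientation as (ω, ψ₊, ψ₋)
(`IsSU3Coframe.exists_rotation`), and the model G₂-form is ω ∧ e⁷ + ψ₊. Hence ⋆₇(X + f Y ∧ ds) = ±
⋆₆Y + f ⋆₆X ∧ ds (`star7_lift6_add_wedge_ds`), while d₇ acts on X and Y separately, since f is
constant on M and ds is closed. In particular ⋆φ = ½ω² + f ψ₊ ∧ ds (`star7_warpedG2_self`).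

Coclosedness therefore says dω ∧ ω = 0 and dψ₊ = 0. The three components of dψ₊ are independent, so
π₀, π₁ and π₂ vanish; then dω ∧ ω = ν₁ ∧ ω², and ν₁ vanishes too
(`IsTorsion.eq_zero_of_isCoclosed`). What remains is dω = -3/2 σ₀ψ₊ + ν₃ and dψ₋ = σ₀ω² - σ₂ ∧ ω.

For coclosed φ the Laplacian of ⋆φ is d⋆dφ, so -Δ(⋆φ) = d⋆₆dω + f (d⋆₆dψ₋) ∧ ds
(`laplacian4_warpedG2`). Here ⋆₆dω = -3/2 σ₀ψ₋ + ⋆₆ν₃ and ⋆₆dψ₋ = 2σ₀ω + σ₂; differentiating by the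
Leibniz rule and substituting dω and dψ₋ again gives the right-hand sides. The time derivative of ⋆φ
is ½∂(ω²) + ∂(fψ₊) ∧ ds. Since X and Y are determined by X + Y ∧ ds, the flow equation is equivalent
to two equations on M; multiplying one by 2 and dividing the other by f gives the system.

Two supporting points carry most of the length. The Hodge stars are defined through a chosen adapted
coframe, so independence of the choice is needed: for G₂ it follows from (u ⌟ φ) ∧ (v ⌟ φ) ∧ φ = 6
g(u,v) vol (`IsG2Coframe.vol_flat_unique`), and for SU(3) by adding a line
(`IsSU3Coframe.hodge_unique`). Identities between model forms become integer identities between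
generalized Kronecker symbols `kron`, decided by the kernel. -/

theorem wedgeOfLinear_apply {k : ℕ} (θ : Fin k → E →L[ℝ] ℝ) (v : Fin k → E) :
    wedgeOfLinear θ v = ∑ σ : Equiv.Perm (Fin k),
      ((Equiv.Perm.sign σ : ℤ) : ℝ) * ∏ i, θ i (v (σ i)) := by
  rw [wedgeOfLinear, ContinuousMultilinearMap.alternatization_apply_apply]
  refine Finset.sum_congr rfl fun σ _ => ?_
  rw [Units.smul_def, zsmul_eq_mul]
  simp

theorem wedgeOfLinear_apply_eq_det {k : ℕ} (θ : Fin k → E →L[ℝ] ℝ) (v : Fin k → E) :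
    wedgeOfLinear θ v = Matrix.det (Matrix.of fun i j => θ i (v j)) := by
  rw [wedgeOfLinear_apply, ← Matrix.det_transpose, Matrix.det_apply']
  rfl

/-- Alternatization is multiplicative (`MultilinearMap.domCoprod_alternization`), so wedging
decomposable forms is concatenation of tuples. By linearity this governs all further identities for
the wedge. -/
theorem altWedge_wedgeOfLinear (h : p + q = n) (a : Fin p → E →L[ℝ] ℝ) (b : Fin q → E →L[ℝ] ℝ) :
    altWedge h (wedgeOfLinear a) (wedgeOfLinear b) =
      wedgeOfLinear fun i => Fin.append a b (Fin.cast h.symm i) := by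
  subst h
  ext v
  change LinearMap.mul' ℝ ℝ (((wedgeOfLinear a).toAlternatingMap.domCoprod
    (wedgeOfLinear b).toAlternatingMap) fun i => v (finSumFinEquiv i)) = _
  rw [wedgeOfLinear_apply, wedgeOfLinear, wedgeOfLinear,
    ContinuousMultilinearMap.alternatization_apply_toAlternatingMap,
    ContinuousMultilinearMap.alternatization_apply_toAlternatingMap,
    ← MultilinearMap.domCoprod_alternization, MultilinearMap.alternatization_apply, map_sum]
  refine Fintype.sum_equiv finSumFinEquiv.permCongr _ _ fun σ => ?_
  rw [Equiv.Perm.sign_permCongr, Units.smul_def, map_zsmul, zsmul_eq_mul, Fin.prod_univ_add]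
  simp [Equiv.permCongr_apply]

/-- The wedge product as a signed sum over all permutations. -/
theorem altWedge_apply (h : p + q = n) (α : E [⋀^Fin p]→L[ℝ] ℝ) (β : E [⋀^Fin q]→L[ℝ] ℝ)
    (v : Fin n → E) :
    altWedge h α β v = ((p.factorial : ℝ) * (q.factorial : ℝ))⁻¹ *
      ∑ σ : Equiv.Perm (Fin n), ((Equiv.Perm.sign σ : ℤ) : ℝ) *
        (α (fun i => v (σ (Fin.cast h (Fin.castAdd q i)))) *
          β (fun i => v (σ (Fin.cast h (Fin.natAdd p i))))) := by
  subst h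
  have hne : ((p.factorial : ℝ) * (q.factorial : ℝ)) ≠ 0 := by positivity
  rw [eq_inv_mul_iff_mul_eq₀ hne]
  have key := congrArg (fun A : E [⋀^Fin p ⊕ Fin q]→ₗ[ℝ] _ =>
    LinearMap.mul' ℝ ℝ (A fun i => v (finSumFinEquiv i)))
    (MultilinearMap.domCoprod_alternization_eq α.toAlternatingMap β.toAlternatingMap)
  simp only [Fintype.card_fin, MultilinearMap.alternatization_apply, map_sum,
    AlternatingMap.smul_apply, map_nsmul] at key
  rw [nsmul_eq_mul, Nat.cast_mul] at key
  refine Eq.trans (Eq.symm ?_) (Eq.trans key.symm ?_)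
  · rfl
  · refine Fintype.sum_equiv finSumFinEquiv.permCongr _ _ fun σ => ?_
    rw [Equiv.Perm.sign_permCongr, Units.smul_def, map_zsmul, zsmul_eq_mul]
    simp [Equiv.permCongr_apply]

theorem altWedge_add_left (h : p + q = n) (α α' : E [⋀^Fin p]→L[ℝ] ℝ) (β : E [⋀^Fin q]→L[ℝ] ℝ) :
    altWedge h (α + α') β = altWedge h α β + altWedge h α' β := by
  ext v
  simp only [altWedge_apply, ContinuousAlternatingMap.add_apply, add_mul, mul_add,
    Finset.sum_add_distrib]

theorem altWedge_add_right (h : p + q = n) (α : E [⋀^Fin p]→L[ℝ] ℝ)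
    (β β' : E [⋀^Fin q]→L[ℝ] ℝ) :
    altWedge h α (β + β') = altWedge h α β + altWedge h α β' := by
  ext v
  simp only [altWedge_apply, ContinuousAlternatingMap.add_apply, mul_add,
    Finset.sum_add_distrib]

theorem altWedge_smul_left (h : p + q = n) (c : ℝ) (α : E [⋀^Fin p]→L[ℝ] ℝ)
    (β : E [⋀^Fin q]→L[ℝ] ℝ) : altWedge h (c • α) β = c • altWedge h α β := by
  ext v
  simp only [altWedge_apply, ContinuousAlternatingMap.smul_apply, smul_eq_mul, Finset.mul_sum]
  exact Finset.sum_congr rfl fun σ _ => by ring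

theorem altWedge_smul_right (h : p + q = n) (c : ℝ) (α : E [⋀^Fin p]→L[ℝ] ℝ)
    (β : E [⋀^Fin q]→L[ℝ] ℝ) : altWedge h α (c • β) = c • altWedge h α β := by
  ext v
  simp only [altWedge_apply, ContinuousAlternatingMap.smul_apply, smul_eq_mul, Finset.mul_sum]
  exact Finset.sum_congr rfl fun σ _ => by ring

/-- The wedge product as a bilinear map. -/
def altWedgeₗ (h : p + q = n) :
    (E [⋀^Fin p]→L[ℝ] ℝ) →ₗ[ℝ] (E [⋀^Fin q]→L[ℝ] ℝ) →ₗ[ℝ] (E [⋀^Fin n]→L[ℝ] ℝ) :=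
  LinearMap.mk₂ ℝ (altWedge h) (altWedge_add_left h) (altWedge_smul_left h)
    (altWedge_add_right h) (altWedge_smul_right h)

@[simp] theorem altWedgeₗ_apply (h : p + q = n) (α : E [⋀^Fin p]→L[ℝ] ℝ)
    (β : E [⋀^Fin q]→L[ℝ] ℝ) : altWedgeₗ h α β = altWedge h α β := rfl

theorem altWedge_zero_left (h : p + q = n) (β : E [⋀^Fin q]→L[ℝ] ℝ) :
    altWedge h (0 : E [⋀^Fin p]→L[ℝ] ℝ) β = 0 := by
  rw [← altWedgeₗ_apply, map_zero, LinearMap.zero_apply]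

theorem altWedge_zero_right (h : p + q = n) (α : E [⋀^Fin p]→L[ℝ] ℝ) :
    altWedge h α (0 : E [⋀^Fin q]→L[ℝ] ℝ) = 0 := by
  rw [← altWedgeₗ_apply, map_zero]

theorem altWedge_sum_left {ι : Type*} (s : Finset ι) (h : p + q = n)
    (α : ι → E [⋀^Fin p]→L[ℝ] ℝ) (β : E [⋀^Fin q]→L[ℝ] ℝ) :
    altWedge h (∑ i ∈ s, α i) β = ∑ i ∈ s, altWedge h (α i) β := by
  rw [← altWedgeₗ_apply, map_sum, LinearMap.sum_apply]
  rfl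

theorem altWedge_sum_right {ι : Type*} (s : Finset ι) (h : p + q = n)
    (α : E [⋀^Fin p]→L[ℝ] ℝ) (β : ι → E [⋀^Fin q]→L[ℝ] ℝ) :
    altWedge h α (∑ i ∈ s, β i) = ∑ i ∈ s, altWedge h α (β i) := by
  rw [← altWedgeₗ_apply, map_sum]
  rfl

/-- The wedge product commutes with pullback. -/
theorem altWedge_compContinuousLinearMap {F : Type*} [NormedAddCommGroup F] [NormedSpace ℝ F]
    (h : p + q = n) (α : E [⋀^Fin p]→L[ℝ] ℝ) (β : E [⋀^Fin q]→L[ℝ] ℝ) (L : F →L[ℝ] E) :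
    (altWedge h α β).compContinuousLinearMap L =
      altWedge h (α.compContinuousLinearMap L) (β.compContinuousLinearMap L) := by
  ext v
  simp only [altWedge_apply, ContinuousAlternatingMap.compContinuousLinearMap_apply,
    Function.comp_def]

theorem wedgeOfLinear_compContinuousLinearMap {F : Type*} [NormedAddCommGroup F]
    [NormedSpace ℝ F] {k : ℕ} (θ : Fin k → E →L[ℝ] ℝ) (L : F →L[ℝ] E) :
    (wedgeOfLinear θ).compContinuousLinearMap L = wedgeOfLinear fun i => (θ i).comp L := by
  ext v
  simp [wedgeOfLinear_apply]

/-! ### Expansion in a coframe -/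

@[simp] theorem coframeForm_dualFrame (e : E ≃L[ℝ] (Fin n → ℝ)) (i j : Fin n) :
    coframeForm e i (dualFrame e j) = if i = j then 1 else 0 := by
  simp [coframeForm, dualFrame, Pi.single_apply]

/-- The frame dual to a coframe, as a basis. -/
def frameBasis (e : E ≃L[ℝ] (Fin n → ℝ)) : Module.Basis (Fin n) ℝ E :=
  Module.Basis.ofEquivFun e.toLinearEquiv

@[simp] theorem frameBasis_apply (e : E ≃L[ℝ] (Fin n → ℝ)) (i : Fin n) :
    frameBasis e i = dualFrame e i := by
  simp [frameBasis, dualFrame, Module.Basis.coe_ofEquivFun]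

theorem sum_coframeForm_smul_dualFrame (e : E ≃L[ℝ] (Fin n → ℝ)) (v : E) :
    ∑ i, coframeForm e i v • dualFrame e i = v := by
  conv_rhs => rw [← (frameBasis e).sum_repr v]
  simp [frameBasis, coframeForm, dualFrame, Module.Basis.coe_ofEquivFun]

/-- Two forms which agree on all tuples of vectors of a frame are equal. -/
theorem form_ext (e : E ≃L[ℝ] (Fin n → ℝ)) {k : ℕ} {α β : E [⋀^Fin k]→L[ℝ] ℝ}
    (h : ∀ s : Fin k → Fin n, Function.Injective s →
      (α fun i => dualFrame e (s i)) = β fun i => dualFrame e (s i)) : α = β := by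
  apply ContinuousAlternatingMap.toAlternatingMap_injective
  refine Module.Basis.ext_alternating (frameBasis e) fun s hs => ?_
  simpa using h s hs

theorem elem_apply_dualFrame (e : E ≃L[ℝ] (Fin n → ℝ)) {k : ℕ} (s t : Fin k → Fin n) :
    (elem e s fun i => dualFrame e (t i)) =
      ∑ σ : Equiv.Perm (Fin k), ((Equiv.Perm.sign σ : ℤ) : ℝ) * if s = t ∘ σ then 1 else 0 := by
  rw [elem, wedgeOfLinear_apply]
  refine Finset.sum_congr rfl fun σ _ => ?_
  simp only [coframeForm_dualFrame, funext_iff, Function.comp_apply]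
  rw [Finset.prod_ite_zero]
  simp

/-- On a frame tuple t each permutation of t contributes β(t), the sign from the elementary form
cancelling the sign from β; hence the division by k!. -/
theorem form_eq_sum_elem (e : E ≃L[ℝ] (Fin n → ℝ)) {k : ℕ} (β : E [⋀^Fin k]→L[ℝ] ℝ) :
    β = (k.factorial : ℝ)⁻¹ • ∑ s : Fin k → Fin n, (β fun i => dualFrame e (s i)) • elem e s := by
  refine form_ext e fun t _ => ?_
  have hk : (k.factorial : ℝ) ≠ 0 := by positivity
  rw [ContinuousAlternatingMap.smul_apply, smul_eq_mul, eq_inv_mul_iff_mul_eq₀ hk,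
    ContinuousAlternatingMap.sum_apply]
  simp only [ContinuousAlternatingMap.smul_apply, smul_eq_mul, elem_apply_dualFrame,
    Finset.mul_sum]
  rw [Finset.sum_comm]
  have hσ : ∀ σ : Equiv.Perm (Fin k),
      ∑ s : Fin k → Fin n, (β fun i => dualFrame e (s i)) *
        (((Equiv.Perm.sign σ : ℤ) : ℝ) * if s = t ∘ σ then 1 else 0) =
      β fun i => dualFrame e (t i) := by
    intro σ
    simp only [mul_ite, mul_one, mul_zero, Finset.sum_ite_eq', Finset.mem_univ, if_true]
    have := β.toAlternatingMap.map_perm (fun i => dualFrame e (t i)) σ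
    have h2 : (β fun i => dualFrame e ((t ∘ σ) i)) =
      Equiv.Perm.sign σ • β fun i => dualFrame e (t i) := this
    rw [h2, Units.smul_def, zsmul_eq_mul, mul_right_comm]
    rw [← Int.cast_mul, ← Units.val_mul, Int.units_mul_self]
    simp
  rw [Finset.sum_congr rfl fun σ _ => hσ σ]
  simp [Fintype.card_perm]

/-- Induction principle: forms are linear combinations of elementary forms. -/
theorem form_induction (e : E ≃L[ℝ] (Fin n → ℝ)) {k : ℕ} {P : E [⋀^Fin k]→L[ℝ] ℝ → Prop}
    (hzero : P 0) (helem : ∀ s, P (elem e s)) (hadd : ∀ α β, P α → P β → P (α + β))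
    (hsmul : ∀ (c : ℝ) α, P α → P (c • α)) (β : E [⋀^Fin k]→L[ℝ] ℝ) : P β := by
  rw [form_eq_sum_elem e β]
  exact hsmul _ _ (Finset.sum_induction _ P hadd hzero fun s _ => hsmul _ _ (helem s))

theorem exists_coframe (E : Type*) [NormedAddCommGroup E] [NormedSpace ℝ E]
    [FiniteDimensional ℝ E] : Nonempty (E ≃L[ℝ] (Fin (Module.finrank ℝ E) → ℝ)) :=
  ⟨ContinuousLinearEquiv.ofFinrankEq (by simp)⟩

/-- Induction principle: forms are linear combinations of products of linear forms. -/
theorem form_induction_wedgeOfLinear [FiniteDimensional ℝ E] {k : ℕ}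
    {P : E [⋀^Fin k]→L[ℝ] ℝ → Prop} (hzero : P 0) (hwedge : ∀ θ, P (wedgeOfLinear θ))
    (hadd : ∀ α β, P α → P β → P (α + β)) (hsmul : ∀ (c : ℝ) α, P α → P (c • α))
    (β : E [⋀^Fin k]→L[ℝ] ℝ) : P β := by
  obtain ⟨e⟩ := exists_coframe E
  exact form_induction e hzero (fun s => hwedge _) hadd hsmul β

/-- Both sides are trilinear, and on decomposable forms the claim is associativity of concatenation.
-/
theorem altWedge_assoc [FiniteDimensional ℝ E] {m l : ℕ} (h₁ : p + q = m) (h₂ : m + r = n)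
    (h₃ : q + r = l) (h₄ : p + l = n) (α : E [⋀^Fin p]→L[ℝ] ℝ) (β : E [⋀^Fin q]→L[ℝ] ℝ)
    (γ : E [⋀^Fin r]→L[ℝ] ℝ) :
    altWedge h₂ (altWedge h₁ α β) γ = altWedge h₄ α (altWedge h₃ β γ) := by
  induction α using form_induction_wedgeOfLinear with
  | hzero => simp only [altWedge_zero_left]
  | hadd α α' h h' => simp only [altWedge_add_left, h, h']
  | hsmul c α h => simp only [altWedge_smul_left, h]
  | hwedge a =>
  induction β using form_induction_wedgeOfLinear with
  | hzero => simp only [altWedge_zero_left, altWedge_zero_right]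
  | hadd α α' h h' => simp only [altWedge_add_left, altWedge_add_right, h, h']
  | hsmul c α h => simp only [altWedge_smul_left, altWedge_smul_right, h]
  | hwedge b =>
  induction γ using form_induction_wedgeOfLinear with
  | hzero => simp only [altWedge_zero_right]
  | hadd α α' h h' => simp only [altWedge_add_right, h, h']
  | hsmul c α h => simp only [altWedge_smul_right, h]
  | hwedge c =>
  subst h₁ h₂ h₃
  simp only [altWedge_wedgeOfLinear, Fin.cast_eq_self]
  congr 1
  rw [Fin.append_assoc]
  rfl

theorem wedgeOfLinear_comp_perm {k : ℕ} (θ : Fin k → E →L[ℝ] ℝ) (σ : Equiv.Perm (Fin k)) :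
    wedgeOfLinear (θ ∘ σ) = ((Equiv.Perm.sign σ : ℤ) : ℝ) • wedgeOfLinear θ := by
  ext v
  rw [ContinuousAlternatingMap.smul_apply, wedgeOfLinear_apply_eq_det, wedgeOfLinear_apply_eq_det,
    smul_eq_mul, ← Matrix.det_permute]
  rfl

theorem ofSubsingleton_eq_wedgeOfLinear (θ : E →L[ℝ] ℝ) :
    ContinuousAlternatingMap.ofSubsingleton ℝ E ℝ (0 : Fin 1) θ = wedgeOfLinear ![θ] := by
  ext v
  simp [wedgeOfLinear_apply_eq_det]

theorem oneForm_eq_wedgeOfLinear (α : E [⋀^Fin 1]→L[ℝ] ℝ) : ∃ θ, α = wedgeOfLinear ![θ] := by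
  obtain ⟨θ, rfl⟩ := (ContinuousAlternatingMap.ofSubsingleton ℝ E ℝ (0 : Fin 1)).surjective α
  exact ⟨θ, ofSubsingleton_eq_wedgeOfLinear θ⟩

theorem altWedge_one_comm [FiniteDimensional ℝ E] (h : 1 + q = n) (h' : q + 1 = n)
    (α : E [⋀^Fin 1]→L[ℝ] ℝ) (β : E [⋀^Fin q]→L[ℝ] ℝ) :
    altWedge h α β = (-1 : ℝ) ^ q • altWedge h' β α := by
  obtain ⟨θ, rfl⟩ := oneForm_eq_wedgeOfLinear α
  induction β using form_induction_wedgeOfLinear with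
  | hzero => simp only [altWedge_zero_left, altWedge_zero_right, smul_zero]
  | hadd α α' h h' => simp only [altWedge_add_left, altWedge_add_right, h, h', smul_add]
  | hsmul c α h => simp only [altWedge_smul_left, altWedge_smul_right, h]; rw [smul_comm]
  | hwedge b =>
  subst h'
  have key := wedgeOfLinear_comp_perm (Fin.cons θ b : Fin (q + 1) → E →L[ℝ] ℝ) (finRotate (q + 1))
  rw [sign_finRotate] at key
  have h1 : (fun i => Fin.append ![θ] b (Fin.cast h.symm i)) = Fin.cons θ b := by
    funext i
    rw [Fin.append_left_eq_cons]
    simp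
  have h2 : (fun i => Fin.append b ![θ] (Fin.cast rfl i)) =
      (Fin.cons θ b : Fin (q + 1) → E →L[ℝ] ℝ) ∘ finRotate (q + 1) := by
    funext i
    rw [Fin.append_right_eq_snoc, Fin.snoc_eq_cons_rotate]
    simp
  rw [altWedge_wedgeOfLinear, altWedge_wedgeOfLinear, h1, h2, key, smul_smul]
  push_cast
  rw [← mul_pow]
  simp

theorem wedgeOfLinear_cons {k : ℕ} (h : 1 + k = k + 1) (θ : E →L[ℝ] ℝ) (b : Fin k → E →L[ℝ] ℝ) :
    wedgeOfLinear (Fin.cons θ b : Fin (k + 1) → E →L[ℝ] ℝ) =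
      altWedge h (wedgeOfLinear ![θ]) (wedgeOfLinear b) := by
  rw [altWedge_wedgeOfLinear]
  congr 1
  funext i
  rw [Fin.append_left_eq_cons]
  simp

/-- For decomposable β the linear factors are moved past α one at a time, each move costing (-1)^p.
-/
theorem altWedge_comm [FiniteDimensional ℝ E] (h : p + q = n) (h' : q + p = n)
    (α : E [⋀^Fin p]→L[ℝ] ℝ) (β : E [⋀^Fin q]→L[ℝ] ℝ) :
    altWedge h α β = (-1 : ℝ) ^ (p * q) • altWedge h' β α := by
  induction β using form_induction_wedgeOfLinear with
  | hzero => simp only [altWedge_zero_left, altWedge_zero_right, smul_zero]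
  | hadd α α' h h' => simp only [altWedge_add_left, altWedge_add_right, h, h', smul_add]
  | hsmul c α h => simp only [altWedge_smul_left, altWedge_smul_right, h]; rw [smul_comm]
  | hwedge b =>
  induction q generalizing n with
  | zero =>
    subst h
    induction α using form_induction_wedgeOfLinear with
    | hzero => simp only [altWedge_zero_left, altWedge_zero_right, smul_zero]
    | hadd α α' h h' => simp only [altWedge_add_left, altWedge_add_right, h, h', smul_add]
    | hsmul c α h => simp only [altWedge_smul_left, altWedge_smul_right, h]; rw [smul_comm]
    | hwedge a =>
    rw [altWedge_wedgeOfLinear, altWedge_wedgeOfLinear, mul_zero, pow_zero, one_smul]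
    congr 1
    funext i
    have hb : b = Fin.elim0 := Subsingleton.elim _ _
    rw [hb, Fin.append_elim0, Fin.elim0_append]
    simp
  | succ q ih =>
    obtain ⟨θ, b, rfl⟩ : ∃ θ b', b = (Fin.cons θ b' : Fin (q + 1) → E →L[ℝ] ℝ) :=
      ⟨b 0, Fin.tail b, (Fin.cons_self_tail b).symm⟩
    have h1 : altWedge rfl α (wedgeOfLinear ![θ]) =
        (-1 : ℝ) ^ p • altWedge (n := p + 1) (by omega) (wedgeOfLinear ![θ]) α := by
      rw [altWedge_one_comm (n := p + 1) (by omega) rfl (wedgeOfLinear ![θ]) α, smul_smul,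
        ← mul_pow]
      simp
    rw [wedgeOfLinear_cons (by omega), ← altWedge_assoc (m := p + 1) rfl (by omega), h1,
      altWedge_smul_left, altWedge_assoc (l := p + q) _ _ rfl (by omega),
      ih rfl (by omega), altWedge_smul_right, smul_smul, ← pow_add,
      altWedge_assoc (l := p + q) (by omega) _ (by omega) (by omega)]
    congr 2
    ring

/-! ### Continuity and the exterior product as a continuous bilinear map -/

instance [FiniteDimensional ℝ E] {k : ℕ} : FiniteDimensional ℝ (E [⋀^Fin k]→L[ℝ] ℝ) := by
  let f : (E [⋀^Fin k]→L[ℝ] ℝ) →ₗ[ℝ] MultilinearMap ℝ (fun _ : Fin k => E) ℝ :=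
    { toFun := fun α => α.toMultilinearMap
      map_add' := fun _ _ => rfl
      map_smul' := fun _ _ => rfl }
  refine Module.Finite.of_injective f fun α β hαβ => ?_
  ext v
  exact congrArg (fun g : MultilinearMap ℝ (fun _ : Fin k => E) ℝ => g v) hαβ

/-- The wedge product as a continuous bilinear map. -/
def altWedgeL [FiniteDimensional ℝ E] (h : p + q = n) :
    (E [⋀^Fin p]→L[ℝ] ℝ) →L[ℝ] (E [⋀^Fin q]→L[ℝ] ℝ) →L[ℝ] (E [⋀^Fin n]→L[ℝ] ℝ) :=
  (altWedgeₗ h).toContinuousBilinearMap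

@[simp] theorem altWedgeL_apply [FiniteDimensional ℝ E] (h : p + q = n)
    (α : E [⋀^Fin p]→L[ℝ] ℝ) (β : E [⋀^Fin q]→L[ℝ] ℝ) : altWedgeL h α β = altWedge h α β := rfl

/-- `extDeriv` alternatizes the Fréchet derivative; this is its value on a rank-one derivative. For
decomposable η it is the expansion of a determinant along its first row. A general derivative is a
sum of rank-one maps (`clm_eq_sum_smulRight`). -/
theorem alternatizeUncurryFin_smulRight [FiniteDimensional ℝ E] {k : ℕ} (h : 1 + k = k + 1)
    (θ : E →L[ℝ] ℝ) (η : E [⋀^Fin k]→L[ℝ] ℝ) :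
    ContinuousAlternatingMap.alternatizeUncurryFin (θ.smulRight η) =
      altWedge h (wedgeOfLinear ![θ]) η := by
  induction η using form_induction_wedgeOfLinear with
  | hzero =>
    rw [altWedge_zero_right]; ext v; simp [ContinuousAlternatingMap.alternatizeUncurryFin_apply]
  | hadd α α' h h' =>
    rw [altWedge_add_right, ← h, ← h', ← ContinuousAlternatingMap.alternatizeUncurryFin_add];
        congr 1; ext; simp
  | hsmul c α h =>
    rw [altWedge_smul_right, ← h, ← ContinuousAlternatingMap.alternatizeUncurryFin_smul]; congr 1;
        ext; simp; ring
  | hwedge b =>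
  ext v
  rw [← wedgeOfLinear_cons, ContinuousAlternatingMap.alternatizeUncurryFin_apply,
    wedgeOfLinear_apply_eq_det, Matrix.det_succ_row_zero]
  refine Finset.sum_congr rfl fun i _ => ?_
  simp only [ContinuousLinearMap.smulRight_apply, ContinuousAlternatingMap.smul_apply,
    wedgeOfLinear_apply_eq_det, smul_eq_mul, zsmul_eq_mul, Matrix.of_apply, Fin.cons_zero]
  push_cast
  rw [mul_assoc]
  rfl

theorem clm_eq_sum_smulRight {G : Type*} [NormedAddCommGroup G] [NormedSpace ℝ G]
    (e : E ≃L[ℝ] (Fin n → ℝ)) (A : E →L[ℝ] G) :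
    A = ∑ i, (coframeForm e i).smulRight (A (dualFrame e i)) := by
  ext v
  conv_lhs => rw [← sum_coframeForm_smul_dualFrame e v]
  simp

theorem alternatizeUncurryFin_sum {ι : Type*} (s : Finset ι) {k : ℕ}
    (A : ι → E →L[ℝ] E [⋀^Fin k]→L[ℝ] ℝ) :
    ContinuousAlternatingMap.alternatizeUncurryFin (∑ i ∈ s, A i) =
      ∑ i ∈ s, ContinuousAlternatingMap.alternatizeUncurryFin (A i) :=
  map_sum (ContinuousAlternatingMap.alternatizeUncurryFinCLM ℝ E ℝ) A s

theorem alternatizeUncurryFin_eq_sum [FiniteDimensional ℝ E] {k : ℕ} (h : 1 + k = k + 1)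
    (e : E ≃L[ℝ] (Fin n → ℝ)) (A : E →L[ℝ] E [⋀^Fin k]→L[ℝ] ℝ) :
    ContinuousAlternatingMap.alternatizeUncurryFin A =
      ∑ i, altWedge h (wedgeOfLinear ![coframeForm e i]) (A (dualFrame e i)) := by
  conv_lhs => rw [clm_eq_sum_smulRight e A, alternatizeUncurryFin_sum]
  exact Finset.sum_congr rfl fun i _ => alternatizeUncurryFin_smulRight h _ _

theorem alternatizeUncurryFin_altWedge_left [FiniteDimensional ℝ E] (h : p + q = n)
    (h' : p + 1 + q = n + 1) (A : E →L[ℝ] E [⋀^Fin p]→L[ℝ] ℝ) (β : E [⋀^Fin q]→L[ℝ] ℝ) :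
    ContinuousAlternatingMap.alternatizeUncurryFin (((altWedgeL h).flip β).comp A) =
      altWedge h' (ContinuousAlternatingMap.alternatizeUncurryFin A) β := by
  obtain ⟨e⟩ := exists_coframe E
  rw [alternatizeUncurryFin_eq_sum (add_comm _ _) e, alternatizeUncurryFin_eq_sum (add_comm _ _) e,
    altWedge_sum_left]
  refine Finset.sum_congr rfl fun i _ => ?_
  rw [altWedge_assoc _ _ h (by omega)]
  rfl

/-- The sign in the Leibniz rule: each eⁱ produced by differentiating the second factor has to be
moved past α. -/
theorem alternatizeUncurryFin_altWedge_right [FiniteDimensional ℝ E] (h : p + q = n)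
    (h' : p + (q + 1) = n + 1) (α : E [⋀^Fin p]→L[ℝ] ℝ) (B : E →L[ℝ] E [⋀^Fin q]→L[ℝ] ℝ) :
    ContinuousAlternatingMap.alternatizeUncurryFin ((altWedgeL h α).comp B) =
      (-1 : ℝ) ^ p • altWedge h' α (ContinuousAlternatingMap.alternatizeUncurryFin B) := by
  obtain ⟨e⟩ := exists_coframe E
  rw [alternatizeUncurryFin_eq_sum (add_comm _ _) e, alternatizeUncurryFin_eq_sum (add_comm _ _) e,
    altWedge_sum_right, Finset.smul_sum]
  refine Finset.sum_congr rfl fun i _ => ?_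
  rw [← altWedge_assoc (m := p + 1) rfl (by omega), ContinuousLinearMap.comp_apply,
    altWedgeL_apply, ← altWedge_assoc (m := p + 1) (add_comm _ _) (by omega),
    altWedge_one_comm (add_comm _ _) rfl, altWedge_smul_left]

end Algebra

/-! ### The Hodge star of a coframe and generalized Kronecker symbols -/

section Hodge

variable {E : Type*} [NormedAddCommGroup E] [NormedSpace ℝ E] {p q r n : ℕ}

/-- The metric dual of a vector, for the metric `∑ eⁱ ⊗ eⁱ`. -/
def flat (e : E ≃L[ℝ] (Fin n → ℝ)) (w : E) : E →L[ℝ] ℝ :=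
  ∑ i, coframeForm e i w • coframeForm e i

theorem flat_apply (e : E ≃L[ℝ] (Fin n → ℝ)) (w v : E) :
    flat e w v = ∑ i, coframeForm e i w * coframeForm e i v := by
  simp [flat]

@[simp] theorem flat_dualFrame (e : E ≃L[ℝ] (Fin n → ℝ)) (i : Fin n) :
    flat e (dualFrame e i) = coframeForm e i := by
  simp [flat]

theorem flat_apply_dualFrame (e : E ≃L[ℝ] (Fin n → ℝ)) (w : E) (i : Fin n) :
    flat e w (dualFrame e i) = coframeForm e i w := by
  simp [flat_apply]

/-- `⋆β (w₁, …, wₗ) = (β ∧ w₁♭ ∧ ⋯ ∧ wₗ♭) (b₁, …, bₙ)`. -/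
theorem hodge_apply (e : E ≃L[ℝ] (Fin n → ℝ)) {k l : ℕ} (h : k + l = n)
    (β : E [⋀^Fin k]→L[ℝ] ℝ) (w : Fin l → E) :
    hodge e h β w = altWedge h β (wedgeOfLinear fun j => flat e (w j)) (dualFrame e) := by
  rw [hodge, altWedge_apply, ContinuousAlternatingMap.smul_apply, smul_eq_mul,
    ContinuousAlternatingMap.sum_apply]
  refine congrArg _ (Finset.sum_congr rfl fun σ _ => ?_)
  rw [ContinuousAlternatingMap.smul_apply, smul_eq_mul, mul_assoc]
  congr 2
  rw [elem, wedgeOfLinear_apply_eq_det, wedgeOfLinear_apply_eq_det, ← Matrix.det_transpose]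
  simp only [flat_apply_dualFrame]
  rfl

theorem hodge_apply_dualFrame (e : E ≃L[ℝ] (Fin n → ℝ)) {k l : ℕ} (h : k + l = n)
    (β : E [⋀^Fin k]→L[ℝ] ℝ) (t : Fin l → Fin n) :
    (hodge e h β fun j => dualFrame e (t j)) = altWedge h β (elem e t) (dualFrame e) := by
  simp only [hodge_apply, flat_dualFrame]
  rfl

theorem hodge_add (e : E ≃L[ℝ] (Fin n → ℝ)) {k l : ℕ} (h : k + l = n)
    (α β : E [⋀^Fin k]→L[ℝ] ℝ) : hodge e h (α + β) = hodge e h α + hodge e h β := by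
  ext w
  simp only [hodge_apply, altWedge_add_left, ContinuousAlternatingMap.add_apply]

theorem hodge_smul (e : E ≃L[ℝ] (Fin n → ℝ)) {k l : ℕ} (h : k + l = n)
    (c : ℝ) (β : E [⋀^Fin k]→L[ℝ] ℝ) : hodge e h (c • β) = c • hodge e h β := by
  ext w
  simp only [hodge_apply, altWedge_smul_left, ContinuousAlternatingMap.smul_apply]

/-- The Hodge star as a linear map. -/
def hodgeₗ (e : E ≃L[ℝ] (Fin n → ℝ)) {k l : ℕ} (h : k + l = n) :
    (E [⋀^Fin k]→L[ℝ] ℝ) →ₗ[ℝ] (E [⋀^Fin l]→L[ℝ] ℝ) where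
  toFun := hodge e h
  map_add' := hodge_add e h
  map_smul' := hodge_smul e h

/-- The volume form of a coframe. -/
def vol (e : E ≃L[ℝ] (Fin n → ℝ)) : E [⋀^Fin n]→L[ℝ] ℝ :=
  wedgeOfLinear (coframeForm e)

theorem vol_dualFrame (e : E ≃L[ℝ] (Fin n → ℝ)) : vol e (dualFrame e) = 1 := by
  rw [vol, wedgeOfLinear_apply_eq_det]
  rw [← Matrix.det_one (n := Fin n)]
  congr 1
  ext i j
  simp [Matrix.one_apply]

theorem topForm_apply (e : E ≃L[ℝ] (Fin n → ℝ)) (η : E [⋀^Fin n]→L[ℝ] ℝ) (v : Fin n → E) :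
    η v = η (dualFrame e) * (frameBasis e).det v := by
  have := congrArg (fun f : E [⋀^Fin n]→ₗ[ℝ] ℝ => f v)
    (AlternatingMap.eq_smul_basis_det (frameBasis e) η.toAlternatingMap)
  have h2 : ⇑(frameBasis e) = dualFrame e := funext (frameBasis_apply e)
  rw [h2] at this
  exact this

theorem topForm_eq_smul_vol (e : E ≃L[ℝ] (Fin n → ℝ)) (η : E [⋀^Fin n]→L[ℝ] ℝ) :
    η = η (dualFrame e) • vol e := by
  ext v
  rw [ContinuousAlternatingMap.smul_apply, topForm_apply e η, topForm_apply e (vol e),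
    vol_dualFrame, one_mul, smul_eq_mul]

/-- The Hodge star depends only on the metric and the volume form of the coframe. -/
theorem hodge_congr {e e' : E ≃L[ℝ] (Fin n → ℝ)} (hflat : flat e = flat e')
    (hvol : vol e = vol e') {k l : ℕ} (h : k + l = n) (β : E [⋀^Fin k]→L[ℝ] ℝ) :
    hodge e h β = hodge e' h β := by
  ext w
  rw [hodge_apply, hodge_apply, hflat, topForm_apply e _ (dualFrame e')]
  have := topForm_apply e (vol e) (dualFrame e')
  rw [vol_dualFrame, hvol, vol_dualFrame, one_mul] at this
  rw [← this, mul_one]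

/-! ### Evaluation of elementary forms on frames -/

/-- The generalized Kronecker symbol. -/
def kron : {k : ℕ} → (Fin k → Fin n) → (Fin k → Fin n) → ℤ
  | 0, _, _ => 1
  | k + 1, s, t => ∑ j : Fin (k + 1),
      if s 0 = t j then (-1) ^ (j : ℕ) * kron (fun i => s i.succ) (fun i => t (j.succAbove i)) else 0

/-- `kron` is the Laplace expansion of the determinant of Kronecker deltas, carried out over ℤ. It
turns identities between elementary forms into decidable integer identities. -/
theorem elem_dualFrame (e : E ≃L[ℝ] (Fin n → ℝ)) {k : ℕ} (s t : Fin k → Fin n) :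
    (elem e s fun i => dualFrame e (t i)) = (kron s t : ℝ) := by
  induction k with
  | zero => simp [elem, wedgeOfLinear_apply_eq_det, kron]
  | succ k ih =>
    rw [elem, wedgeOfLinear_apply_eq_det, Matrix.det_succ_row_zero, kron, Int.cast_sum]
    refine Finset.sum_congr rfl fun j _ => ?_
    rw [Matrix.of_apply, coframeForm_dualFrame]
    split_ifs
    · rw [mul_one, Int.cast_mul, ← ih, elem, wedgeOfLinear_apply_eq_det]
      push_cast
      rfl
    · simp

theorem elem_dualFrame_id (e : E ≃L[ℝ] (Fin n → ℝ)) (s : Fin n → Fin n) :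
    elem e s (dualFrame e) = (kron s id : ℝ) :=
  elem_dualFrame e s id

theorem altWedge_elem (e : E ≃L[ℝ] (Fin n → ℝ)) {m : ℕ} (h : p + q = m) (s : Fin p → Fin n)
    (t : Fin q → Fin n) :
    altWedge h (elem e s) (elem e t) = elem e fun i => Fin.append s t (Fin.cast h.symm i) := by
  rw [elem, elem, altWedge_wedgeOfLinear, elem]
  congr 1
  funext i
  generalize Fin.cast h.symm i = j
  induction j using Fin.addCases <;> simp

theorem elem_eq_zero_of_not_injective (e : E ≃L[ℝ] (Fin n → ℝ)) {k : ℕ} {s : Fin k → Fin n}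
    (hs : ¬ Function.Injective s) : elem e s = 0 := by
  simp only [Function.Injective, not_forall] at hs
  obtain ⟨i, j, hij, hne⟩ := hs
  ext v
  rw [elem, wedgeOfLinear_apply_eq_det]
  exact Matrix.det_zero_of_row_eq hne (by ext l; simp [hij])

/-- `(θ ∧ β) (v₀, …, vₖ) = ∑ (-1)ⁱ θ(vᵢ) β(v₀, …, v̂ᵢ, …, vₖ)`. -/
theorem altWedge_one_apply [FiniteDimensional ℝ E] {k : ℕ} (h : 1 + k = k + 1)
    (α : E [⋀^Fin 1]→L[ℝ] ℝ) (β : E [⋀^Fin k]→L[ℝ] ℝ) (v : Fin (k + 1) → E) :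
    altWedge h α β v = ∑ i : Fin (k + 1), (-1 : ℝ) ^ (i : ℕ) *
      (α (fun _ => v i) * β fun j => v (i.succAbove j)) := by
  obtain ⟨θ, rfl⟩ := oneForm_eq_wedgeOfLinear α
  rw [← alternatizeUncurryFin_smulRight, ContinuousAlternatingMap.alternatizeUncurryFin_apply]
  refine Finset.sum_congr rfl fun i _ => ?_
  rw [zsmul_eq_mul, ContinuousLinearMap.smulRight_apply, ContinuousAlternatingMap.smul_apply,
    ← ofSubsingleton_eq_wedgeOfLinear]
  push_cast
  simp only [ContinuousAlternatingMap.ofSubsingleton_apply_apply, smul_eq_mul]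
  rfl

/-! ### Adapted coframes of a `G₂`-form are unique up to `SO(7)` -/

/-- The signs of the terms of the standard `G₂`-form. -/
def g2Sign : Fin 7 → ℤ := ![1, 1, 1, 1, -1, -1, -1]

/-- The multi-indices of the terms of the standard `G₂`-form. -/
def g2Index : Fin 7 → Fin 3 → Fin 7 :=
  ![![0, 1, 6], ![2, 3, 6], ![4, 5, 6], ![0, 2, 4], ![0, 3, 5], ![1, 2, 5], ![1, 3, 4]]

theorem isG2Coframe_iff (e : E ≃L[ℝ] (Fin 7 → ℝ)) (φ : E [⋀^Fin 3]→L[ℝ] ℝ) :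
    IsG2Coframe e φ ↔ φ = ∑ a, (g2Sign a : ℝ) • elem e (g2Index a) := by
  simp only [IsG2Coframe, Fin.sum_univ_seven, g2Sign, g2Index]
  apply Eq.congr rfl
  simp
  module

/-- The coefficient of the volume form in (b_m ⌟ φ) ∧ (b_l ⌟ φ) ∧ φ, expanded over the terms of the
model form; the guards select the terms that survive contraction. -/
theorem g2_contraction_kron : ∀ m l : Fin 7,
    (∑ a, ∑ i : Fin 3, if g2Index a i = m then ∑ b, ∑ j : Fin 3, if g2Index b j = l then ∑ c,
      g2Sign a * (-1) ^ (i : ℕ) * (g2Sign b * (-1) ^ (j : ℕ)) * g2Sign c *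
        kron ![g2Index a (i.succAbove 0), g2Index a (i.succAbove 1), g2Index b (j.succAbove 0),
          g2Index b (j.succAbove 1), g2Index c 0, g2Index c 1, g2Index c 2] id
      else 0 else 0) = if m = l then 6 else 0 := by
  decide +kernel

theorem elem_curryLeft_dualFrame (e : E ≃L[ℝ] (Fin n → ℝ)) {k : ℕ} (s : Fin (k + 1) → Fin n)
    (m : Fin n) : (elem e s).curryLeft (dualFrame e m) =
      ∑ i : Fin (k + 1), if s i = m then (-1 : ℝ) ^ (i : ℕ) • elem e (fun j => s (i.succAbove j))
        else 0 := by
  ext v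
  rw [ContinuousAlternatingMap.curryLeft_apply_apply, elem, wedgeOfLinear_apply_eq_det,
    Matrix.det_succ_column_zero, ContinuousAlternatingMap.sum_apply]
  refine Finset.sum_congr rfl fun i _ => ?_
  rw [Matrix.of_apply, Matrix.vecCons, Fin.cons_zero, coframeForm_dualFrame]
  split_ifs
  · rw [mul_one, ContinuousAlternatingMap.smul_apply, elem, wedgeOfLinear_apply_eq_det]
    rfl
  · simp

end Hodge

/-! ### A G₂-form determines its metric and orientation -/

section G2

variable {E : Type*} [NormedAddCommGroup E] [NormedSpace ℝ E] {p q r n : ℕ}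

/-- The 7-form `(u ⌟ φ) ∧ (v ⌟ φ) ∧ φ`. -/
def g2Contraction (φ : E [⋀^Fin 3]→L[ℝ] ℝ) (u v : E) : E [⋀^Fin 7]→L[ℝ] ℝ :=
  altWedge (p := 4) (q := 3) rfl
    (altWedge (p := 2) (q := 2) rfl (φ.curryLeft u) (φ.curryLeft v)) φ

/-- Evaluation of a form on a tuple of vectors. -/
def evalₗ {k : ℕ} (v : Fin k → E) : (E [⋀^Fin k]→L[ℝ] ℝ) →ₗ[ℝ] ℝ where
  toFun η := η v
  map_add' _ _ := rfl
  map_smul' _ _ := rfl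

theorem evalₗ_apply {k : ℕ} (v : Fin k → E) (η : E [⋀^Fin k]→L[ℝ] ℝ) : evalₗ v η = η v := rfl

theorem map_curryLeft_g2Form {G : Type*} [AddCommGroup G] [Module ℝ G]
    {e : E ≃L[ℝ] (Fin 7 → ℝ)} {φ : E [⋀^Fin 3]→L[ℝ] ℝ} (he : IsG2Coframe e φ)
    (f : (E [⋀^Fin 2]→L[ℝ] ℝ) →ₗ[ℝ] G) (m : Fin 7) :
    f (φ.curryLeft (dualFrame e m)) = ∑ a, ∑ i : Fin 3, if g2Index a i = m then
      ((g2Sign a * (-1) ^ (i : ℕ) : ℤ) : ℝ) • f (elem e fun j => g2Index a (i.succAbove j))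
      else 0 := by
  have h : φ.curryLeft (dualFrame e m) =
      ∑ a, (g2Sign a : ℝ) • (elem e (g2Index a)).curryLeft (dualFrame e m) := by
    ext v
    rw [ContinuousAlternatingMap.curryLeft_apply_apply, (isG2Coframe_iff e φ).1 he,
      ContinuousAlternatingMap.sum_apply, ContinuousAlternatingMap.sum_apply]
    rfl
  rw [h, map_sum]
  refine Finset.sum_congr rfl fun a _ => ?_
  rw [elem_curryLeft_dualFrame, map_smul, map_sum, Finset.smul_sum]
  refine Finset.sum_congr rfl fun i _ => ?_
  split_ifs
  · rw [map_smul, smul_smul]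
    push_cast
    rfl
  · simp

theorem map₂_curryLeft_g2Form {e : E ≃L[ℝ] (Fin 7 → ℝ)} {φ : E [⋀^Fin 3]→L[ℝ] ℝ}
    (he : IsG2Coframe e φ)
    (f : (E [⋀^Fin 2]→L[ℝ] ℝ) →ₗ[ℝ] (E [⋀^Fin 2]→L[ℝ] ℝ) →ₗ[ℝ] ℝ) (m l : Fin 7) :
    f (φ.curryLeft (dualFrame e m)) (φ.curryLeft (dualFrame e l)) =
      ∑ a, ∑ i : Fin 3, if g2Index a i = m then ∑ b, ∑ j : Fin 3, if g2Index b j = l then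
        ((g2Sign a * (-1) ^ (i : ℕ) : ℤ) : ℝ) * (((g2Sign b * (-1) ^ (j : ℕ) : ℤ) : ℝ) *
          f (elem e fun k => g2Index a (i.succAbove k)) (elem e fun k => g2Index b (j.succAbove k)))
        else 0 else 0 := by
  rw [map_curryLeft_g2Form he f m, LinearMap.sum_apply]
  refine Finset.sum_congr rfl fun a _ => ?_
  rw [LinearMap.sum_apply]
  refine Finset.sum_congr rfl fun i _ => ?_
  split_ifs
  · rw [LinearMap.smul_apply, map_curryLeft_g2Form he _ l, Finset.smul_sum]
    refine Finset.sum_congr rfl fun b _ => ?_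
    rw [Finset.smul_sum]
    refine Finset.sum_congr rfl fun j _ => ?_
    split_ifs
    · rw [smul_eq_mul, smul_eq_mul]
    · rw [smul_zero]
  · rw [LinearMap.zero_apply]

theorem altWedge_altWedge_g2Form {e : E ≃L[ℝ] (Fin 7 → ℝ)} {φ : E [⋀^Fin 3]→L[ℝ] ℝ}
    (he : IsG2Coframe e φ) (s t : Fin 2 → Fin 7) :
    altWedge (p := 4) (q := 3) (n := 7) rfl (altWedge (p := 2) (q := 2) rfl (elem e s) (elem e t)) φ
      (dualFrame e) = ∑ c, (g2Sign c : ℝ) * (kron ![s 0, s 1, t 0, t 1, g2Index c 0, g2Index c 1,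
        g2Index c 2] id : ℝ) := by
  conv_lhs => rw [(isG2Coframe_iff e φ).1 he]
  rw [altWedge_sum_right, ContinuousAlternatingMap.sum_apply]
  refine Finset.sum_congr rfl fun c _ => ?_
  rw [altWedge_smul_right, ContinuousAlternatingMap.smul_apply, smul_eq_mul, altWedge_elem,
    altWedge_elem, elem_dualFrame_id]
  refine congrArg (fun s => (g2Sign c : ℝ) * (kron s id : ℝ)) ?_
  funext k
  fin_cases k <;> rfl

theorem g2Contraction_dualFrame {e : E ≃L[ℝ] (Fin 7 → ℝ)} {φ : E [⋀^Fin 3]→L[ℝ] ℝ}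
    (he : IsG2Coframe e φ) (m l : Fin 7) :
    g2Contraction φ (dualFrame e m) (dualFrame e l) = (if m = l then 6 else 0 : ℝ) • vol e := by
  rw [topForm_eq_smul_vol e (g2Contraction _ _ _)]
  refine congrArg (fun c : ℝ => c • vol e) ?_
  have h1 := map₂_curryLeft_g2Form he ((altWedgeₗ rfl).compr₂
    (evalₗ (dualFrame e) ∘ₗ (altWedgeₗ (p := 4) (q := 3) (n := 7) rfl).flip φ)) m l
  simp only [LinearMap.compr₂_apply, LinearMap.comp_apply, LinearMap.flip_apply, altWedgeₗ_apply,
    evalₗ_apply, altWedge_altWedge_g2Form he] at h1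
  rw [g2Contraction, h1]
  have h0 := congrArg (Int.cast : ℤ → ℝ) (g2_contraction_kron m l)
  rw [apply_ite (Int.cast : ℤ → ℝ), Int.cast_zero, Int.cast_ofNat] at h0
  rw [← h0, Int.cast_sum]
  refine Finset.sum_congr rfl fun a _ => ?_
  rw [Int.cast_sum]
  refine Finset.sum_congr rfl fun i _ => ?_
  split_ifs
  · rw [Int.cast_sum]
    refine Finset.sum_congr rfl fun b _ => ?_
    rw [Int.cast_sum]
    refine Finset.sum_congr rfl fun j _ => ?_
    split_ifs
    · rw [Int.cast_sum, Finset.mul_sum, Finset.mul_sum]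
      refine Finset.sum_congr rfl fun c _ => ?_
      push_cast
      ring
    · simp
  · simp

/-- The left side involves φ alone, so metric times volume form is the same for all adapted
coframes. By bilinearity the frame case suffices. -/
theorem g2Contraction_eq {e : E ≃L[ℝ] (Fin 7 → ℝ)} {φ : E [⋀^Fin 3]→L[ℝ] ℝ}
    (he : IsG2Coframe e φ) (u v : E) :
    g2Contraction φ u v = (6 * flat e u v) • vol e := by
  have h : g2Contraction φ u v = ∑ m, ∑ l, (coframeForm e m u * coframeForm e l v) •
      g2Contraction φ (dualFrame e m) (dualFrame e l) := by
    conv_lhs => rw [← sum_coframeForm_smul_dualFrame e u, ← sum_coframeForm_smul_dualFrame e v]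
    simp only [g2Contraction, map_sum, map_smul, altWedge_sum_left, altWedge_sum_right,
      altWedge_smul_left, altWedge_smul_right]
    simp only [Finset.smul_sum]
    rw [Finset.sum_comm]
    simp only [smul_smul, mul_comm]
  rw [h]
  simp only [g2Contraction_dualFrame he, ite_smul, zero_smul, smul_ite, smul_zero, smul_smul,
    Finset.sum_ite_eq, Finset.mem_univ, if_true]
  rw [← Finset.sum_smul, flat_apply, Finset.mul_sum]
  simp only [mul_comm]

/-- Adapted coframes of a `G₂`-form induce the same volume form and the same metric. -/
theorem IsG2Coframe.vol_flat_unique {e e' : E ≃L[ℝ] (Fin 7 → ℝ)} {φ : E [⋀^Fin 3]→L[ℝ] ℝ}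
    (he : IsG2Coframe e φ) (he' : IsG2Coframe e' φ) : vol e = vol e' ∧ flat e = flat e' := by
  have hvol : vol e' = (vol e' (dualFrame e)) • vol e := topForm_eq_smul_vol e (vol e')
  set c := vol e' (dualFrame e) with hc
  have hflat : ∀ u v, flat e u v = c * flat e' u v := by
    intro u v
    have := (g2Contraction_eq he u v).symm.trans (g2Contraction_eq he' u v)
    have := congrArg (fun η : E [⋀^Fin 7]→L[ℝ] ℝ => η (dualFrame e)) this
    simp only [ContinuousAlternatingMap.smul_apply, vol_dualFrame, smul_eq_mul, ← hc] at this
    linarith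
  let P : Matrix (Fin 7) (Fin 7) ℝ := Matrix.of fun i j => coframeForm e' i (dualFrame e j)
  have hP : P.det = c := by rw [hc, vol, wedgeOfLinear_apply_eq_det]
  -- P expresses e' in the frame of e, so PᵀP is the Gram matrix of the metric of e'. Taking
  -- determinants, the scalar contributes c⁷ and the two factors contribute c each, whence c⁹ = 1,
  -- and c = 1 because odd powers are injective on ℝ.
  have hPP : c • (P.transpose * P) = 1 := by
    ext i j
    have := hflat (dualFrame e i) (dualFrame e j)
    rw [flat_dualFrame, coframeForm_dualFrame, flat_apply] at this
    rw [Matrix.one_apply, this]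
    rfl
  have hc9 : c ^ 9 = 1 := by
    have := congrArg Matrix.det hPP
    rw [Matrix.det_smul, Matrix.det_mul, Matrix.det_transpose, hP, Matrix.det_one] at this
    simp only [Fintype.card_fin] at this
    linear_combination this
  have hc1 : c = 1 := by
    have : Odd 9 := by decide
    exact this.strictMono_pow.injective (by simpa using hc9)
  constructor
  · rw [hvol, hc1, one_smul]
  · ext u v
    rw [hflat, hc1, one_mul]

theorem IsG2Coframe.hodge_unique {e e' : E ≃L[ℝ] (Fin 7 → ℝ)} {φ : E [⋀^Fin 3]→L[ℝ] ℝ}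
    (he : IsG2Coframe e φ) (he' : IsG2Coframe e' φ) {k l : ℕ} (h : k + l = 7)
    (β : E [⋀^Fin k]→L[ℝ] ℝ) : hodge e h β = hodge e' h β :=
  hodge_congr (he.vol_flat_unique he').2 (he.vol_flat_unique he').1 h β

theorem IsG2Coframe.g2Hodge_eq {e : E ≃L[ℝ] (Fin 7 → ℝ)} {φ : E [⋀^Fin 3]→L[ℝ] ℝ}
    (he : IsG2Coframe e φ) {k l : ℕ} (h : k + l = 7) (β : E [⋀^Fin k]→L[ℝ] ℝ) :
    g2Hodge φ h β = hodge e h β := by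
  have H : ∃ e : E ≃L[ℝ] (Fin 7 → ℝ), IsG2Coframe e φ := ⟨e, he⟩
  rw [g2Hodge, dif_pos H]
  exact IsG2Coframe.hodge_unique H.choose_spec he h β

end G2

/-! ### Adding one covector to a coframe: the Hodge star of a product -/

section Extension

variable {E : Type*} [NormedAddCommGroup E] [NormedSpace ℝ E]
  {F : Type*} [NormedAddCommGroup F] [NormedSpace ℝ F] {n : ℕ}

theorem eq_of_coframeForm_eq (e : E ≃L[ℝ] (Fin n → ℝ)) {v w : E}
    (h : ∀ i, coframeForm e i v = coframeForm e i w) : v = w :=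
  e.injective (funext h)

/-- The coframe consisting of given linear forms. -/
def coframeOf [FiniteDimensional ℝ E] (θ : Fin n → E →L[ℝ] ℝ) (hn : Module.finrank ℝ E = n)
    (hθ : ∀ v, (∀ i, θ i v = 0) → v = 0) : E ≃L[ℝ] (Fin n → ℝ) :=
  (LinearEquiv.ofInjectiveOfFinrankEq (ContinuousLinearMap.pi θ).toLinearMap
    (LinearMap.ker_eq_bot.1 (LinearMap.ker_eq_bot'.2 fun v hv => hθ v (congrFun hv)))
    (by simp [hn])).toContinuousLinearEquiv

@[simp] theorem coframeForm_coframeOf [FiniteDimensional ℝ E] (θ : Fin n → E →L[ℝ] ℝ)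
    (hn : Module.finrank ℝ E = n) (hθ : ∀ v, (∀ i, θ i v = 0) → v = 0) (i : Fin n) :
    coframeForm (coframeOf θ hn hθ) i = θ i := rfl

/-- Two forms are equal if they agree on frame vectors, the last frame vector appearing at most
once, in the first place. -/
theorem form_ext_last (e' : E ≃L[ℝ] (Fin (n + 1) → ℝ)) {l : ℕ} {α β : E [⋀^Fin (l + 1)]→L[ℝ] ℝ}
    (h₁ : ∀ t : Fin (l + 1) → Fin n, (α fun i => dualFrame e' (t i).castSucc) =
      β fun i => dualFrame e' (t i).castSucc)
    (h₂ : ∀ t : Fin l → Fin n,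
      α (Fin.cons (dualFrame e' (Fin.last n)) fun i => dualFrame e' (t i).castSucc) =
        β (Fin.cons (dualFrame e' (Fin.last n)) fun i => dualFrame e' (t i).castSucc)) :
    α = β := by
  refine form_ext e' fun t ht => ?_
  by_cases hl : ∃ j, t j = Fin.last n
  · obtain ⟨j, hj⟩ := hl
    -- Transposing positions 0 and j brings the last frame vector to the front; injectivity of t
    -- excludes a second occurrence, and both forms change by the same sign.
    have hu : ∀ i : Fin l, t (Equiv.swap 0 j i.succ) ≠ Fin.last n := by
      intro i hi
      have := ht (hi.trans hj.symm)
      rw [Equiv.swap_apply_eq_iff, Equiv.swap_apply_right] at this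
      exact Fin.succ_ne_zero i this
    choose u hu' using fun i => Fin.exists_castSucc_eq.2 (hu i)
    have hperm : (fun i => dualFrame e' (t (Equiv.swap 0 j i))) =
        Fin.cons (dualFrame e' (Fin.last n)) fun i => dualFrame e' (u i).castSucc := by
      funext i
      induction i using Fin.cases with
      | zero => simp [hj]
      | succ i => simp [hu']
    have hα := α.toAlternatingMap.map_perm (fun i => dualFrame e' (t i)) (Equiv.swap 0 j)
    have hβ := β.toAlternatingMap.map_perm (fun i => dualFrame e' (t i)) (Equiv.swap 0 j)
    have h := h₂ u
    rw [← hperm] at h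
    have h3 := hα.symm.trans (Eq.trans h hβ)
    exact smul_left_cancel _ h3
  · push Not at hl
    choose u hu using fun i => Fin.exists_castSucc_eq.2 (hl i)
    simp only [← hu]
    exact h₁ u

/-- `e'` consists of the pullback of the coframe `e` under `π`, followed by `θ`. -/
structure IsExtension (π : E →L[ℝ] F) (e : F ≃L[ℝ] (Fin n → ℝ)) (θ : E →L[ℝ] ℝ)
    (e' : E ≃L[ℝ] (Fin (n + 1) → ℝ)) : Prop where
  castSucc : ∀ i, coframeForm e' (Fin.castSucc i) = (coframeForm e i).comp π
  last : coframeForm e' (Fin.last n) = θ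

namespace IsExtension

variable {π : E →L[ℝ] F} {e : F ≃L[ℝ] (Fin n → ℝ)} {θ : E →L[ℝ] ℝ}
  {e' : E ≃L[ℝ] (Fin (n + 1) → ℝ)}

theorem map_dualFrame_castSucc (H : IsExtension π e θ e') (i : Fin n) : π
    (dualFrame e' i.castSucc) = dualFrame e i := by
  refine eq_of_coframeForm_eq e fun j => ?_
  rw [← ContinuousLinearMap.comp_apply, ← H.castSucc, coframeForm_dualFrame, coframeForm_dualFrame]
  simp

theorem map_dualFrame_last (H : IsExtension π e θ e') : π (dualFrame e' (Fin.last n)) = 0 := by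
  refine eq_of_coframeForm_eq e fun j => ?_
  rw [← ContinuousLinearMap.comp_apply, ← H.castSucc, coframeForm_dualFrame, map_zero,
    if_neg (Fin.castSucc_lt_last j).ne]

theorem form_dualFrame_castSucc (H : IsExtension π e θ e') (i : Fin n) : θ
    (dualFrame e' i.castSucc) = 0 := by
  rw [← H.last, coframeForm_dualFrame, if_neg (Fin.castSucc_lt_last i).ne']

theorem form_dualFrame_last (H : IsExtension π e θ e') : θ (dualFrame e' (Fin.last n)) = 1 := by
  rw [← H.last, coframeForm_dualFrame, if_pos rfl]

theorem elem_castSucc (H : IsExtension π e θ e') {l : ℕ} (t : Fin l → Fin n) :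
    elem e' (fun i => (t i).castSucc) = (elem e t).compContinuousLinearMap π := by
  rw [elem, elem, wedgeOfLinear_compContinuousLinearMap]
  exact congrArg _ (funext fun i => H.castSucc _)

theorem elem_cons_last (H : IsExtension π e θ e') {l : ℕ} (h : 1 + l = l + 1) (t : Fin l → Fin n) :
    elem e' (Fin.cons (Fin.last n) fun i => (t i).castSucc : Fin (l + 1) → Fin (n + 1)) =
      altWedge h (wedgeOfLinear ![θ]) ((elem e t).compContinuousLinearMap π) := by
  rw [← H.elem_castSucc, elem, elem, ← wedgeOfLinear_cons]
  congr 1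
  funext i
  induction i using Fin.cases with
  | zero => simp [H.last]
  | succ i => simp

theorem vol_eq (H : IsExtension π e θ e') (h : n + 1 = n + 1) :
    vol e' = altWedge h ((vol e).compContinuousLinearMap π) (wedgeOfLinear ![θ]) := by
  rw [vol, vol, wedgeOfLinear_compContinuousLinearMap, altWedge_wedgeOfLinear]
  congr 1
  funext i
  rw [Fin.append_right_eq_snoc]
  induction i using Fin.lastCases with
  | last => simp [H.last]
  | cast i => simp [H.castSucc]

theorem altWedge_form_dualFrame (H : IsExtension π e θ e') (h : n + 1 = n + 1)
    (η : F [⋀^Fin n]→L[ℝ] ℝ) :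
    altWedge h (η.compContinuousLinearMap π) (wedgeOfLinear ![θ]) (dualFrame e') =
      η (dualFrame e) := by
  have : η.compContinuousLinearMap π =
      η (dualFrame e) • (vol e).compContinuousLinearMap π := by
    conv_lhs => rw [topForm_eq_smul_vol e η]
    rfl
  rw [this, altWedge_smul_left, ← H.vol_eq, ContinuousAlternatingMap.smul_apply, vol_dualFrame,
    smul_eq_mul, mul_one]

/-- A top-degree form is determined by its value on the frame, and π kills the last frame vector. -/
theorem pullback_top_eq_zero (H : IsExtension π e θ e') (η : F [⋀^Fin (n + 1)]→L[ℝ] ℝ) :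
    η.compContinuousLinearMap π = 0 := by
  rw [topForm_eq_smul_vol e' (η.compContinuousLinearMap π),
    ContinuousAlternatingMap.compContinuousLinearMap_apply,
    ContinuousAlternatingMap.map_coord_zero _ (Fin.last n) H.map_dualFrame_last, zero_smul]

theorem altWedge_pullback_form_zero [FiniteDimensional ℝ E] {k m : ℕ} (h : k + 1 = m)
    (α : E [⋀^Fin k]→L[ℝ] ℝ) (v : Fin m → E) (hv : ∀ i, θ (v i) = 0) :
    altWedge h α (wedgeOfLinear ![θ]) v = 0 := by
  rw [altWedge_apply]
  simp [← ofSubsingleton_eq_wedgeOfLinear, hv]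

theorem form_altWedge_cons (H : IsExtension π e θ e') [FiniteDimensional ℝ E] {l : ℕ}
    (h : 1 + l = l + 1)
    (α : F [⋀^Fin l]→L[ℝ] ℝ) (t : Fin l → Fin n) :
    altWedge h (wedgeOfLinear ![θ]) (α.compContinuousLinearMap π)
      (Fin.cons (dualFrame e' (Fin.last n)) fun i => dualFrame e' (t i).castSucc) =
      α fun i => dualFrame e (t i) := by
  rw [altWedge_one_apply, Fin.sum_univ_succ, Finset.sum_eq_zero]
  · simp [← ofSubsingleton_eq_wedgeOfLinear, H.form_dualFrame_last, Function.comp_def,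
      H.map_dualFrame_castSucc]
  · intro i _
    simp [← ofSubsingleton_eq_wedgeOfLinear, H.form_dualFrame_castSucc]

/-- The sign comes from moving θ past the l-form η to the last place, where it completes the volume
form. -/
theorem altWedge_altWedge_dualFrame (H : IsExtension π e θ e') [FiniteDimensional ℝ E] {k l m : ℕ}
    (h : k + l = n)
    (h₁ : k + 1 = m) (h₂ : m + l = n + 1) (γ : F [⋀^Fin k]→L[ℝ] ℝ) (η : F [⋀^Fin l]→L[ℝ] ℝ) :
    altWedge h₂ (altWedge h₁ (γ.compContinuousLinearMap π) (wedgeOfLinear ![θ]))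
      (η.compContinuousLinearMap π) (dualFrame e') =
      (-1 : ℝ) ^ l * altWedge h γ η (dualFrame e) := by
  rw [altWedge_assoc (l := l + 1) _ _ (by omega) (by omega),
    altWedge_one_comm (n := l + 1) _ rfl, altWedge_smul_right, ← altWedge_assoc h rfl,
    ← altWedge_compContinuousLinearMap, ContinuousAlternatingMap.smul_apply,
    H.altWedge_form_dualFrame, smul_eq_mul]

/-- `⋆(γ ∧ θ) = (-1)ˡ ⋆γ` if `θ` is the last element of an adapted coframe. -/
theorem hodge_altWedge_form (H : IsExtension π e θ e') [FiniteDimensional ℝ E] {k l m : ℕ}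
    (h : k + l = n) (h₁ : k + 1 = m)
    (h₂ : m + l = n + 1) (γ : F [⋀^Fin k]→L[ℝ] ℝ) :
    hodge e' h₂ (altWedge h₁ (γ.compContinuousLinearMap π) (wedgeOfLinear ![θ])) =
      (-1 : ℝ) ^ l • (hodge e h γ).compContinuousLinearMap π := by
  have hcast : ∀ t : Fin l → Fin n,
      (hodge e' h₂ (altWedge h₁ (γ.compContinuousLinearMap π) (wedgeOfLinear ![θ])) fun i =>
        dualFrame e' (t i).castSucc) =
      ((-1 : ℝ) ^ l • (hodge e h γ).compContinuousLinearMap π) fun i =>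
        dualFrame e' (t i).castSucc := by
    intro t
    rw [hodge_apply_dualFrame, H.elem_castSucc, H.altWedge_altWedge_dualFrame h,
      ContinuousAlternatingMap.smul_apply, ContinuousAlternatingMap.compContinuousLinearMap_apply,
      ← hodge_apply_dualFrame, smul_eq_mul]
    simp only [Function.comp_def, H.map_dualFrame_castSucc]
  -- A 0-form has no slot for the last frame vector, so `hcast` already decides the case. Otherwise
  -- both sides vanish when that vector is inserted: on the left θ occurs twice in the wedge, on the
  -- right π kills the vector.
  cases l with
  | zero =>
    refine form_ext e' fun t _ => ?_
    have := hcast Fin.elim0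
    convert this using 2
  | succ l =>
    refine form_ext_last e' hcast fun t => ?_
    have h0 : altWedge (n := l + 1 + 1) (by omega) (wedgeOfLinear ![θ])
        (elem e' (Fin.cons (Fin.last n) fun i => (t i).castSucc : Fin (l + 1) → Fin (n + 1))) =
        0 := by
      rw [← H.last, elem, ← wedgeOfLinear_cons]
      have h1 := elem_eq_zero_of_not_injective e' (s := Fin.cons (Fin.last n)
        (Fin.cons (Fin.last n) fun i => (t i).castSucc : Fin (l + 1) → Fin (n + 1))) (by
          intro hinj
          exact absurd (hinj (a₁ := 0) (a₂ := 1) rfl) (by simp))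
      rw [elem] at h1
      refine Eq.trans (congrArg _ (funext fun i => ?_)) h1
      induction i using Fin.cases <;> rfl
    have h1 : (Fin.cons (dualFrame e' (Fin.last n)) fun i => dualFrame e' (t i).castSucc) =
        fun i => dualFrame e' ((Fin.cons (Fin.last n) fun i => (t i).castSucc :
          Fin (l + 1) → Fin (n + 1)) i) := by
      funext i
      induction i using Fin.cases <;> rfl
    rw [ContinuousAlternatingMap.smul_apply,
      ContinuousAlternatingMap.compContinuousLinearMap_apply,
      ContinuousAlternatingMap.map_coord_zero (hodge e h γ) 0 (by simp [H.map_dualFrame_last]), smul_zero,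
      h1, hodge_apply_dualFrame,
      altWedge_assoc (l := l + 1 + 1) _ _ (by omega) (by omega), h0, altWedge_zero_right]
    rfl

/-- `⋆γ = ⋆γ ∧ θ` if `θ` is the last element of an adapted coframe. -/
theorem hodge_pullback (H : IsExtension π e θ e') [FiniteDimensional ℝ E] {k l m : ℕ}
    (h : k + l = n) (h₁ : l + 1 = m)
    (h₂ : k + m = n + 1) (γ : F [⋀^Fin k]→L[ℝ] ℝ) :
    hodge e' h₂ (γ.compContinuousLinearMap π) =
      altWedge h₁ ((hodge e h γ).compContinuousLinearMap π) (wedgeOfLinear ![θ]) := by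
  subst h₁
  refine form_ext_last e' (fun t => ?_) fun t => ?_
  -- Both sides vanish without the last frame vector: the left is a pulled-back form of degree n +
  -- 1, and on the right θ only meets vectors that it kills.
  · rw [hodge_apply_dualFrame, H.elem_castSucc, ← altWedge_compContinuousLinearMap,
      H.pullback_top_eq_zero, altWedge_pullback_form_zero _ _ _ fun i =>
        H.form_dualFrame_castSucc _]
    rfl
  · have h1 : (Fin.cons (dualFrame e' (Fin.last n)) fun i => dualFrame e' (t i).castSucc) =
        fun i => dualFrame e' ((Fin.cons (Fin.last n) fun i => (t i).castSucc :
          Fin (l + 1) → Fin (n + 1)) i) := by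
      funext i
      induction i using Fin.cases <;> rfl
    have h2 := altWedge_one_comm (by omega) rfl (wedgeOfLinear ![θ])
      ((hodge e h γ).compContinuousLinearMap π)
    have h3 : altWedge rfl ((hodge e h γ).compContinuousLinearMap π) (wedgeOfLinear ![θ]) =
        (-1 : ℝ) ^ l • altWedge (n := l + 1) (by omega) (wedgeOfLinear ![θ])
          ((hodge e h γ).compContinuousLinearMap π) := by
      rw [h2, smul_smul, ← mul_pow]
      simp
    rw [h3, ContinuousAlternatingMap.smul_apply, H.form_altWedge_cons, h1, hodge_apply_dualFrame,
      H.elem_cons_last (by omega), ← altWedge_assoc (m := k + 1) rfl (by omega),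
      H.altWedge_altWedge_dualFrame h, hodge_apply_dualFrame, smul_eq_mul]

end IsExtension

end Extension

/-! ### Model identities for ω, ψ₊ and ψ₋ -/

section SU3Algebra

variable {E : Type*} [NormedAddCommGroup E] [NormedSpace ℝ E] {n : ℕ}

/-- Two forms which agree on all increasing tuples of vectors of a frame are equal. -/
theorem form_ext_strictMono (e : E ≃L[ℝ] (Fin n → ℝ)) {k : ℕ} {α β : E [⋀^Fin k]→L[ℝ] ℝ}
    (h : ∀ s : Fin k → Fin n, StrictMono s →
      (α fun i => dualFrame e (s i)) = β fun i => dualFrame e (s i)) : α = β := by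
  refine form_ext e fun s hs => ?_
  have hmono : StrictMono (s ∘ Tuple.sort s) :=
    (Tuple.monotone_sort s).strictMono_of_injective (hs.comp (Tuple.sort s).injective)
  have hα := α.toAlternatingMap.map_perm (fun i => dualFrame e (s i)) (Tuple.sort s)
  have hβ := β.toAlternatingMap.map_perm (fun i => dualFrame e (s i)) (Tuple.sort s)
  exact smul_left_cancel _ (hα.symm.trans (Eq.trans (h _ hmono) hβ))

theorem hodge_elem_dualFrame (e : E ≃L[ℝ] (Fin n → ℝ)) {k l : ℕ} (h : k + l = n)
    (s : Fin k → Fin n) (t : Fin l → Fin n) :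
    (hodge e h (elem e s) fun i => dualFrame e (t i)) =
      (kron (fun i => Fin.append s t (Fin.cast h.symm i)) id : ℝ) := by
  rw [hodge_apply_dualFrame, altWedge_elem, elem_dualFrame_id]

/-- The multi-indices of the terms of the standard `ω`. -/
def omegaIndex : Fin 3 → Fin 2 → Fin 6 := ![![0, 1], ![2, 3], ![4, 5]]

/-- The multi-indices of the terms of `ω ∧ ω / 2`. -/
def omegaSqIndex : Fin 3 → Fin 4 → Fin 6 := ![![0, 1, 2, 3], ![0, 1, 4, 5], ![2, 3, 4, 5]]

/-- The signs of the terms of the standard `ψ₊`. -/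
def psiSign : Fin 4 → ℤ := ![1, -1, -1, -1]

/-- The multi-indices of the terms of the standard `ψ₊`. -/
def psiPIndex : Fin 4 → Fin 3 → Fin 6 := ![![0, 2, 4], ![0, 3, 5], ![1, 2, 5], ![1, 3, 4]]

/-- The multi-indices of the terms of the standard `ψ₋`. -/
def psiMIndex : Fin 4 → Fin 3 → Fin 6 := ![![1, 3, 5], ![1, 2, 4], ![0, 3, 4], ![0, 2, 5]]

theorem isSU3Coframe_iff (e : E ≃L[ℝ] (Fin 6 → ℝ)) (ω : E [⋀^Fin 2]→L[ℝ] ℝ)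
    (ψp ψm : E [⋀^Fin 3]→L[ℝ] ℝ) : IsSU3Coframe e ω ψp ψm ↔
      ω = ∑ a, elem e (omegaIndex a) ∧
      ψp = ∑ a, (psiSign a : ℝ) • elem e (psiPIndex a) ∧
      ψm = -∑ a, (psiSign a : ℝ) • elem e (psiMIndex a) := by
  simp only [IsSU3Coframe, Fin.sum_univ_three, Fin.sum_univ_four, omegaIndex, psiSign, psiPIndex,
    psiMIndex]
  refine and_congr Iff.rfl (and_congr (Eq.congr rfl ?_) (Eq.congr rfl ?_))
  · simp
    module
  · simp
    module

/-- Coefficient form of ω ∧ ω = 2(e¹²³⁴ + e¹²⁵⁶ + e³⁴⁵⁶). Increasing tuples suffice by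
`form_ext_strictMono`; the next three checks do the same for ⋆ω, ⋆ψ₊ and ⋆ψ₋. -/
theorem omegaSq_kron : ∀ t : Fin 4 → Fin 6, (∀ i : Fin 3, t i.castSucc < t i.succ) →
    ∑ a, ∑ b, kron (Fin.append (omegaIndex a) (omegaIndex b)) t =
      2 * ∑ a, kron (omegaSqIndex a) t := by
  decide +kernel

theorem hodge_omega_kron : ∀ t : Fin 4 → Fin 6, (∀ i : Fin 3, t i.castSucc < t i.succ) →
    ∑ a, kron (n := 6) (Fin.append (omegaIndex a) t) id = ∑ a, kron (omegaSqIndex a) t := by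
  decide +kernel

theorem hodge_psiP_kron : ∀ t : Fin 3 → Fin 6, (∀ i : Fin 2, t i.castSucc < t i.succ) →
    ∑ a, psiSign a * kron (n := 6) (Fin.append (psiPIndex a) t) id =
      -∑ a, psiSign a * kron (psiMIndex a) t := by
  decide +kernel

theorem hodge_psiM_kron : ∀ t : Fin 3 → Fin 6, (∀ i : Fin 2, t i.castSucc < t i.succ) →
    ∑ a, psiSign a * kron (n := 6) (Fin.append (psiMIndex a) t) id =
      ∑ a, psiSign a * kron (psiPIndex a) t := by
  decide +kernel

/-- The complement of a pair of indices. -/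
def complPair (s : Fin 2 → Fin 6) : Fin 4 → Fin 6 :=
  -- At least four indices survive the filter, so the default 0 is never reached.
  fun i => ((List.finRange 6).filter fun a => a ≠ s 0 ∧ a ≠ s 1).getD i 0

/-- The star of e^s is plus or minus the elementary form of the complementary indices;
`hodge_complPair_kron` then says that applying it twice restores e^s with sign +1. -/
theorem hodge_pair_kron : ∀ s : Fin 2 → Fin 6, s 0 < s 1 → ∀ t : Fin 4 → Fin 6,
    (∀ i : Fin 3, t i.castSucc < t i.succ) → kron (n := 6) (Fin.append s t) id =
      kron (n := 6) (Fin.append s (complPair s)) id * kron (complPair s) t := by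
  decide +kernel

theorem hodge_complPair_kron : ∀ s : Fin 2 → Fin 6, s 0 < s 1 → ∀ t : Fin 2 → Fin 6, t 0 < t 1 →
    kron (n := 6) (Fin.append s (complPair s)) id * kron (n := 6) (Fin.append (complPair s) t) id =
      kron s t := by
  decide +kernel

theorem lt_of_strictMono {k : ℕ} {t : Fin (k + 1) → Fin 6} (ht : StrictMono t) :
    ∀ i : Fin k, t i.castSucc < t i.succ :=
  fun i => ht i.castSucc_lt_succ

/-- `⋆⋆ = 1` on 2-forms in dimension 6. -/
theorem hodge_hodge_two (e : E ≃L[ℝ] (Fin 6 → ℝ)) (h : 2 + 4 = 6)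
    (h' : 4 + 2 = 6) (β : E [⋀^Fin 2]→L[ℝ] ℝ) : hodge e h' (hodge e h β) = β := by
  have hlt : ∀ s : Fin 2 → Fin 6, s 0 < s 1 →
      hodge e h' (hodge e h (elem e s)) = elem e s := by
    intro s hs
    have h1 : hodge e h (elem e s) =
        (kron (n := 6) (Fin.append s (complPair s)) id : ℝ) • elem e (complPair s) := by
      refine form_ext_strictMono e fun t ht => ?_
      rw [hodge_elem_dualFrame, ContinuousAlternatingMap.smul_apply, elem_dualFrame, smul_eq_mul,
        ← Int.cast_mul, ← hodge_pair_kron s hs t (lt_of_strictMono ht)]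
      rfl
    refine form_ext_strictMono e fun t ht => ?_
    rw [h1, hodge_smul, ContinuousAlternatingMap.smul_apply, hodge_elem_dualFrame, elem_dualFrame,
      smul_eq_mul, ← hodge_complPair_kron s hs t (ht (by decide)), Int.cast_mul]
    rfl
  induction β using form_induction e with
  | hzero =>
    rw [← zero_smul ℝ (0 : E [⋀^Fin 2]→L[ℝ] ℝ), hodge_smul, hodge_smul, zero_smul, zero_smul]
  | hadd α β hα hβ => rw [hodge_add, hodge_add, hα, hβ]
  | hsmul c α hα => rw [hodge_smul, hodge_smul, hα]
  | helem s =>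
    rcases lt_trichotomy (s 0) (s 1) with hs | hs | hs
    · exact hlt s hs
    · rw [elem_eq_zero_of_not_injective e fun hinj => absurd (hinj hs) (by decide),
        ← zero_smul ℝ (0 : E [⋀^Fin 2]→L[ℝ] ℝ), hodge_smul, hodge_smul, zero_smul, zero_smul]
    · have h2 := hlt (s ∘ Equiv.swap 0 1) (by simpa using hs)
      have h3 : elem e (s ∘ Equiv.swap 0 1) = (-1 : ℝ) • elem e s := by
        have := wedgeOfLinear_comp_perm (fun i => coframeForm e (s i)) (Equiv.swap 0 1)
        rw [Equiv.Perm.sign_swap (by decide)] at this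
        refine Eq.trans this ?_
        push_cast
        rfl
      rw [h3, hodge_smul, hodge_smul] at h2
      exact smul_right_injective _ (by norm_num : (-1 : ℝ) ≠ 0) h2

section Values

variable {e : E ≃L[ℝ] (Fin 6 → ℝ)} {ω : E [⋀^Fin 2]→L[ℝ] ℝ}
  {ψp ψm : E [⋀^Fin 3]→L[ℝ] ℝ}

theorem IsSU3Coframe.omega_wedge_omega (he : IsSU3Coframe e ω ψp ψm) (h : 2 + 2 = 4) :
    altWedge h ω ω = (2 : ℝ) • ∑ a, elem e (omegaSqIndex a) := by
  refine form_ext_strictMono e fun t ht => ?_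
  rw [((isSU3Coframe_iff e ω ψp ψm).1 he).1, altWedge_sum_left, ContinuousAlternatingMap.smul_apply,
    ContinuousAlternatingMap.sum_apply, ContinuousAlternatingMap.sum_apply]
  simp only [altWedge_sum_right, ContinuousAlternatingMap.sum_apply, altWedge_elem, elem_dualFrame]
  have := congrArg (Int.cast : ℤ → ℝ) (omegaSq_kron t (lt_of_strictMono ht))
  push_cast at this
  exact this

theorem IsSU3Coframe.hodge_omega (he : IsSU3Coframe e ω ψp ψm) (h : 2 + 4 = 6) (h' : 2 + 2 = 4) :
    (2 : ℝ) • hodge e h ω = altWedge h' ω ω := by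
  rw [he.omega_wedge_omega]
  refine congrArg _ (form_ext_strictMono e fun t ht => ?_)
  rw [((isSU3Coframe_iff e ω ψp ψm).1 he).1]
  change hodgeₗ e h _ _ = _
  rw [map_sum, ContinuousAlternatingMap.sum_apply, ContinuousAlternatingMap.sum_apply]
  have := congrArg (Int.cast : ℤ → ℝ) (hodge_omega_kron t (lt_of_strictMono ht))
  push_cast at this
  simp only [elem_dualFrame]
  rw [← this]
  exact Finset.sum_congr rfl fun a _ => hodge_elem_dualFrame e h _ _

theorem IsSU3Coframe.hodge_omega_wedge_omega (he : IsSU3Coframe e ω ψp ψm) (h : 4 + 2 = 6)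
    (h' : 2 + 2 = 4) : hodge e h (altWedge h' ω ω) = (2 : ℝ) • ω := by
  rw [← he.hodge_omega (by omega), hodge_smul, hodge_hodge_two]

theorem IsSU3Coframe.hodge_psiP (he : IsSU3Coframe e ω ψp ψm) (h : 3 + 3 = 6) :
    hodge e h ψp = ψm := by
  refine form_ext_strictMono e fun t ht => ?_
  rw [((isSU3Coframe_iff e ω ψp ψm).1 he).2.1, ((isSU3Coframe_iff e ω ψp ψm).1 he).2.2]
  change hodgeₗ e h _ _ = _
  rw [map_sum, ContinuousAlternatingMap.sum_apply, ContinuousAlternatingMap.neg_apply,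
    ContinuousAlternatingMap.sum_apply]
  have := congrArg (Int.cast : ℤ → ℝ) (hodge_psiP_kron t (lt_of_strictMono ht))
  push_cast at this
  simp only [map_smul, ContinuousAlternatingMap.smul_apply, elem_dualFrame, smul_eq_mul]
  rw [← this]
  exact Finset.sum_congr rfl fun a _ => congrArg _ (hodge_elem_dualFrame e h _ _)

theorem IsSU3Coframe.hodge_psiM (he : IsSU3Coframe e ω ψp ψm) (h : 3 + 3 = 6) :
    hodge e h ψm = -ψp := by
  refine form_ext_strictMono e fun t ht => ?_
  rw [((isSU3Coframe_iff e ω ψp ψm).1 he).2.1, ((isSU3Coframe_iff e ω ψp ψm).1 he).2.2]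
  change hodgeₗ e h _ _ = _
  rw [map_neg, map_sum, ContinuousAlternatingMap.neg_apply, ContinuousAlternatingMap.neg_apply,
    ContinuousAlternatingMap.sum_apply, ContinuousAlternatingMap.sum_apply]
  have := congrArg (Int.cast : ℤ → ℝ) (hodge_psiM_kron t (lt_of_strictMono ht))
  push_cast at this
  simp only [map_smul, ContinuousAlternatingMap.smul_apply, elem_dualFrame, smul_eq_mul]
  rw [← this]
  exact congrArg _ (Finset.sum_congr rfl fun a _ => congrArg _ (hodge_elem_dualFrame e h _ _))

/-- Each term of ψ₊ takes one index from each pair of ω, so every product of terms repeats an index.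
-/
theorem IsSU3Coframe.psiP_wedge_omega (he : IsSU3Coframe e ω ψp ψm) (h : 3 + 2 = 5) :
    altWedge h ψp ω = 0 := by
  rw [((isSU3Coframe_iff e ω ψp ψm).1 he).1, ((isSU3Coframe_iff e ω ψp ψm).1 he).2.1,
    altWedge_sum_left]
  refine Finset.sum_eq_zero fun a _ => ?_
  rw [altWedge_sum_right]
  refine Finset.sum_eq_zero fun b _ => ?_
  have : ∀ (h : 5 = 3 + 2) (a : Fin 4) (b : Fin 3), ¬ Function.Injective
      fun i => Fin.append (psiPIndex a) (omegaIndex b) (Fin.cast h i) := by decide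
  rw [altWedge_smul_left, altWedge_elem, elem_eq_zero_of_not_injective e (this h.symm a b),
    smul_zero]

/-- Wedging 1-forms with `ω ∧ ω` is injective. -/
theorem IsSU3Coframe.eq_zero_of_wedge_omega_wedge_omega [FiniteDimensional ℝ E]
    (he : IsSU3Coframe e ω ψp ψm)
    (h : 1 + 4 = 5) (h' : 2 + 2 = 4) {ν : E [⋀^Fin 1]→L[ℝ] ℝ}
    (hν : altWedge h ν (altWedge h' ω ω) = 0) : ν = 0 := by
  -- Row j is j followed by the two pairs of ω not containing j. Evaluating ν ∧ ω² there leaves only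
  -- the splitting with j in the slot of ν, which gives twice the coefficient of eʲ.
  let c : Fin 6 → Fin 5 → Fin 6 := ![![0, 2, 3, 4, 5], ![1, 2, 3, 4, 5], ![2, 0, 1, 4, 5],
    ![3, 0, 1, 4, 5], ![4, 0, 1, 2, 3], ![5, 0, 1, 2, 3]]
  have hk : ∀ (j : Fin 6) (i : Fin 5), ∑ a, kron (omegaSqIndex a) (fun k => c j (i.succAbove k)) =
      if i = 0 then 1 else 0 := by decide +kernel
  refine form_ext e fun s _ => ?_
  have h1 := congrArg (fun α : E [⋀^Fin 5]→L[ℝ] ℝ => α fun i => dualFrame e (c (s 0) i)) hν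
  simp only [altWedge_one_apply, he.omega_wedge_omega, ContinuousAlternatingMap.smul_apply,
    ContinuousAlternatingMap.sum_apply, elem_dualFrame, ← Int.cast_sum, hk] at h1
  rw [Finset.sum_eq_single 0 (by intro i _ hi; simp [hi]) (by simp)] at h1
  have hc : ∀ j, c j 0 = j := by decide
  rw [hc] at h1
  have h2 : (fun _ : Fin 1 => dualFrame e (s 0)) = fun i => dualFrame e (s i) := by
    funext i
    rw [Subsingleton.elim i 0]
  rw [h2] at h1
  simpa using h1

end Values

end SU3Algebra

/-! ### Independence of the components of dψ₊ -/

section TorsionAlgebra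

variable {E : Type*} [NormedAddCommGroup E] [NormedSpace ℝ E] {n : ℕ}
  {e : E ≃L[ℝ] (Fin 6 → ℝ)} {ω : E [⋀^Fin 2]→L[ℝ] ℝ} {ψp ψm : E [⋀^Fin 3]→L[ℝ] ℝ}

theorem hodge_zero (e : E ≃L[ℝ] (Fin n → ℝ)) {k l : ℕ} (h : k + l = n) :
    hodge e h (0 : E [⋀^Fin k]→L[ℝ] ℝ) = 0 := by
  rw [← zero_smul ℝ (0 : E [⋀^Fin k]→L[ℝ] ℝ), hodge_smul, zero_smul]

theorem IsSU3Coframe.elem_wedge_omega (he : IsSU3Coframe e ω ψp ψm) (h : 2 + 2 = 4)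
    (s : Fin 2 → Fin 6) (t : Fin 4 → Fin 6) :
    (altWedge h (elem e s) ω fun i => dualFrame e (t i)) =
      (∑ b, kron (Fin.append s (omegaIndex b)) t : ℤ) := by
  rw [((isSU3Coframe_iff e ω ψp ψm).1 he).1, altWedge_sum_right,
    ContinuousAlternatingMap.sum_apply, Int.cast_sum]
  refine Finset.sum_congr rfl fun b _ => ?_
  rw [altWedge_elem, elem_dualFrame]
  rfl

theorem IsSU3Coframe.elem_wedge_psiP (he : IsSU3Coframe e ω ψp ψm) (h : 1 + 3 = 4)
    (s : Fin 1 → Fin 6) (t : Fin 4 → Fin 6) :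
    (altWedge h (elem e s) ψp fun i => dualFrame e (t i)) =
      (∑ b, psiSign b * kron (Fin.append s (psiPIndex b)) t : ℤ) := by
  rw [((isSU3Coframe_iff e ω ψp ψm).1 he).2.1, altWedge_sum_right,
    ContinuousAlternatingMap.sum_apply, Int.cast_sum]
  refine Finset.sum_congr rfl fun b _ => ?_
  rw [altWedge_smul_right, altWedge_elem, ContinuousAlternatingMap.smul_apply, elem_dualFrame,
    Int.cast_mul]
  rfl

theorem IsSU3Coframe.omegaSq_dualFrame (he : IsSU3Coframe e ω ψp ψm) (h : 2 + 2 = 4)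
    (t : Fin 4 → Fin 6) : (altWedge h ω ω fun i => dualFrame e (t i)) =
      (2 * ∑ a, kron (omegaSqIndex a) t : ℤ) := by
  rw [he.omega_wedge_omega, ContinuousAlternatingMap.smul_apply,
    ContinuousAlternatingMap.sum_apply]
  simp only [elem_dualFrame]
  push_cast
  rfl

/-- A linear functional of `σ ∧ ω` which vanishes if `⋆σ = -σ ∧ ω`, by a finite computation. -/
theorem IsSU3Coframe.sum_wedge_omega_eq_zero (he : IsSU3Coframe e ω ψp ψm) (h : 2 + 4 = 6)
    (h' : 2 + 2 = 4) {m : ℕ} (x : Fin m → ℤ) (t : Fin m → Fin 4 → Fin 6) (y : ℤ)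
    (u : Fin 4 → Fin 6)
    (hcert : ∀ s : Fin 2 → Fin 6, ∑ k, x k * ∑ b, kron (Fin.append s (omegaIndex b)) (t k) =
      y * (kron (n := 6) (Fin.append s u) id + ∑ b, kron (Fin.append s (omegaIndex b)) u))
    {σ : E [⋀^Fin 2]→L[ℝ] ℝ} (hσ : hodge e h σ = -altWedge h' σ ω) :
    ∑ k, (x k : ℝ) * altWedge h' σ ω (fun i => dualFrame e (t k i)) = 0 := by
  have key : ∀ σ : E [⋀^Fin 2]→L[ℝ] ℝ,
      ∑ k, (x k : ℝ) * altWedge h' σ ω (fun i => dualFrame e (t k i)) =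
        y * ((hodge e h σ + altWedge h' σ ω) fun i => dualFrame e (u i)) := by
    intro σ
    induction σ using form_induction e with
    | hzero =>
      rw [hodge_zero]
      simp [altWedge_zero_left]
    | hadd α β hα hβ =>
      rw [hodge_add, altWedge_add_left, add_add_add_comm, ContinuousAlternatingMap.add_apply,
        mul_add, ← hα, ← hβ, ← Finset.sum_add_distrib]
      exact Finset.sum_congr rfl fun k _ => by
        rw [ContinuousAlternatingMap.add_apply, mul_add]
    | hsmul c α hα =>
      rw [hodge_smul, altWedge_smul_left, ← smul_add, ContinuousAlternatingMap.smul_apply,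
        smul_eq_mul, mul_left_comm, ← hα, Finset.mul_sum]
      exact Finset.sum_congr rfl fun k _ => by
        rw [ContinuousAlternatingMap.smul_apply, smul_eq_mul, mul_left_comm]
    | helem s =>
      have hc := congrArg (Int.cast : ℤ → ℝ) (hcert s)
      rw [Int.cast_sum, Int.cast_mul, Int.cast_add] at hc
      simp only [he.elem_wedge_omega, ContinuousAlternatingMap.add_apply, hodge_elem_dualFrame]
      simp only [Int.cast_mul] at hc
      exact hc
  rw [key, hσ, neg_add_cancel]
  simp

/-- Index tuples detecting the coefficients of a 1-form `π` in `π ∧ ψ₊`. -/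
def detectIndex : Fin 6 → Fin 2 → Fin 4 → Fin 6 :=
  ![![![0, 1, 2, 5], ![0, 1, 3, 4]], ![![0, 1, 2, 4], ![0, 1, 3, 5]],
    ![![0, 2, 3, 5], ![1, 2, 3, 4]], ![![0, 2, 3, 4], ![1, 2, 3, 5]],
    ![![0, 3, 4, 5], ![1, 2, 4, 5]], ![![0, 2, 4, 5], ![1, 3, 4, 5]]]

/-- Signs detecting the coefficients of a 1-form `π` in `π ∧ ψ₊`. -/
def detectSign : Fin 6 → Fin 2 → ℤ :=
  ![![-1, -1], ![-1, 1], ![1, 1], ![1, -1], ![-1, -1], ![-1, 1]]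

/-- For each j, a signed sum of two coefficients isolates the j-th coefficient of π: it gives 2π_j
on π ∧ ψ₊, 0 on ω² (`detect_omegaSq_kron`), and on σ ∧ ω a multiple of one coefficient of ⋆σ + σ ∧ ω
(`detect_omega_kron`), which vanishes for σ in Ω²₈. -/
theorem detect_psiP_kron : ∀ (j : Fin 6) (s : Fin 1 → Fin 6), ∑ k, detectSign j k *
    ∑ b, psiSign b * kron (Fin.append s (psiPIndex b)) (detectIndex j k) =
      2 * kron s fun _ => j := by
  decide +kernel

theorem detect_omegaSq_kron : ∀ (j : Fin 6) (k : Fin 2),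
    ∑ a, kron (omegaSqIndex a) (detectIndex j k) = 0 := by
  decide +kernel

theorem detect_omega_kron : ∀ (j : Fin 6) (s : Fin 2 → Fin 6), ∑ k, detectSign j k *
    ∑ b, kron (Fin.append s (omegaIndex b)) (detectIndex j k) =
      detectSign j 1 * (kron (n := 6) (Fin.append s (detectIndex j 1)) id +
        ∑ b, kron (Fin.append s (omegaIndex b)) (detectIndex j 1)) := by
  decide +kernel

/-- The sum of the three coefficients of σ ∧ ω along the terms of ω² is twice the trace σ₁₂ + σ₃₄ +
σ₅₆, which is also a coefficient of ⋆σ + σ ∧ ω. This functional is zero on π ∧ ψ₊ and nonzero on ω²,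
so it isolates the coefficient of ω². -/
theorem trace_omega_kron : ∀ s : Fin 2 → Fin 6, ∑ k : Fin 3, 1 *
    ∑ b, kron (Fin.append s (omegaIndex b)) (omegaSqIndex k) =
      2 * (kron (n := 6) (Fin.append s (omegaSqIndex 2)) id +
        ∑ b, kron (Fin.append s (omegaIndex b)) (omegaSqIndex 2)) := by
  decide +kernel

theorem trace_psiP_kron : ∀ (s : Fin 1 → Fin 6) (k : Fin 3),
    ∑ b, psiSign b * kron (Fin.append s (psiPIndex b)) (omegaSqIndex k) = 0 := by
  decide +kernel

theorem trace_omegaSq_kron : ∀ k : Fin 3, ∑ a, kron (omegaSqIndex a) (omegaSqIndex k) = 1 := by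
  decide +kernel

theorem IsSU3Coframe.sum_wedge_psiP_eq (he : IsSU3Coframe e ω ψp ψm) (h : 1 + 3 = 4)
    {m : ℕ} (x : Fin m → ℤ) (t : Fin m → Fin 4 → Fin 6) (y : ℤ) (j : Fin 6)
    (hcert : ∀ s : Fin 1 → Fin 6, ∑ k, x k * ∑ b, psiSign b *
      kron (Fin.append s (psiPIndex b)) (t k) = y * kron s fun _ => j)
    (π : E [⋀^Fin 1]→L[ℝ] ℝ) :
    ∑ k, (x k : ℝ) * altWedge h π ψp (fun i => dualFrame e (t k i)) =
      y * π fun _ => dualFrame e j := by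
  induction π using form_induction e with
  | hzero => simp [altWedge_zero_left]
  | hadd α β hα hβ =>
    rw [altWedge_add_left, ContinuousAlternatingMap.add_apply, mul_add, ← hα, ← hβ,
      ← Finset.sum_add_distrib]
    exact Finset.sum_congr rfl fun k _ => by rw [ContinuousAlternatingMap.add_apply, mul_add]
  | hsmul c α hα =>
    rw [altWedge_smul_left, ContinuousAlternatingMap.smul_apply, smul_eq_mul, mul_left_comm, ← hα,
      Finset.mul_sum]
    exact Finset.sum_congr rfl fun k _ => by
      rw [ContinuousAlternatingMap.smul_apply, smul_eq_mul, mul_left_comm]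
  | helem s =>
    have hc := congrArg (Int.cast : ℤ → ℝ) (hcert s)
    rw [Int.cast_sum, Int.cast_mul] at hc
    simp only [he.elem_wedge_psiP, elem_dualFrame e s fun _ => j]
    simp only [Int.cast_mul] at hc
    exact hc

/-- The torsion components of `dψ₊` are independent. -/
theorem IsSU3Coframe.eq_zero_of_torsion_eq_zero (he : IsSU3Coframe e ω ψp ψm)
    (h : 2 + 4 = 6) (h' : 2 + 2 = 4) (h'' : 1 + 3 = 4) {c : ℝ} {π : E [⋀^Fin 1]→L[ℝ] ℝ}
    {σ : E [⋀^Fin 2]→L[ℝ] ℝ} (hσ : hodge e h σ = -altWedge h' σ ω)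
    (hsum : c • altWedge h' ω ω + altWedge h'' π ψp - altWedge h' σ ω = 0) :
    c = 0 ∧ π = 0 ∧ σ = 0 := by
  have hval : ∀ t : Fin 4 → Fin 6, (altWedge h' σ ω fun i => dualFrame e (t i)) =
      c * (2 * ∑ a, kron (omegaSqIndex a) t : ℤ) +
        altWedge h'' π ψp fun i => dualFrame e (t i) := by
    intro t
    have := congrArg (fun α : E [⋀^Fin 4]→L[ℝ] ℝ => α fun i => dualFrame e (t i))
      (sub_eq_zero.1 hsum)
    simp only [ContinuousAlternatingMap.add_apply, ContinuousAlternatingMap.smul_apply,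
      smul_eq_mul, he.omegaSq_dualFrame] at this
    exact this.symm
  -- The trace functional annihilates σ ∧ ω and π ∧ ψ₊ and takes the value 6c on c ω².
  have hc : c = 0 := by
    have h1 := he.sum_wedge_omega_eq_zero h h' (fun _ => 1) omegaSqIndex 2 _ trace_omega_kron hσ
    have h2 := he.sum_wedge_psiP_eq h'' (fun _ => 1) omegaSqIndex 0 0
      (fun s => by simp only [trace_psiP_kron]; simp) π
    simp only [hval, trace_omegaSq_kron, mul_add, Finset.sum_add_distrib, h2] at h1
    norm_num at h1
    exact h1
  have hπ : π = 0 := by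
    refine form_ext e fun s _ => ?_
    have h1 := he.sum_wedge_omega_eq_zero h h' _ _ _ _ (detect_omega_kron (s 0)) hσ
    have h2 := he.sum_wedge_psiP_eq h'' _ _ 2 (s 0) (detect_psiP_kron (s 0)) π
    simp only [hval, detect_omegaSq_kron, mul_add, Finset.sum_add_distrib, h2] at h1
    have h3 : (fun i => dualFrame e (s i)) = fun _ => dualFrame e (s 0) := by
      funext i
      rw [Subsingleton.elim i 0]
    rw [h3]
    norm_num at h1
    simpa using h1
  refine ⟨hc, hπ, ?_⟩
  -- What is left of the relation is -σ ∧ ω = ⋆σ = 0, and σ = ⋆⋆σ.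
  rw [hc, hπ, altWedge_zero_left, zero_smul, zero_add, zero_sub, ← hσ] at hsum
  rw [← hodge_hodge_two e h (by omega) σ, hsum, hodge_zero]

end TorsionAlgebra

/-! ### From SU(3)-coframes to G₂-coframes -/

section Warped

variable {E : Type*} [NormedAddCommGroup E] [NormedSpace ℝ E] {F : Type*} [NormedAddCommGroup F]
  [NormedSpace ℝ F]

theorem exists_isExtension [FiniteDimensional ℝ E] {n : ℕ} (hn : Module.finrank ℝ E = n + 1)
    (π : E →L[ℝ] F) (e : F ≃L[ℝ] (Fin n → ℝ)) (θ : E →L[ℝ] ℝ)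
    (hker : ∀ v, π v = 0 → θ v = 0 → v = 0) : ∃ e', IsExtension π e θ e' := by
  refine ⟨coframeOf (Fin.snoc (fun i => (coframeForm e i).comp π) θ) hn fun v hv => ?_, ?_, ?_⟩
  · refine hker v (eq_of_coframeForm_eq e fun i => ?_) ?_
    · simpa using hv i.castSucc
    · simpa using hv (Fin.last n)
  · intro i
    rw [coframeForm_coframeOf, Fin.snoc_castSucc]
  · rw [coframeForm_coframeOf, Fin.snoc_last]

variable {π : E →L[ℝ] F} {e : F ≃L[ℝ] (Fin 6 → ℝ)} {θ : E →L[ℝ] ℝ} {e' : E ≃L[ℝ] (Fin 7 → ℝ)}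
  {ω : F [⋀^Fin 2]→L[ℝ] ℝ} {ψp ψm : F [⋀^Fin 3]→L[ℝ] ℝ}

theorem IsSU3Coframe.isG2Coframe (he : IsSU3Coframe e ω ψp ψm) (H : IsExtension π e θ e')
    (h : 2 + 1 = 3) : IsG2Coframe e' (altWedge h (ω.compContinuousLinearMap π)
      (wedgeOfLinear ![θ]) + ψp.compContinuousLinearMap π) := by
  obtain ⟨hω, hp, -⟩ := he
  have h0 : coframeForm e' 0 = (coframeForm e 0).comp π := H.castSucc 0
  have h1 : coframeForm e' 1 = (coframeForm e 1).comp π := H.castSucc 1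
  have h2 : coframeForm e' 2 = (coframeForm e 2).comp π := H.castSucc 2
  have h3 : coframeForm e' 3 = (coframeForm e 3).comp π := H.castSucc 3
  have h4 : coframeForm e' 4 = (coframeForm e 4).comp π := H.castSucc 4
  have h5 : coframeForm e' 5 = (coframeForm e 5).comp π := H.castSucc 5
  have h6 : coframeForm e' 6 = θ := H.last
  have hw : ∀ i j : Fin 6, altWedge h ((elem e ![i, j]).compContinuousLinearMap π)
      (wedgeOfLinear ![θ]) =
      wedgeOfLinear ![(coframeForm e i).comp π, (coframeForm e j).comp π, θ] := by
    intro i j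
    rw [elem, wedgeOfLinear_compContinuousLinearMap, altWedge_wedgeOfLinear]
    congr 1
    funext k
    fin_cases k <;> rfl
  have he' : ∀ i j k : Fin 7, elem e' ![i, j, k] =
      wedgeOfLinear ![coframeForm e' i, coframeForm e' j, coframeForm e' k] := by
    intro i j k
    rw [elem]
    congr 1
    funext l
    fin_cases l <;> rfl
  have hl : ∀ i j k : Fin 6, (elem e ![i, j, k]).compContinuousLinearMap π =
      wedgeOfLinear ![(coframeForm e i).comp π, (coframeForm e j).comp π,
        (coframeForm e k).comp π] := by
    intro i j k
    rw [elem, wedgeOfLinear_compContinuousLinearMap]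
    congr 1
    funext l
    fin_cases l <;> rfl
  have hpl : ψp.compContinuousLinearMap π = (elem e ![0, 2, 4]).compContinuousLinearMap π -
      (elem e ![0, 3, 5]).compContinuousLinearMap π - (elem e ![1, 2, 5]).compContinuousLinearMap π -
      (elem e ![1, 3, 4]).compContinuousLinearMap π := by
    rw [hp]
    rfl
  have hωl : ω.compContinuousLinearMap π = (elem e ![0, 1]).compContinuousLinearMap π +
      (elem e ![2, 3]).compContinuousLinearMap π + (elem e ![4, 5]).compContinuousLinearMap π := by
    rw [hω]
    rfl
  rw [IsG2Coframe, hpl, hωl, altWedge_add_left, altWedge_add_left]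
  simp only [hw, he', hl, h0, h1, h2, h3, h4, h5, h6]
  abel

/-- Rotating the phase of an `SU(3)`-structure by `π / 2`. -/
theorem IsSU3Coframe.exists_rotation (he : IsSU3Coframe e ω ψp ψm) :
    ∃ e₁ : F ≃L[ℝ] (Fin 6 → ℝ), IsSU3Coframe e₁ ω (-ψm) ψp ∧ vol e = vol e₁ ∧
      flat e = flat e₁ := by
  have : FiniteDimensional ℝ F := e.symm.toLinearEquiv.finiteDimensional
  have hfin : Module.finrank ℝ F = 6 := by
    rw [e.toLinearEquiv.finrank_eq]
    simp
  obtain ⟨hω, hp, hm⟩ := he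
  -- This multiplies e¹ + ie² by i, hence ψ₊ + iψ₋ by i, and leaves ω, the metric and the volume
  -- form unchanged.
  let θ : Fin 6 → F →L[ℝ] ℝ := ![-coframeForm e 1, coframeForm e 0, coframeForm e 2,
    coframeForm e 3, coframeForm e 4, coframeForm e 5]
  have hθ : ∀ v, (∀ i, θ i v = 0) → v = 0 := by
    intro v hv
    refine eq_of_coframeForm_eq e fun i => ?_
    rw [map_zero]
    fin_cases i
    · exact hv 1
    · exact neg_eq_zero.1 (hv 0)
    · exact hv 2
    · exact hv 3
    · exact hv 4
    · exact hv 5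
  refine ⟨coframeOf θ hfin hθ, ⟨?_, ?_, ?_⟩, ?_, ?_⟩
  · rw [hω]
    ext v
    simp [θ, elem, wedgeOfLinear_apply_eq_det, Matrix.det_fin_two]
    ring
  · rw [hm]
    ext v
    simp [θ, elem, wedgeOfLinear_apply_eq_det, Matrix.det_fin_three]
    ring
  · rw [hp]
    ext v
    simp [θ, elem, wedgeOfLinear_apply_eq_det, Matrix.det_fin_three]
    ring
  · have hv : ∀ a b : F →L[ℝ] ℝ, wedgeOfLinear ![a, b, coframeForm e 2,
        coframeForm e 3, coframeForm e 4, coframeForm e 5] =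
        altWedge (n := 6) rfl (wedgeOfLinear ![a, b]) (wedgeOfLinear ![coframeForm e 2,
          coframeForm e 3, coframeForm e 4, coframeForm e 5]) := by
      intro a b
      rw [altWedge_wedgeOfLinear]
      congr 1
      funext l
      fin_cases l <;> rfl
    have h1 : vol (coframeOf θ hfin hθ) = wedgeOfLinear ![-coframeForm e 1, coframeForm e 0,
        coframeForm e 2, coframeForm e 3, coframeForm e 4, coframeForm e 5] := rfl
    have h2 : vol e = wedgeOfLinear ![coframeForm e 0, coframeForm e 1,
        coframeForm e 2, coframeForm e 3, coframeForm e 4, coframeForm e 5] := by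
      rw [vol]
      congr 1
      funext l
      fin_cases l <;> rfl
    rw [h1, h2, hv, hv]
    congr 1
    ext v
    simp [wedgeOfLinear_apply_eq_det, Matrix.det_fin_two]
    ring
  · ext u v
    simp only [flat_apply, Fin.sum_univ_six, coframeForm_coframeOf]
    simp [θ]
    ring

/-- The rotated coframe followed by cθ is adapted to φ, so cθ is the seventh unit covector;
rewriting in terms of θ produces the factors c⁻¹ and c. The sign of c does not matter, since the
orientation is the one defined by cθ. -/
theorem IsSU3Coframe.g2Hodge_warped [FiniteDimensional ℝ E] (he : IsSU3Coframe e ω ψp ψm)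
    (hE : Module.finrank ℝ E = 7) (hker : ∀ v, π v = 0 → θ v = 0 → v = 0) {c : ℝ} (hc : c ≠ 0)
    (h : 2 + 1 = 3) {φ : E [⋀^Fin 3]→L[ℝ] ℝ}
    (hφ : φ = c • altWedge h (ω.compContinuousLinearMap π) (wedgeOfLinear ![θ]) -
      ψm.compContinuousLinearMap π) :
    (∀ {k l m : ℕ} (h : k + l = 6) (h₁ : k + 1 = m) (h₂ : m + l = 7) (γ : F [⋀^Fin k]→L[ℝ] ℝ),
      g2Hodge φ h₂ (altWedge h₁ (γ.compContinuousLinearMap π) (wedgeOfLinear ![θ])) =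
        (c⁻¹ * (-1 : ℝ) ^ l) • (hodge e h γ).compContinuousLinearMap π) ∧
    (∀ {k l m : ℕ} (h : k + l = 6) (h₁ : l + 1 = m) (h₂ : k + m = 7) (γ : F [⋀^Fin k]→L[ℝ] ℝ),
      g2Hodge φ h₂ (γ.compContinuousLinearMap π) =
        c • altWedge h₁ ((hodge e h γ).compContinuousLinearMap π) (wedgeOfLinear ![θ])) := by
  obtain ⟨e₁, he₁, hvol, hflat⟩ := he.exists_rotation
  obtain ⟨e', H⟩ := exists_isExtension hE π e₁ (c • θ) fun v hv hv' => hker v hv (by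
    simpa [hc] using hv')
  have hcθ : wedgeOfLinear ![c • θ] = c • wedgeOfLinear ![θ] := by
    ext v
    simp [wedgeOfLinear_apply_eq_det]
  have hG : IsG2Coframe e' φ := by
    have := he₁.isG2Coframe H h
    rw [hcθ, altWedge_smul_right] at this
    rw [hφ, sub_eq_add_neg]
    exact this
  refine ⟨fun h h₁ h₂ γ => ?_, fun h h₁ h₂ γ => ?_⟩
  · have := H.hodge_altWedge_form h h₁ h₂ γ
    rw [hcθ, altWedge_smul_right, hodge_smul, ← hodge_congr hflat hvol] at this
    rw [hG.g2Hodge_eq, mul_smul, ← this, smul_smul, inv_mul_cancel₀ hc, one_smul]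
  · rw [hG.g2Hodge_eq, H.hodge_pullback h h₁ h₂ γ, hcθ, altWedge_smul_right,
      ← hodge_congr hflat hvol]

/-- The Hodge star of an `SU(3)`-structure does not depend on the adapted coframe. -/
theorem IsSU3Coframe.hodge_unique {e₁ : F ≃L[ℝ] (Fin 6 → ℝ)} (he : IsSU3Coframe e ω ψp ψm)
    (he₁ : IsSU3Coframe e₁ ω ψp ψm) {k l : ℕ} (h : k + l = 6) (β : F [⋀^Fin k]→L[ℝ] ℝ) :
    hodge e h β = hodge e₁ h β := by
  have : FiniteDimensional ℝ F := e.symm.toLinearEquiv.finiteDimensional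
  -- On F × ℝ with dt as seventh covector, both coframes become adapted to the same G₂-form ω ∧ dt +
  -- ψ₊, whose metric and volume form are unique; these are then restricted to F.
  have hE : Module.finrank ℝ (F × ℝ) = 6 + 1 := by
    rw [Module.finrank_prod, e.toLinearEquiv.finrank_eq]
    simp
  have hker : ∀ v : F × ℝ, ContinuousLinearMap.fst ℝ F ℝ v = 0 →
      ContinuousLinearMap.snd ℝ F ℝ v = 0 → v = 0 := fun v h1 h2 => Prod.ext h1 h2
  obtain ⟨e', H⟩ := exists_isExtension hE _ e _ hker
  obtain ⟨e₁', H₁⟩ := exists_isExtension hE _ e₁ _ hker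
  obtain ⟨hvol, hflat⟩ := (he.isG2Coframe H rfl).vol_flat_unique (he₁.isG2Coframe H₁ rfl)
  refine hodge_congr ?_ ?_ h β
  · ext u v
    have h1 := congrArg (fun f => f (u, (0 : ℝ)) (v, (0 : ℝ))) hflat
    simp only [flat_apply, Fin.sum_univ_castSucc (n := 6), H.castSucc, H₁.castSucc, H.last,
      H₁.last] at h1
    simpa [flat_apply] using h1
  · rw [topForm_eq_smul_vol e (vol e₁), ← H.altWedge_form_dualFrame rfl, ← H₁.vol_eq, ← hvol,
      vol_dualFrame, one_smul]

theorem IsSU3Coframe.su3Hodge_eq (he : IsSU3Coframe e ω ψp ψm) {k l : ℕ} (h : k + l = 6)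
    (β : F [⋀^Fin k]→L[ℝ] ℝ) : su3Hodge ω ψp ψm h β = hodge e h β := by
  have H : ∃ e : F ≃L[ℝ] (Fin 6 → ℝ), IsSU3Coframe e ω ψp ψm := ⟨e, he⟩
  rw [su3Hodge, dif_pos H]
  exact H.choose_spec.hodge_unique he h β

end Warped

/-! ### Leibniz rules for the exterior derivative on a vector space -/

section ExtDeriv

variable {E : Type*} [NormedAddCommGroup E] [NormedSpace ℝ E] [FiniteDimensional ℝ E] {p q n : ℕ}

theorem extDeriv_altWedge (h : p + q = n) (h₁ : p + 1 + q = n + 1) (h₂ : p + (q + 1) = n + 1)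
    {α : E → E [⋀^Fin p]→L[ℝ] ℝ} {β : E → E [⋀^Fin q]→L[ℝ] ℝ} {x : E}
    (hα : DifferentiableAt ℝ α x) (hβ : DifferentiableAt ℝ β x) :
    extDeriv (fun y => altWedge h (α y) (β y)) x =
      altWedge h₁ (extDeriv α x) (β x) + (-1 : ℝ) ^ p • altWedge h₂ (α x) (extDeriv β x) := by
  have hd : fderiv ℝ (fun y => altWedge h (α y) (β y)) x =
      (altWedgeL h (α x)).comp (fderiv ℝ β x) + ((altWedgeL h).flip (β x)).comp (fderiv ℝ α x) :=
    ((altWedgeL h).hasFDerivAt_of_bilinear hα.hasFDerivAt hβ.hasFDerivAt).fderiv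
  rw [extDeriv, hd, ContinuousAlternatingMap.alternatizeUncurryFin_add,
    alternatizeUncurryFin_altWedge_right h h₂, alternatizeUncurryFin_altWedge_left h h₁]
  exact add_comm _ _

theorem extDeriv_fun_smul_form (h : 1 + p = p + 1) {u : E → ℝ} {α : E → E [⋀^Fin p]→L[ℝ] ℝ} {x : E}
    (hu : DifferentiableAt ℝ u x) (hα : DifferentiableAt ℝ α x) :
    extDeriv (fun y => u y • α y) x =
      altWedge h (ContinuousAlternatingMap.ofSubsingleton ℝ E ℝ (0 : Fin 1) (fderiv ℝ u x)) (α x) +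
        u x • extDeriv α x := by
  have hd : fderiv ℝ (fun y => u y • α y) x =
      u x • fderiv ℝ α x + (fderiv ℝ u x).smulRight (α x) :=
    (hu.hasFDerivAt.smul hα.hasFDerivAt).fderiv
  rw [extDeriv, hd, ContinuousAlternatingMap.alternatizeUncurryFin_add,
    ContinuousAlternatingMap.alternatizeUncurryFin_smul, alternatizeUncurryFin_smulRight h,
    ofSubsingleton_eq_wedgeOfLinear]
  exact add_comm _ _

theorem form_eq_zero_of_finrank_lt {k : ℕ} (hk : Module.finrank ℝ E < k)
    (α : E [⋀^Fin k]→L[ℝ] ℝ) : α = 0 := by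
  obtain ⟨e⟩ := exists_coframe E
  refine form_ext e fun s hs => ?_
  have := Fintype.card_le_of_injective s hs
  simp only [Fintype.card_fin] at this
  omega

end ExtDeriv

/-! ### Exterior calculus on manifolds in preferred charts -/

section Manifold

variable {E : Type*} [NormedAddCommGroup E] [NormedSpace ℝ E]
  {H : Type*} [TopologicalSpace H] (I : ModelWithCorners ℝ E H)
  {M : Type*} [TopologicalSpace M] [ChartedSpace H M] {p q n k : ℕ}

/-- Differentiability of a differential form at a point. -/
def FormDiffAt (α : Form E M k) (x : M) : Prop :=
  DifferentiableAt ℝ (localRep I x α) (extChartAt I x x)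

variable {I}

theorem localRep_wedge (h : p + q = n) (α : Form E M p) (β : Form E M q) (x₀ : M) :
    localRep I x₀ (wedge α β h) =
      fun y => altWedge h (localRep I x₀ α y) (localRep I x₀ β y) :=
  funext fun _ => altWedge_compContinuousLinearMap h _ _ _

theorem FormDiffAt.wedge [FiniteDimensional ℝ E] {α : Form E M p} {β : Form E M q} {x : M}
    (h : p + q = n) (hα : FormDiffAt I α x) (hβ : FormDiffAt I β x) :
    FormDiffAt I (wedge α β h) x := by
  rw [FormDiffAt, localRep_wedge]
  exact ((altWedgeL h).hasFDerivAt_of_bilinear hα.hasFDerivAt hβ.hasFDerivAt).differentiableAt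

theorem FormDiffAt.add {α β : Form E M k} {x : M} (hα : FormDiffAt I α x)
    (hβ : FormDiffAt I β x) : FormDiffAt I (α + β) x :=
  DifferentiableAt.add hα hβ

theorem FormDiffAt.const_smul {α : Form E M k} {x : M} (c : ℝ) (hα : FormDiffAt I α x) :
    FormDiffAt I (c • α) x :=
  DifferentiableAt.const_smul hα c

theorem FormDiffAt.neg {α : Form E M k} {x : M} (hα : FormDiffAt I α x) : FormDiffAt I (-α) x :=
  DifferentiableAt.neg hα

theorem SmoothFormOn.formDiffAt [I.Boundaryless] {α : Form E M k} {U : Set M}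
    (hα : SmoothFormOn I α U)
    (hU : IsOpen U) {x : M} (hx : x ∈ U) : FormDiffAt I α x := by
  have h := (hα x).contDiffWithinAt (x := extChartAt I x x)
    ⟨mem_extChartAt_target x, by rwa [mem_preimage, extChartAt_to_inv]⟩
  refine (h.contDiffAt ?_).differentiableAt (by simp)
  refine Filter.inter_mem (extChartAt_target_mem_nhds x) ?_
  exact (continuousAt_extChartAt_symm x).preimage_mem_nhds
    (hU.mem_nhds (by rwa [extChartAt_to_inv]))

theorem SmoothForm.formDiffAt [I.Boundaryless] {α : Form E M k} (hα : SmoothForm I α) (x : M) :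
    FormDiffAt I α x :=
  SmoothFormOn.formDiffAt hα isOpen_univ (mem_univ x)

variable [I.Boundaryless]

theorem hasFDerivAt_comp_extChartAt_symm {F : Type*} [NormedAddCommGroup F] [NormedSpace ℝ F]
    {u : M → F} {x : M} (hu : MDifferentiableAt I 𝓘(ℝ, F) u x) :
    HasFDerivAt (u ∘ (extChartAt I x).symm) (mfderiv I 𝓘(ℝ, F) u x : E →L[ℝ] F)
      (extChartAt I x x) := by
  -- Quantifying over D lets the derivative, a map between tangent spaces, be treated as a map from
  -- E to F.
  have key : ∀ D : E →L[ℝ] F, HasFDerivWithinAt (u ∘ (extChartAt I x).symm) D (range I)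
      (extChartAt I x x) → HasFDerivAt (u ∘ (extChartAt I x).symm) D (extChartAt I x x) := by
    intro D hD
    rwa [I.range_eq_univ, hasFDerivWithinAt_univ] at hD
  exact key _ hu.hasMFDerivAt.2

theorem FormDiffAt.mulForm {u : M → ℝ} {α : Form E M k} {x : M}
    (hu : MDifferentiableAt I 𝓘(ℝ, ℝ) u x) (hα : FormDiffAt I α x) :
    FormDiffAt I (mulForm u α) x :=
  (hasFDerivAt_comp_extChartAt_symm hu).differentiableAt.smul hα

variable [IsManifold I 1 M]

variable (I) in
theorem mdifferentiableAt_extChartAt_symm {x₀ : M} {y : E} (hy : y ∈ (extChartAt I x₀).target) :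
    MDifferentiableAt 𝓘(ℝ, E) I (extChartAt I x₀).symm y := by
  have := mdifferentiableWithinAt_extChartAt_symm (I := I) hy
  rwa [I.range_eq_univ, mdifferentiableWithinAt_univ] at this

variable (I) in
-- The tangent space at x is identified with E by the preferred chart at x, in which that chart
-- reads as the identity. Hence `extD` at x is simply the flat `extDeriv` of the local
-- representative (`extD_eq`).
theorem mfderiv_extChartAt_self (x : M) :
    mfderiv I 𝓘(ℝ, E) (extChartAt I x) x = ContinuousLinearMap.id ℝ E := by
  have hd := hasFDerivAt_comp_extChartAt_symm
    (mdifferentiableAt_extChartAt (I := I) (mem_chart_source H x))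
  have : extChartAt I x ∘ (extChartAt I x).symm =ᶠ[𝓝 (extChartAt I x x)] id := by
    filter_upwards [extChartAt_target_mem_nhds (I := I) x] with y hy
    exact (extChartAt I x).right_inv hy
  have key : ∀ D : E →L[ℝ] E,
      HasFDerivAt (extChartAt I x ∘ (extChartAt I x).symm) D (extChartAt I x x) →
      D = ContinuousLinearMap.id ℝ E :=
    fun D hD => (hD.congr_of_eventuallyEq this.symm).unique (hasFDerivAt_id _)
  exact key _ hd

variable (I) in
theorem mfderiv_extChartAt_symm_self (x : M) :
    mfderiv 𝓘(ℝ, E) I (extChartAt I x).symm (extChartAt I x x) = ContinuousLinearMap.id ℝ E := by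
  have h := mfderivWithin_extChartAt_symm_comp_mfderiv_extChartAt' (I := I)
    (mem_extChartAt_source (I := I) x)
  rw [I.range_eq_univ, mfderivWithin_univ, mfderiv_extChartAt_self] at h
  exact h

variable (I) in
theorem localRep_self (x : M) (α : Form E M k) : localRep I x α (extChartAt I x x) = α x := by
  rw [localRep, pullback, mfderiv_extChartAt_symm_self, extChartAt_to_inv]
  rfl

variable (I) in
theorem extD_eq (α : Form E M k) (x : M) :
    extD I α x = extDeriv (localRep I x α) (extChartAt I x x) := by
  rw [extD, mfderiv_extChartAt_self]
  rfl

theorem extD_wedge [FiniteDimensional ℝ E] {α : Form E M p} {β : Form E M q} {x : M}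
    (h : p + q = n) (h₁ : p + 1 + q = n + 1) (h₂ : p + (q + 1) = n + 1)
    (hα : FormDiffAt I α x) (hβ : FormDiffAt I β x) :
    extD I (G2Coflow.wedge α β h) x = altWedge h₁ (extD I α x) (β x) +
      (-1 : ℝ) ^ p • altWedge h₂ (α x) (extD I β x) := by
  rw [extD_eq, extD_eq, extD_eq, localRep_wedge, extDeriv_altWedge h h₁ h₂ hα hβ, localRep_self,
    localRep_self]

theorem extD_add {α β : Form E M k} {x : M} (hα : FormDiffAt I α x) (hβ : FormDiffAt I β x) :
    extD I (α + β) x = extD I α x + extD I β x := by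
  rw [extD_eq, extD_eq, extD_eq]
  exact extDeriv_add hα hβ

theorem extD_const_smul (c : ℝ) (α : Form E M k) (x : M) :
    extD I (c • α) x = c • extD I α x := by
  rw [extD_eq, extD_eq]
  exact extDeriv_smul c (localRep I x α)

theorem extD_mulForm [FiniteDimensional ℝ E] {u : M → ℝ} {α : Form E M k} {x : M}
    (h : 1 + k = k + 1) (hu : MDifferentiableAt I 𝓘(ℝ, ℝ) u x) (hα : FormDiffAt I α x) :
    extD I (G2Coflow.mulForm u α) x = altWedge h (diffFun I u x) (α x) + u x • extD I α x := by
  have hu' := hasFDerivAt_comp_extChartAt_symm hu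
  have key : ∀ D : E →L[ℝ] ℝ,
      HasFDerivAt (u ∘ (extChartAt I x).symm) D (extChartAt I x x) →
      fderiv ℝ (u ∘ (extChartAt I x).symm) (extChartAt I x x) = D := fun D hD => hD.fderiv
  have hfd := key _ hu'
  have h1 : localRep I x (G2Coflow.mulForm u α) =
      fun y => (u ∘ (extChartAt I x).symm) y • localRep I x α y := rfl
  rw [extD_eq, extD_eq, h1, extDeriv_fun_smul_form h hu'.differentiableAt hα, localRep_self,
    hfd, Function.comp_apply, extChartAt_to_inv]
  rfl

end Manifold

/-! ### Pullback by maps that are linear in preferred charts -/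

section Pullback

variable {E : Type*} [NormedAddCommGroup E] [NormedSpace ℝ E]
  {H : Type*} [TopologicalSpace H] {I : ModelWithCorners ℝ E H}
  {M : Type*} [TopologicalSpace M] [ChartedSpace H M]
  {E' : Type*} [NormedAddCommGroup E'] [NormedSpace ℝ E']
  {H' : Type*} [TopologicalSpace H'] {I' : ModelWithCorners ℝ E' H'}
  {M' : Type*} [TopologicalSpace M'] [ChartedSpace H' M'] {k : ℕ}

theorem mfderiv_comp_continuousLinearMap {g : E → M} (L : E' →L[ℝ] E) {w : E'}
    (hg : MDifferentiableAt 𝓘(ℝ, E) I g (L w)) :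
    mfderiv 𝓘(ℝ, E') I (fun y => g (L y)) w =
      ContinuousLinearMap.comp (mfderiv 𝓘(ℝ, E) I g (L w) : E →L[ℝ] E) L := by
  have := mfderiv_comp w hg L.differentiableAt.mdifferentiableAt
  rw [mfderiv_eq_fderiv, L.fderiv] at this
  exact this

theorem apply_extChartAt_of_linear {F : M' → M} (L : E' →L[ℝ] E) {x : M'}
    (hmaps : MapsTo L (extChartAt I' x).target (extChartAt I (F x)).target)
    (hL : ∀ w ∈ (extChartAt I' x).target,
      F ((extChartAt I' x).symm w) = (extChartAt I (F x)).symm (L w)) :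
    L (extChartAt I' x x) = extChartAt I (F x) (F x) := by
  have h := hL _ (mem_extChartAt_target (I := I') x)
  rw [extChartAt_to_inv] at h
  rw [← (extChartAt I (F x)).right_inv (hmaps (mem_extChartAt_target (I := I') x)), ← h]

variable (I I') in
theorem extChartAt_prod_symm_apply (x : M' × M) (w : E' × E) :
    (extChartAt (I'.prod I) x).symm w =
      ((extChartAt I' x.1).symm w.1, (extChartAt I x.2).symm w.2) := by
  rw [extChartAt_prod]; rfl

theorem extChartAt_prod_target (x : M' × M) :
    (extChartAt (I'.prod I) x).target =
      (extChartAt I' x.1).target ×ˢ (extChartAt I x.2).target := by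
  rw [extChartAt_prod]; rfl

theorem pullback_fst_apply (α : Form E' M' k) (x : M' × M) :
    pullback (I'.prod I) I' Prod.fst α x =
      (α x.1).compContinuousLinearMap (ContinuousLinearMap.fst ℝ E' E) := by
  rw [pullback, mfderiv_fst]; rfl

theorem pullback_snd_apply (α : Form E M k) (x : M' × M) :
    pullback (I'.prod I) I Prod.snd α x =
      (α x.2).compContinuousLinearMap (ContinuousLinearMap.snd ℝ E' E) := by
  rw [pullback, mfderiv_snd]; rfl

variable [I.Boundaryless] [IsManifold I 1 M] [I'.Boundaryless] [IsManifold I' 1 M']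

/-- Chain rule for both sides of F ∘ chart⁻¹ = chart⁻¹ ∘ L. The projections of a product satisfy
this hypothesis because the preferred charts there are product charts. -/
theorem localRep_pullback_of_linear {F : M' → M} (hF : MDifferentiable I' I F) (L : E' →L[ℝ] E)
    {x : M'} (hmaps : MapsTo L (extChartAt I' x).target (extChartAt I (F x)).target)
    (hL : ∀ w ∈ (extChartAt I' x).target,
      F ((extChartAt I' x).symm w) = (extChartAt I (F x)).symm (L w))
    (α : Form E M k) {w : E'} (hw : w ∈ (extChartAt I' x).target) :
    localRep I' x (pullback I' I F α) w =
      (localRep I (F x) α (L w)).compContinuousLinearMap L := by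
  have h1 := mfderiv_comp w (hF ((extChartAt I' x).symm w))
    (mdifferentiableAt_extChartAt_symm I' hw)
  have h2 : F ∘ (extChartAt I' x).symm =ᶠ[𝓝 w] fun y => (extChartAt I (F x)).symm (L y) := by
    filter_upwards [(isOpen_extChartAt_target x).mem_nhds hw] with y hy using hL y hy
  rw [h2.mfderiv_eq, mfderiv_comp_continuousLinearMap L
    (mdifferentiableAt_extChartAt_symm I (hmaps hw))] at h1
  -- The two base points agree only propositionally, so the identity is proved for arbitrary equal
  -- points.
  have key : ∀ (x₁ x₂ : M) (_ : x₁ = x₂) (A : E →L[ℝ] E) (B : E' →L[ℝ] E) (C : E' →L[ℝ] E')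
      (_ : A.comp L = B.comp C),
      ((α x₁).compContinuousLinearMap B).compContinuousLinearMap C =
        ((α x₂).compContinuousLinearMap A).compContinuousLinearMap L := by
    rintro x₁ _ rfl A B C h
    ext v
    exact congrArg (α x₁) (funext fun i => congrArg (fun D : E' →L[ℝ] E => D (v i)) h.symm)
  exact key _ _ (hL w hw) _ _ _ h1

theorem eventuallyEq_localRep_pullback_of_linear {F : M' → M} (hF : MDifferentiable I' I F)
    (L : E' →L[ℝ] E) {x : M'}
    (hmaps : MapsTo L (extChartAt I' x).target (extChartAt I (F x)).target)
    (hL : ∀ w ∈ (extChartAt I' x).target,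
      F ((extChartAt I' x).symm w) = (extChartAt I (F x)).symm (L w)) (α : Form E M k) :
    localRep I' x (pullback I' I F α) =ᶠ[𝓝 (extChartAt I' x x)]
      fun w => (localRep I (F x) α (L w)).compContinuousLinearMap L := by
  filter_upwards [extChartAt_target_mem_nhds (I := I') x] with w hw
    using localRep_pullback_of_linear hF L hmaps hL α hw

theorem FormDiffAt.pullback_of_linear {F : M' → M} (hF : MDifferentiable I' I F)
    (L : E' →L[ℝ] E) {x : M'}
    (hmaps : MapsTo L (extChartAt I' x).target (extChartAt I (F x)).target)
    (hL : ∀ w ∈ (extChartAt I' x).target,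
      F ((extChartAt I' x).symm w) = (extChartAt I (F x)).symm (L w)) {α : Form E M k}
    (hα : FormDiffAt I α (F x)) : FormDiffAt I' (pullback I' I F α) x := by
  refine DifferentiableAt.congr_of_eventuallyEq ?_
    (eventuallyEq_localRep_pullback_of_linear hF L hmaps hL α)
  rw [FormDiffAt, ← apply_extChartAt_of_linear L hmaps hL] at hα
  exact (ContinuousAlternatingMap.compContinuousLinearMapCLM L).differentiableAt.comp _
    (hα.comp _ L.differentiableAt)

theorem extD_pullback_of_linear {F : M' → M} (hF : MDifferentiable I' I F)
    (L : E' →L[ℝ] E) {x : M'}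
    (hmaps : MapsTo L (extChartAt I' x).target (extChartAt I (F x)).target)
    (hL : ∀ w ∈ (extChartAt I' x).target,
      F ((extChartAt I' x).symm w) = (extChartAt I (F x)).symm (L w)) {α : Form E M k}
    (hα : FormDiffAt I α (F x)) :
    extD I' (pullback I' I F α) x = (extD I α (F x)).compContinuousLinearMap L := by
  rw [FormDiffAt, ← apply_extChartAt_of_linear L hmaps hL] at hα
  rw [extD_eq, extD_eq, (eventuallyEq_localRep_pullback_of_linear hF L hmaps hL α).extDeriv_eq,
    ← apply_extChartAt_of_linear L hmaps hL]
  have := extDeriv_pullback (r := ⊤) (f := L) hα L.contDiff.contDiffAt (by simp)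
  rw [L.fderiv] at this
  rw [← this]
  congr 1
  funext y
  rw [L.fderiv]

theorem FormDiffAt.pullback_fst {α : Form E' M' k} {x : M' × M}
    (hα : FormDiffAt I' α x.1) : FormDiffAt (I'.prod I) (pullback (I'.prod I) I' Prod.fst α) x :=
  hα.pullback_of_linear mdifferentiable_fst (ContinuousLinearMap.fst ℝ E' E)
    (fun w hw => by rw [extChartAt_prod_target] at hw; exact hw.1)
    (fun w _ => by rw [extChartAt_prod_symm_apply]; rfl)

theorem extD_pullback_fst {α : Form E' M' k} {x : M' × M} (hα : FormDiffAt I' α x.1) :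
    extD (I'.prod I) (pullback (I'.prod I) I' Prod.fst α) x =
      (extD I' α x.1).compContinuousLinearMap (ContinuousLinearMap.fst ℝ E' E) :=
  extD_pullback_of_linear mdifferentiable_fst (ContinuousLinearMap.fst ℝ E' E)
    (fun w hw => by rw [extChartAt_prod_target] at hw; exact hw.1)
    (fun w _ => by rw [extChartAt_prod_symm_apply]; rfl) hα

theorem FormDiffAt.pullback_snd {α : Form E M k} {x : M' × M}
    (hα : FormDiffAt I α x.2) : FormDiffAt (I'.prod I) (pullback (I'.prod I) I Prod.snd α) x :=
  hα.pullback_of_linear mdifferentiable_snd (ContinuousLinearMap.snd ℝ E' E)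
    (fun w hw => by rw [extChartAt_prod_target] at hw; exact hw.2)
    (fun w _ => by rw [extChartAt_prod_symm_apply]; rfl)

theorem extD_pullback_snd {α : Form E M k} {x : M' × M} (hα : FormDiffAt I α x.2) :
    extD (I'.prod I) (pullback (I'.prod I) I Prod.snd α) x =
      (extD I α x.2).compContinuousLinearMap (ContinuousLinearMap.snd ℝ E' E) :=
  extD_pullback_of_linear mdifferentiable_snd (ContinuousLinearMap.snd ℝ E' E)
    (fun w hw => by rw [extChartAt_prod_target] at hw; exact hw.2)
    (fun w _ => by rw [extChartAt_prod_symm_apply]; rfl) hα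

end Pullback

/-! ### The angular form on the circle -/

section Circle

attribute [local instance] finrank_real_complex_fact'

/-- The covector field `ds` on the circle. -/
def angularCovector (z : Circle) : EuclideanSpace ℝ (Fin 1) →L[ℝ] ℝ :=
  Complex.imCLM.comp
    ((ContinuousLinearMap.mul ℝ ℂ (starRingEnd ℂ (z : ℂ))).comp
      (mfderiv (𝓡 1) 𝓘(ℝ, ℂ) (fun w : Circle => (w : ℂ)) z))

theorem contMDiff_coe_circle {m : WithTop ℕ∞} :
    ContMDiff (𝓡 1) 𝓘(ℝ, ℂ) m (fun w : Circle => (w : ℂ)) :=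
  contMDiff_coe_sphere (E := ℂ)

theorem mdifferentiable_coe_circle :
    MDifferentiable (𝓡 1) 𝓘(ℝ, ℂ) (fun w : Circle => (w : ℂ)) :=
  contMDiff_coe_circle.mdifferentiable (n := 1) one_ne_zero

theorem mfderiv_coe_circle_eq_zero {z : Circle} {v : EuclideanSpace ℝ (Fin 1)}
    (h : (mfderiv (𝓡 1) 𝓘(ℝ, ℂ) (fun w : Circle => (w : ℂ)) z :
      EuclideanSpace ℝ (Fin 1) →L[ℝ] ℂ) v = 0) : v = 0 := by
  have key : ∀ D : EuclideanSpace ℝ (Fin 1) →L[ℝ] ℂ, Function.Injective D → D v = 0 → v = 0 :=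
    fun D hD hv => hD (hv.trans (map_zero D).symm)
  exact key _ (injective_mvfderiv_subtypeVal_sphere (E := ℂ) (n := 1) z) h

theorem angularForm_eq_wedgeOfLinear (z : Circle) :
    angularForm z = wedgeOfLinear ![angularCovector z] := by
  rw [angularForm, toOneForm, ofSubsingleton_eq_wedgeOfLinear]
  rfl

/-- Differentiating |w|² = 1 shows that z̄ Dv has zero real part for the inclusion D of the tangent
line. If its imaginary part vanishes too, then Dv = 0, and D is injective. -/
theorem angularCovector_eq_zero {z : Circle} {v : EuclideanSpace ℝ (Fin 1)}
    (h : angularCovector z v = 0) : v = 0 := by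
  set D : EuclideanSpace ℝ (Fin 1) →L[ℝ] ℂ :=
    mfderiv (𝓡 1) 𝓘(ℝ, ℂ) (fun w : Circle => (w : ℂ)) z with hD
  have hd := hasFDerivAt_comp_extChartAt_symm (mdifferentiable_coe_circle z)
  change HasFDerivAt _ D _ at hd
  have h2 := hd.norm_sq
  have h3 : (fun y => ‖((fun w : Circle => (w : ℂ)) ∘ (extChartAt (𝓡 1) z).symm) y‖ ^ 2) =
      fun _ => (1 : ℝ) := by
    funext y
    rw [Function.comp_apply, Circle.norm_coe, one_pow]
  rw [h3] at h2
  have h4 := congrArg (fun L : EuclideanSpace ℝ (Fin 1) →L[ℝ] ℝ => L v)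
    (h2.unique (hasFDerivAt_const _ _))
  simp [Complex.inner] at h4
  have h5 : (starRingEnd ℂ (z : ℂ) * D v).im = 0 := h
  have h6 : (starRingEnd ℂ (z : ℂ) * D v).re = 0 := by
    simp
    linarith
  have h7 : starRingEnd ℂ (z : ℂ) * D v = 0 := Complex.ext h6 h5
  have h8 : D v = 0 := by
    refine (mul_eq_zero.1 h7).resolve_left ?_
    simp
  exact mfderiv_coe_circle_eq_zero h8

/-- In a chart ds is Im(c̄ dc), with c the parametrization of the circle; since dc occurs in it, c
must be twice continuously differentiable. -/
theorem formDiffAt_angularForm (z : Circle) : FormDiffAt (𝓡 1) angularForm z := by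
  set c : EuclideanSpace ℝ (Fin 1) → ℂ := fun y => ((extChartAt (𝓡 1) z).symm y : Circle) with hc
  have hcd : ContDiffAt ℝ 2 c (extChartAt (𝓡 1) z z) := by
    have h1 := (contMDiff_coe_circle (m := 2)).comp_contMDiffOn
      (contMDiffOn_extChartAt_symm (I := 𝓡 1) z)
    exact (contMDiffOn_iff_contDiffOn.1 h1).contDiffAt (extChartAt_target_mem_nhds z)
  have key : localRep (𝓡 1) z angularForm =ᶠ[𝓝 (extChartAt (𝓡 1) z z)] fun y =>
      ContinuousAlternatingMap.ofSubsingleton ℝ _ ℝ (0 : Fin 1)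
        (Complex.imCLM.comp ((ContinuousLinearMap.mul ℝ ℂ (Complex.conjCLE (c y))).comp
          (fderiv ℝ c y))) := by
    filter_upwards [extChartAt_target_mem_nhds (I := 𝓡 1) z] with y hy
    have h1 := mfderiv_comp y (mdifferentiable_coe_circle ((extChartAt (𝓡 1) z).symm y))
      (mdifferentiableAt_extChartAt_symm (𝓡 1) hy)
    rw [mfderiv_eq_fderiv] at h1
    change fderiv ℝ c y = _ at h1
    rw [h1]
    rfl
  refine DifferentiableAt.congr_of_eventuallyEq ?_ key
  have hc1 : DifferentiableAt ℝ c (extChartAt (𝓡 1) z z) := hcd.differentiableAt two_ne_zero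
  have hc2 : DifferentiableAt ℝ (fderiv ℝ c) (extChartAt (𝓡 1) z z) :=
    (hcd.fderiv_right (m := 1) le_rfl).differentiableAt one_ne_zero
  have h1 : DifferentiableAt ℝ (fun y => ContinuousLinearMap.mul ℝ ℂ (Complex.conjCLE (c y)))
      (extChartAt (𝓡 1) z z) :=
    (ContinuousLinearMap.mul ℝ ℂ).differentiableAt.comp _
      (Complex.conjCLE.differentiableAt.comp _ hc1)
  exact (ContinuousAlternatingMap.ofSubsingletonLIE (𝕜 := ℝ) (F := ℝ) (0 : Fin 1)).differentiableAt.comp _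
    ((differentiableAt_const Complex.imCLM).clm_comp (h1.clm_comp hc2))

theorem extD_angularForm (z : Circle) : extD (𝓡 1) angularForm z = 0 :=
  form_eq_zero_of_finrank_lt (by simp) _

end Circle

/-! ### Differentiability of the Hodge star along a smooth coframe -/

section Coframes

variable {E : Type*} [NormedAddCommGroup E] [NormedSpace ℝ E] {n k l : ℕ}

theorem differentiableAt_form_apply {F : Type*} [NormedAddCommGroup F] [NormedSpace ℝ F]
    {α : F → E [⋀^Fin k]→L[ℝ] ℝ} {v : F → Fin k → E} {y : F} (hα : DifferentiableAt ℝ α y)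
    (hv : ∀ i, DifferentiableAt ℝ (fun z => v z i) y) :
    DifferentiableAt ℝ (fun z => α z (v z)) y := by
  have h1 : DifferentiableAt ℝ (fun z => (α z).toContinuousMultilinearMap) y :=
    (ContinuousAlternatingMap.toContinuousMultilinearMapCLM (𝕜 := ℝ) (E := E) (F := ℝ)
      (ι := Fin k) ℝ).differentiableAt.comp y hα
  exact (h1.hasFDerivAt.continuousMultilinearMap_apply
    fun i => (hv i).hasFDerivAt).differentiableAt

variable {H : Type*} [TopologicalSpace H] {I : ModelWithCorners ℝ E H}
  {M : Type*} [TopologicalSpace M] [ChartedSpace H M]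

variable (I) in
/-- The local representative of a field of coframes in the preferred chart at `x₀`. -/
def coframeRep (x₀ : M) (e : M → (E ≃L[ℝ] (Fin n → ℝ))) (y : E) : E →L[ℝ] (Fin n → ℝ) :=
  ContinuousLinearMap.comp (e ((extChartAt I x₀).symm y) : E →L[ℝ] (Fin n → ℝ))
    (mfderiv 𝓘(ℝ, E) I (extChartAt I x₀).symm y)

theorem eventually_extChartAt_symm_mem {U : Set M} (hU : IsOpen U) {x : M} (hx : x ∈ U) :
    ∀ᶠ y in 𝓝 (extChartAt I x x), (extChartAt I x).symm y ∈ U :=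
  (continuousAt_extChartAt_symm x).eventually_mem (hU.mem_nhds (by rwa [extChartAt_to_inv]))

theorem FormDiffAt.congr_of_eqOn {α β : Form E M k} {x : M} {U : Set M} (hα : FormDiffAt I α x)
    (hU : IsOpen U) (hx : x ∈ U) (h : EqOn β α U) : FormDiffAt I β x := by
  refine DifferentiableAt.congr_of_eventuallyEq hα ?_
  filter_upwards [eventually_extChartAt_symm_mem (I := I) hU hx] with y hy
  rw [localRep, localRep, pullback, pullback, h hy]

variable {e : M → (E ≃L[ℝ] (Fin n → ℝ))} {x : M}

theorem differentiableAt_coframeRep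
    (he : ∀ i, FormDiffAt I (toOneForm fun x => coframeForm (e x) i) x) :
    DifferentiableAt ℝ (coframeRep I x e) (extChartAt I x x) := by
  have h1 : ∀ i, DifferentiableAt ℝ (fun y => (ContinuousLinearMap.proj (R := ℝ)
      (φ := fun _ : Fin n => ℝ) i).comp (coframeRep I x e y)) (extChartAt I x x) := fun i =>
    (ContinuousAlternatingMap.ofSubsingletonLIE (𝕜 := ℝ) (E := E) (F := ℝ)
      (0 : Fin 1)).symm.differentiableAt.comp (extChartAt I x x) (he i)
  have h2 : coframeRep I x e = fun y => ∑ i, (ContinuousLinearMap.toSpanSingleton ℝ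
      (Pi.single i 1 : Fin n → ℝ)).comp ((ContinuousLinearMap.proj (R := ℝ)
      (φ := fun _ : Fin n => ℝ) i).comp (coframeRep I x e y)) := by
    funext y
    ext v i
    simp [Finset.sum_apply, Pi.single_apply]
  rw [h2]
  exact DifferentiableAt.fun_sum fun i _ => (differentiableAt_const _).clm_comp (h1 i)

variable [FiniteDimensional ℝ E]

theorem differentiableAt_wedgeOfLinear {F : Type*} [NormedAddCommGroup F] [NormedSpace ℝ F]
    {θ : F → Fin k → E →L[ℝ] ℝ} {y : F} (hθ : ∀ j, DifferentiableAt ℝ (fun z => θ z j) y) :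
    DifferentiableAt ℝ (fun z => wedgeOfLinear (θ z)) y := by
  induction k with
  | zero =>
    have : (fun z => wedgeOfLinear (θ z)) = fun _ => wedgeOfLinear (θ y) :=
      funext fun z => congrArg _ (Subsingleton.elim _ _)
    rw [this]
    exact differentiableAt_const _
  | succ k ih =>
    have h : (fun z => wedgeOfLinear (θ z)) = fun z => altWedgeL (Nat.add_comm 1 k)
        (ContinuousAlternatingMap.ofSubsingletonLIE (𝕜 := ℝ) (F := ℝ) (0 : Fin 1) (θ z 0))
        (wedgeOfLinear fun j => θ z j.succ) := by
      funext z
      rw [altWedgeL_apply]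
      change _ = altWedge _ (ContinuousAlternatingMap.ofSubsingleton ℝ E ℝ (0 : Fin 1) (θ z 0)) _
      rw [ofSubsingleton_eq_wedgeOfLinear, ← wedgeOfLinear_cons]
      exact congrArg _ (Fin.cons_self_tail (θ z)).symm
    rw [h]
    have h1 : DifferentiableAt ℝ (fun z =>
        ContinuousAlternatingMap.ofSubsingletonLIE (𝕜 := ℝ) (F := ℝ) (0 : Fin 1) (θ z 0)) y :=
      (ContinuousAlternatingMap.ofSubsingletonLIE (𝕜 := ℝ) (E := E) (F := ℝ)
        (0 : Fin 1)).differentiableAt.comp y (hθ 0)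
    exact ((altWedgeL _).hasFDerivAt_of_bilinear h1.hasFDerivAt
      (ih fun j => hθ j.succ).hasFDerivAt).differentiableAt

theorem FormDiffAt.elem (he : ∀ i, FormDiffAt I (toOneForm fun x => coframeForm (e x) i) x)
    (s : Fin k → Fin n) : FormDiffAt I (fun x => elem (e x) s) x := by
  have h : localRep I x (fun x => G2Coflow.elem (e x) s) = fun y => wedgeOfLinear fun j =>
      (ContinuousLinearMap.proj (R := ℝ) (φ := fun _ : Fin n => ℝ) (s j)).comp
        (coframeRep I x e y) :=
    funext fun y => wedgeOfLinear_compContinuousLinearMap _ _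
  rw [FormDiffAt, h]
  exact differentiableAt_wedgeOfLinear fun j =>
    (differentiableAt_const _).clm_comp (differentiableAt_coframeRep he)

variable [I.Boundaryless] [IsManifold I 1 M]

/-- The dual frame is the inverse of the coframe read in the chart, and inversion of linear
isomorphisms is differentiable. -/
theorem differentiableAt_apply_dualFrame
    (he : ∀ i, FormDiffAt I (toOneForm fun x => coframeForm (e x) i) x) {β : Form E M k}
    (hβ : FormDiffAt I β x) (s : Fin k → Fin n) :
    DifferentiableAt ℝ ((fun z => β z fun i => dualFrame (e z) (s i)) ∘ (extChartAt I x).symm)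
      (extChartAt I x x) := by
  have hA := differentiableAt_coframeRep he
  have hA0 : coframeRep I x e (extChartAt I x x) = (e x : E →L[ℝ] (Fin n → ℝ)) := by
    rw [coframeRep, mfderiv_extChartAt_symm_self, extChartAt_to_inv]
    rfl
  have hinv : DifferentiableAt ℝ (fun y => (coframeRep I x e y).inverse) (extChartAt I x x) := by
    have : DifferentiableAt ℝ (ContinuousLinearMap.inverse : (E →L[ℝ] (Fin n → ℝ)) → _)
        (coframeRep I x e (extChartAt I x x)) := by
      rw [hA0]
      exact (contDiffAt_map_inverse (n := 1) (e x)).differentiableAt one_ne_zero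
    exact this.comp _ hA
  -- Invertibility is an open condition, so near the point `ContinuousLinearMap.inverse` is a true
  -- inverse rather than its default value 0.
  have hev : ∀ᶠ y in 𝓝 (extChartAt I x x), ∃ A : E ≃L[ℝ] (Fin n → ℝ),
      (A : E →L[ℝ] (Fin n → ℝ)) = coframeRep I x e y := by
    refine hA.continuousAt.eventually_mem
      (s := range ((↑) : (E ≃L[ℝ] (Fin n → ℝ)) → E →L[ℝ] (Fin n → ℝ))) ?_
    rw [hA0]
    exact (e x).nhds
  refine DifferentiableAt.congr_of_eventuallyEq (differentiableAt_form_apply hβ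
    (v := fun y i => (coframeRep I x e y).inverse (Pi.single (s i) 1))
    fun i => hinv.clm_apply (differentiableAt_const _)) ?_
  filter_upwards [hev] with y ⟨A, hA⟩
  refine congrArg (β ((extChartAt I x).symm y)) (funext fun i => ?_)
  rw [← hA, ContinuousLinearMap.inverse_equiv]
  have h1 : coframeRep I x e y (A.symm (Pi.single (s i) 1)) = Pi.single (s i) 1 := by
    rw [← hA]
    exact A.apply_symm_apply _
  exact (e ((extChartAt I x).symm y)).symm_apply_eq.2 h1.symm

theorem FormDiffAt.hodge (he : ∀ i, FormDiffAt I (toOneForm fun x => coframeForm (e x) i) x)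
    {β : Form E M k} (hβ : FormDiffAt I β x) (h : k + l = n) :
    FormDiffAt I (fun z => hodge (e z) h (β z)) x := by
  have h1 : localRep I x (fun z => G2Coflow.hodge (e z) h (β z)) = fun y =>
      ((k.factorial : ℝ) * (l.factorial : ℝ))⁻¹ • ∑ σ : Equiv.Perm (Fin n),
        (((Equiv.Perm.sign σ : ℤ) : ℝ) * ((fun z => β z fun i =>
          dualFrame (e z) (σ (Fin.cast h (Fin.castAdd l i)))) ∘ (extChartAt I x).symm) y) •
        localRep I x (fun z => G2Coflow.elem (e z) fun j => σ (Fin.cast h (Fin.natAdd k j))) y := by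
    funext y
    have key : ∀ D : E →L[ℝ] E,
        (G2Coflow.hodge (e ((extChartAt I x).symm y)) h
          (β ((extChartAt I x).symm y))).compContinuousLinearMap D =
        ((k.factorial : ℝ) * (l.factorial : ℝ))⁻¹ • ∑ σ : Equiv.Perm (Fin n),
        (((Equiv.Perm.sign σ : ℤ) : ℝ) * ((fun z => β z fun i =>
          dualFrame (e z) (σ (Fin.cast h (Fin.castAdd l i)))) ∘ (extChartAt I x).symm) y) •
        (G2Coflow.elem (e ((extChartAt I x).symm y))
          fun j => σ (Fin.cast h (Fin.natAdd k j))).compContinuousLinearMap D := by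
      intro D
      rw [G2Coflow.hodge]
      ext v
      simp
    exact key _
  rw [FormDiffAt, h1]
  refine DifferentiableAt.fun_const_smul (DifferentiableAt.fun_sum fun σ _ => ?_) _
  have h2 : DifferentiableAt ℝ (localRep I x (fun z => G2Coflow.elem (e z)
      fun j => σ (Fin.cast h (Fin.natAdd k j)))) (extChartAt I x x) := FormDiffAt.elem he _
  exact ((differentiableAt_apply_dualFrame he hβ _).const_mul _).smul h2

end Coframes

/-! ### Regularity of an SU(3)-structure and its Hodge star -/

section SU3

variable {M : Type*} [TopologicalSpace M] [ChartedSpace E6 M] {ω : Form E6 M 2}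
  {ψp ψm : Form E6 M 3} {k l : ℕ}

theorem IsSU3Structure.exists_coframe (h : IsSU3Structure ω ψp ψm) (x : M) :
    ∃ e : E6 ≃L[ℝ] (Fin 6 → ℝ), IsSU3Coframe e (ω x) (ψp x) (ψm x) := by
  obtain ⟨U, -, hx, e, -, he⟩ := h x
  exact ⟨e x, he x hx⟩

theorem IsSU3Structure.formDiffAt (h : IsSU3Structure ω ψp ψm) (x : M) :
    FormDiffAt (𝓡 6) ω x ∧ FormDiffAt (𝓡 6) ψp x ∧ FormDiffAt (𝓡 6) ψm x := by
  obtain ⟨U, hU, hx, e, hs, he⟩ := h x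
  have hd : ∀ i, FormDiffAt (𝓡 6) (toOneForm fun x => coframeForm (e x) i) x :=
    fun i => (hs i).formDiffAt hU hx
  have hsub : ∀ {k : ℕ} {α β : Form E6 M k}, FormDiffAt (𝓡 6) α x → FormDiffAt (𝓡 6) β x →
      FormDiffAt (𝓡 6) (α - β) x := fun hα hβ => DifferentiableAt.sub hα hβ
  have hel : ∀ {k : ℕ} (s : Fin k → Fin 6), FormDiffAt (𝓡 6) (fun x => elem (e x) s) x :=
    fun s => FormDiffAt.elem hd s
  exact ⟨(((hel _).add (hel _)).add (hel _)).congr_of_eqOn hU hx fun z hz => (he z hz).1,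
    (hsub (hsub (hsub (hel _) (hel _)) (hel _)) (hel _)).congr_of_eqOn hU hx
      fun z hz => (he z hz).2.1,
    ((((hel _).neg.add (hel _)).add (hel _)).add (hel _)).congr_of_eqOn hU hx
      fun z hz => (he z hz).2.2⟩

/-- Near x the pointwise chosen coframes defining ⋆₆ may be replaced by one smooth local coframe.
This provides the differentiability of ⋆₆ν₃ used when the sum ⋆₆dω is differentiated. -/
theorem IsSU3Structure.formDiffAt_star6 [IsManifold (𝓡 6) 1 M] (h : IsSU3Structure ω ψp ψm)
    {x : M} {β : Form E6 M k} (hβ : FormDiffAt (𝓡 6) β x) (hkl : k + l = 6) :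
    FormDiffAt (𝓡 6) (star6 ω ψp ψm β hkl) x := by
  obtain ⟨U, hU, hx, e, hs, he⟩ := h x
  exact (FormDiffAt.hodge (fun i => (hs i).formDiffAt hU hx) hβ hkl).congr_of_eqOn hU hx
    fun z hz => (he z hz).su3Hodge_eq hkl (β z)

end SU3

/-! ### Uniqueness of the decomposition X + Y ∧ θ -/

section Split

variable {E F : Type*} [NormedAddCommGroup E] [NormedSpace ℝ E]
  [NormedAddCommGroup F] [NormedSpace ℝ F] {l m : ℕ}

theorem g2Hodge_add (φ : E [⋀^Fin 3]→L[ℝ] ℝ) (h : m + l = 7) (α β : E [⋀^Fin m]→L[ℝ] ℝ) :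
    g2Hodge φ h (α + β) = g2Hodge φ h α + g2Hodge φ h β := by
  unfold g2Hodge
  split_ifs
  · exact hodge_add _ _ _ _
  · simp

theorem g2Hodge_smul (φ : E [⋀^Fin 3]→L[ℝ] ℝ) (h : m + l = 7) (c : ℝ) (α : E [⋀^Fin m]→L[ℝ] ℝ) :
    g2Hodge φ h (c • α) = c • g2Hodge φ h α := by
  unfold g2Hodge
  split_ifs
  · exact hodge_smul _ _ _ _
  · simp

variable [FiniteDimensional ℝ E]

/-- On vectors from the image of ι only X is seen, since θ vanishes there. Once X = 0, inserting u
in one slot isolates Y up to the nonzero factor θ(u) and a sign. -/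
theorem eq_zero_of_pullback_add_altWedge_eq_zero {π : E →L[ℝ] F} {θ : E →L[ℝ] ℝ} {ι : F →L[ℝ] E}
    {u : E} (hπι : ∀ v, π (ι v) = v) (hθι : ∀ v, θ (ι v) = 0) (hθu : θ u ≠ 0)
    (h : l + 1 = m) {X : F [⋀^Fin m]→L[ℝ] ℝ} {Y : F [⋀^Fin l]→L[ℝ] ℝ}
    (hXY : X.compContinuousLinearMap π +
      altWedge h (Y.compContinuousLinearMap π) (wedgeOfLinear ![θ]) = 0) : X = 0 ∧ Y = 0 := by
  subst h
  have hX : X = 0 := by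
    ext v
    have h1 := congrArg (fun β : E [⋀^Fin (l + 1)]→L[ℝ] ℝ => β fun i => ι (v i)) hXY
    rw [altWedge_comm rfl (Nat.add_comm 1 l)] at h1
    simpa [altWedge_one_apply, Function.comp_def, hπι, hθι,
      ← ofSubsingleton_eq_wedgeOfLinear] using h1
  refine ⟨hX, ?_⟩
  ext v
  have h1 := congrArg (fun β : E [⋀^Fin (l + 1)]→L[ℝ] ℝ => β (Fin.cons u fun i => ι (v i))) hXY
  rw [hX, altWedge_comm rfl (Nat.add_comm 1 l)] at h1
  simpa [altWedge_one_apply, Function.comp_def, hπι, hθι, hθu, Fin.sum_univ_succ,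
    ← ofSubsingleton_eq_wedgeOfLinear] using h1

end Split

/-! ### Linearity of the wedge and of ⋆₇ -/

section Star7

variable {E : Type*} [NormedAddCommGroup E] [NormedSpace ℝ E] {N : Type*} {k l m : ℕ}

theorem wedge_add_left (h : k + l = m) (α β : Form E N k) (γ : Form E N l) :
    wedge (α + β) γ h = wedge α γ h + wedge β γ h :=
  funext fun _ => altWedge_add_left _ _ _ _

theorem wedge_smul_left (h : k + l = m) (c : ℝ) (α : Form E N k) (γ : Form E N l) :
    wedge (c • α) γ h = c • wedge α γ h :=
  funext fun _ => altWedge_smul_left _ _ _ _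

theorem star7_add (φ : Form E N 3) (h : k + l = 7) (α β : Form E N k) :
    star7 φ (α + β) h = star7 φ α h + star7 φ β h :=
  funext fun _ => g2Hodge_add _ _ _ _

theorem star7_smul (φ : Form E N 3) (h : k + l = 7) (c : ℝ) (α : Form E N k) :
    star7 φ (c • α) h = c • star7 φ α h :=
  funext fun _ => g2Hodge_smul _ _ _ _

theorem star7_zero (φ : Form E N 3) (h : k + l = 7) : star7 φ (0 : Form E N k) h = 0 := by
  have := star7_smul φ h 0 (0 : Form E N k)
  rwa [zero_smul, zero_smul] at this

end Star7

/-! ### Properties of ⋆₆ on an SU(3)-manifold -/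

section Star6

variable {M : Type*} [TopologicalSpace M] [ChartedSpace E6 M] {ω : Form E6 M 2}
  {ψp ψm : Form E6 M 3} {k l : ℕ}

theorem star6_add (hS : IsSU3Structure ω ψp ψm) (h : k + l = 6) (α β : Form E6 M k) :
    star6 ω ψp ψm (α + β) h = star6 ω ψp ψm α h + star6 ω ψp ψm β h := by
  funext x
  obtain ⟨e, he⟩ := hS.exists_coframe x
  simp only [star6, he.su3Hodge_eq, Pi.add_apply, hodge_add]

theorem star6_smul (hS : IsSU3Structure ω ψp ψm) (h : k + l = 6) (c : ℝ) (α : Form E6 M k) :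
    star6 ω ψp ψm (c • α) h = c • star6 ω ψp ψm α h := by
  funext x
  obtain ⟨e, he⟩ := hS.exists_coframe x
  simp only [star6, he.su3Hodge_eq, Pi.smul_apply, hodge_smul]

theorem star6_neg (hS : IsSU3Structure ω ψp ψm) (h : k + l = 6) (α : Form E6 M k) :
    star6 ω ψp ψm (-α) h = -star6 ω ψp ψm α h := by
  rw [← neg_one_smul ℝ α, star6_smul hS]
  exact neg_one_smul ℝ (star6 ω ψp ψm α h)

theorem star6_mulForm (hS : IsSU3Structure ω ψp ψm) (h : k + l = 6) (u : M → ℝ)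
    (α : Form E6 M k) :
    star6 ω ψp ψm (mulForm u α) h = mulForm u (star6 ω ψp ψm α h) := by
  funext x
  obtain ⟨e, he⟩ := hS.exists_coframe x
  simp only [star6, he.su3Hodge_eq, mulForm, hodge_smul]

theorem star6_omega (hS : IsSU3Structure ω ψp ψm) :
    (star6 ω ψp ψm ω : Form E6 M 4) = (1 / 2 : ℝ) • wedge ω ω := by
  funext x
  obtain ⟨e, he⟩ := hS.exists_coframe x
  simp only [star6, he.su3Hodge_eq, Pi.smul_apply, wedge, ← he.hodge_omega rfl rfl, smul_smul]
  norm_num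

theorem star6_omega_wedge_omega (hS : IsSU3Structure ω ψp ψm) :
    (star6 ω ψp ψm (wedge ω ω : Form E6 M 4) : Form E6 M 2) = (2 : ℝ) • ω := by
  funext x
  obtain ⟨e, he⟩ := hS.exists_coframe x
  simp only [star6, he.su3Hodge_eq, Pi.smul_apply, wedge, he.hodge_omega_wedge_omega]

theorem star6_psiP (hS : IsSU3Structure ω ψp ψm) :
    (star6 ω ψp ψm ψp : Form E6 M 3) = ψm := by
  funext x
  obtain ⟨e, he⟩ := hS.exists_coframe x
  simp only [star6, he.su3Hodge_eq, he.hodge_psiP]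

theorem star6_psiM (hS : IsSU3Structure ω ψp ψm) :
    (star6 ω ψp ψm ψm : Form E6 M 3) = -ψp := by
  funext x
  obtain ⟨e, he⟩ := hS.exists_coframe x
  simp only [star6, he.su3Hodge_eq, he.hodge_psiM, Pi.neg_apply]

theorem star6_star6_two (hS : IsSU3Structure ω ψp ψm) (σ : Form E6 M 2) :
    (star6 ω ψp ψm (star6 ω ψp ψm σ : Form E6 M 4) : Form E6 M 2) = σ := by
  funext x
  obtain ⟨e, he⟩ := hS.exists_coframe x
  simp only [star6, he.su3Hodge_eq, hodge_hodge_two]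

end Star6

/-! ### Forms X + Y ∧ ds on M × S¹ and their exterior derivative -/

section Lift

variable {M : Type*} [TopologicalSpace M] [ChartedSpace E6 M] {k l m : ℕ}

theorem lift6_apply (α : Form E6 M k) (p : M × Circle) :
    lift6 α p = (α p.1).compContinuousLinearMap (ContinuousLinearMap.fst ℝ _ _) :=
  pullback_fst_apply α p

theorem ds_apply (p : M × Circle) :
    (ds : Form E7 (M × Circle) 1) p = wedgeOfLinear
      ![(angularCovector p.2).comp (ContinuousLinearMap.snd ℝ E6 (EuclideanSpace ℝ (Fin 1)))] := by
  rw [ds, pullback_snd_apply, angularForm_eq_wedgeOfLinear, wedgeOfLinear_compContinuousLinearMap]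
  congr 1
  funext i
  fin_cases i
  rfl

theorem lift6_add (α β : Form E6 M k) : lift6 (α + β) = lift6 α + lift6 β := rfl

theorem lift6_smul (c : ℝ) (α : Form E6 M k) : lift6 (c • α) = c • lift6 α := rfl

theorem eq_zero_of_lift6_add_wedge_ds_apply_eq_zero (h : k + 1 = m) {x : M} {z : Circle}
    {X : Form E6 M m} {Y : Form E6 M k} (hXY : (lift6 X + wedge (lift6 Y) ds h) (x, z) = 0) :
    X x = 0 ∧ Y x = 0 := by
  rw [Pi.add_apply, wedge, lift6_apply, lift6_apply, ds_apply] at hXY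
  have hu : angularCovector z (EuclideanSpace.single 0 1) ≠ 0 := fun h0 => by
    simpa using congrArg (fun v : EuclideanSpace ℝ (Fin 1) => v 0) (angularCovector_eq_zero h0)
  exact eq_zero_of_pullback_add_altWedge_eq_zero (ι := ContinuousLinearMap.inl ℝ _ _)
    (u := (0, EuclideanSpace.single 0 1)) (fun v => rfl) (fun v => by simp) (by simpa using hu)
    h hXY

theorem eq_of_lift6_add_wedge_ds_apply_eq (h : k + 1 = m) {x : M} {z : Circle} {X X' : Form E6 M m}
    {Y Y' : Form E6 M k} (hXY : (lift6 X + wedge (lift6 Y) ds h) (x, z) =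
      (lift6 X' + wedge (lift6 Y') ds h) (x, z)) : X x = X' x ∧ Y x = Y' x := by
  have hd : (lift6 (X - X') + wedge (lift6 (Y - Y')) ds h) (x, z) = 0 := by
    have h1 : (lift6 (X - X') + wedge (lift6 (Y - Y')) ds h : Form E7 (M × Circle) m) =
        (lift6 X + wedge (lift6 Y) ds h) - (lift6 X' + wedge (lift6 Y') ds h) := by
      rw [sub_eq_add_neg, sub_eq_add_neg, ← neg_one_smul ℝ X', ← neg_one_smul ℝ Y', lift6_add,
        lift6_add, lift6_smul, lift6_smul, wedge_add_left, wedge_smul_left]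
      module
    rw [h1, Pi.sub_apply, hXY, sub_self]
  have := eq_zero_of_lift6_add_wedge_ds_apply_eq_zero h hd
  exact ⟨sub_eq_zero.1 this.1, sub_eq_zero.1 this.2⟩

variable [IsManifold (𝓡 6) 1 M]

theorem formDiffAt_lift6 {α : Form E6 M k} {p : M × Circle} (hα : FormDiffAt (𝓡 6) α p.1) :
    FormDiffAt I7 (lift6 α) p :=
  hα.pullback_fst

theorem extD_lift6 {α : Form E6 M k} (hα : ∀ x, FormDiffAt (𝓡 6) α x) :
    extD I7 (lift6 α) = lift6 (extD (𝓡 6) α) := by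
  funext p
  rw [lift6, extD_pullback_fst (hα _), lift6_apply]

theorem formDiffAt_ds (p : M × Circle) : FormDiffAt I7 ds p :=
  (formDiffAt_angularForm _).pullback_snd

theorem extD_ds : extD I7 (ds : Form E7 (M × Circle) 1) = 0 := by
  funext p
  rw [ds, extD_pullback_snd (formDiffAt_angularForm _), extD_angularForm]
  rfl

theorem formDiffAt_lift6_wedge_ds (h : k + 1 = m) {α : Form E6 M k} {p : M × Circle}
    (hα : FormDiffAt (𝓡 6) α p.1) : FormDiffAt I7 (wedge (lift6 α) ds h) p :=
  (formDiffAt_lift6 hα).wedge h (formDiffAt_ds p)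

theorem extD_lift6_wedge_ds (h : k + 1 = m) (h' : k + 1 + 1 = m + 1) {α : Form E6 M k}
    (hα : ∀ x, FormDiffAt (𝓡 6) α x) :
    extD I7 (wedge (lift6 α) ds h) = wedge (lift6 (extD (𝓡 6) α)) ds h' := by
  funext p
  rw [extD_wedge h h' (by omega) (formDiffAt_lift6 (hα _)) (formDiffAt_ds p), extD_ds,
    extD_lift6 hα]
  simp [wedge, altWedge_zero_right]

theorem extD_lift6_add_wedge_ds (c : ℝ) (h : k + 1 = m) (h' : k + 1 + 1 = m + 1) {X : Form E6 M m}
    {Y : Form E6 M k} (hX : ∀ x, FormDiffAt (𝓡 6) X x) (hY : ∀ x, FormDiffAt (𝓡 6) Y x) :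
    extD I7 (lift6 X + c • wedge (lift6 Y) ds h) =
      lift6 (extD (𝓡 6) X) + c • wedge (lift6 (extD (𝓡 6) Y)) ds h' := by
  funext p
  rw [extD_add (formDiffAt_lift6 (hX _)) ((formDiffAt_lift6_wedge_ds h (hY _)).const_smul c),
    extD_const_smul, extD_lift6 hX, extD_lift6_wedge_ds h h' hY]
  rfl

end Lift

/-! ### The Hodge star and the Laplacian of the warped structure -/

section Warped

variable {M : Type*} [TopologicalSpace M] [ChartedSpace E6 M] {ω : Form E6 M 2}
  {ψp ψm : Form E6 M 3} {k l m : ℕ} {c : ℝ}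

theorem warpedG2_zero_one : warpedG2 0 1 c ω ψp ψm = lift6 (-ψm) + c • wedge (lift6 ω) ds := by
  rw [warpedG2, ← neg_one_smul ℝ ψm, lift6_smul]
  module

theorem star7_warpedG2 (hS : IsSU3Structure ω ψp ψm) (hc : c ≠ 0) :
    (∀ {k l m : ℕ} (h : k + l = 6) (h₁ : k + 1 = m) (h₂ : m + l = 7) (γ : Form E6 M k),
      star7 (warpedG2 0 1 c ω ψp ψm) (wedge (lift6 γ) ds h₁) h₂ =
        (c⁻¹ * (-1 : ℝ) ^ l) • lift6 (star6 ω ψp ψm γ h)) ∧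
    (∀ {k l m : ℕ} (h : k + l = 6) (h₁ : l + 1 = m) (h₂ : k + m = 7) (γ : Form E6 M k),
      star7 (warpedG2 0 1 c ω ψp ψm) (lift6 γ) h₂ =
        c • wedge (lift6 (star6 ω ψp ψm γ h)) ds h₁) := by
  have hE : Module.finrank ℝ E7 = 7 := by simp
  have hker : ∀ (z : Circle) (v : E7), ContinuousLinearMap.fst ℝ E6 (EuclideanSpace ℝ (Fin 1)) v =
      0 →
      (angularCovector z).comp (ContinuousLinearMap.snd ℝ E6 (EuclideanSpace ℝ (Fin 1))) v = 0 →
      v = 0 := fun z v h1 h2 => Prod.ext h1 (angularCovector_eq_zero h2)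
  have hφ : ∀ p : M × Circle, warpedG2 0 1 c ω ψp ψm p =
      c • altWedge rfl ((ω p.1).compContinuousLinearMap (ContinuousLinearMap.fst ℝ _ _))
        (wedgeOfLinear ![(angularCovector p.2).comp
          (ContinuousLinearMap.snd ℝ E6 (EuclideanSpace ℝ (Fin 1)))]) -
      (ψm p.1).compContinuousLinearMap (ContinuousLinearMap.fst ℝ _ _) := by
    intro p
    rw [← ds_apply, ← lift6_apply, ← lift6_apply, warpedG2, one_smul, zero_smul, zero_sub,
      ← sub_eq_add_neg]
    rfl
  have key : ∀ (p : M × Circle) (e : E6 ≃L[ℝ] (Fin 6 → ℝ))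
      (he : IsSU3Coframe e (ω p.1) (ψp p.1) (ψm p.1)), _ :=
    fun p e he => he.g2Hodge_warped (E := E7) (π := ContinuousLinearMap.fst ℝ _ _)
      (θ := (angularCovector p.2).comp
          (ContinuousLinearMap.snd ℝ E6 (EuclideanSpace ℝ (Fin 1)))) hE (hker p.2) hc
      (by norm_num : 2 + 1 = 3) (hφ p)
  constructor
  · intro k l m h h₁ h₂ γ
    funext p
    obtain ⟨e, he⟩ := hS.exists_coframe p.1
    simp only [star7, wedge, Pi.smul_apply, lift6_apply, ds_apply, star6, he.su3Hodge_eq]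
    rw [(key p e he).1 h h₁ h₂ (γ p.1)]
  · intro k l m h h₁ h₂ γ
    funext p
    obtain ⟨e, he⟩ := hS.exists_coframe p.1
    simp only [star7, wedge, Pi.smul_apply, lift6_apply, ds_apply, star6, he.su3Hodge_eq]
    rw [(key p e he).2 h h₁ h₂ (γ p.1)]

/-- Writing forms with c Y ∧ ds instead of Y ∧ ds absorbs the warping: c ds is a unit covector, so c
cancels from the first component. -/
theorem star7_lift6_add_wedge_ds (hS : IsSU3Structure ω ψp ψm) (hc : c ≠ 0) {k l : ℕ}
    (h₁ : k + 1 + l = 6) (h₂ : k + (l + 1) = 6) (h : k + 1 + (l + 1) = 7) (X : Form E6 M (k + 1))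
    (Y : Form E6 M k) :
    star7 (warpedG2 0 1 c ω ψp ψm) (lift6 X + c • wedge (lift6 Y) ds) h =
      lift6 ((-1 : ℝ) ^ (l + 1) • star6 ω ψp ψm Y h₂) +
        c • wedge (lift6 (star6 ω ψp ψm X h₁)) ds := by
  rw [star7_add, star7_smul, (star7_warpedG2 hS hc).2 h₁ rfl,
    (star7_warpedG2 hS hc).1 h₂ rfl, smul_smul, mul_inv_cancel_left₀ hc, lift6_smul]
  exact add_comm _ _

theorem star7_warpedG2_self (hS : IsSU3Structure ω ψp ψm) (hc : c ≠ 0) :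
    (star7 (warpedG2 0 1 c ω ψp ψm) (warpedG2 0 1 c ω ψp ψm) : Form E7 (M × Circle) 4) =
      lift6 ((1 / 2 : ℝ) • wedge ω ω) + c • wedge (lift6 ψp) ds := by
  conv_lhs => enter [2]; rw [warpedG2_zero_one]
  rw [star7_lift6_add_wedge_ds hS hc rfl rfl, star6_omega hS, star6_neg hS,
    star6_psiM hS, neg_neg]
  norm_num

theorem star7_star7_warpedG2 (hS : IsSU3Structure ω ψp ψm) (hc : c ≠ 0) :
    (star7 (warpedG2 0 1 c ω ψp ψm) (star7 (warpedG2 0 1 c ω ψp ψm)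
      (warpedG2 0 1 c ω ψp ψm) : Form E7 (M × Circle) 4) : Form E7 (M × Circle) 3) =
      warpedG2 0 1 c ω ψp ψm := by
  rw [star7_warpedG2_self hS hc, star7_lift6_add_wedge_ds hS hc rfl rfl, star6_psiP hS,
    star6_smul hS, star6_omega_wedge_omega hS, warpedG2_zero_one, smul_smul]
  rw [show (-1 : ℝ) ^ (2 + 1) = -1 by norm_num, show (1 / 2 : ℝ) * 2 = 1 by norm_num, one_smul,
    neg_one_smul ℝ ψm]

variable [IsManifold (𝓡 6) 1 M]

theorem extD_zero {E : Type*} [NormedAddCommGroup E] [NormedSpace ℝ E]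
    {H : Type*} [TopologicalSpace H] {I : ModelWithCorners ℝ E H} [I.Boundaryless]
    {N : Type*} [TopologicalSpace N] [ChartedSpace H N] [IsManifold I 1 N] :
    extD I (0 : Form E N k) = 0 := by
  funext x
  rw [← zero_smul ℝ (0 : Form E N k), extD_const_smul, zero_smul]
  rfl

theorem extD_neg {E : Type*} [NormedAddCommGroup E] [NormedSpace ℝ E]
    {H : Type*} [TopologicalSpace H] {I : ModelWithCorners ℝ E H} [I.Boundaryless]
    {N : Type*} [TopologicalSpace N] [ChartedSpace H N] [IsManifold I 1 N] (α : Form E N k) :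
    extD I (-α) = -extD I α := by
  funext x
  rw [← neg_one_smul ℝ α, extD_const_smul]
  exact neg_one_smul ℝ (extD I α x)

/-- Coclosedness kills d*d, and d*(⋆φ) = ⋆d⋆⋆φ = ⋆dφ with sign (-1)⁴. Here dφ = -dψ₋ + c dω ∧ ds,
and ⋆₇ exchanges the two components, giving -⋆₆dω - c ⋆₆dψ₋ ∧ ds. -/
theorem laplacian4_warpedG2 (hS : IsSU3Structure ω ψp ψm) (hc : c ≠ 0)
    (hco : IsCoclosed I7 (warpedG2 0 1 c ω ψp ψm))
    (h1 : ∀ x, FormDiffAt (𝓡 6) (star6 ω ψp ψm (extD (𝓡 6) ψm) : Form E6 M 2) x)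
    (h2 : ∀ x, FormDiffAt (𝓡 6) (star6 ω ψp ψm (extD (𝓡 6) ω) : Form E6 M 3) x) :
    - laplacian4 I7 (warpedG2 0 1 c ω ψp ψm)
      (star7 (warpedG2 0 1 c ω ψp ψm) (warpedG2 0 1 c ω ψp ψm)) =
    lift6 (extD (𝓡 6) (star6 ω ψp ψm (extD (𝓡 6) ω) : Form E6 M 3)) +
      c • wedge (lift6 (extD (𝓡 6) (star6 ω ψp ψm (extD (𝓡 6) ψm) : Form E6 M 2))) ds := by
  have hd : extD I7 (warpedG2 0 1 c ω ψp ψm) =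
      lift6 (-extD (𝓡 6) ψm) + c • wedge (lift6 (extD (𝓡 6) ω)) ds := by
    rw [warpedG2_zero_one, ← extD_neg]
    exact extD_lift6_add_wedge_ds c rfl rfl (fun x => (hS.formDiffAt x).2.2.neg)
      fun x => (hS.formDiffAt x).1
  have hs : (star7 (warpedG2 0 1 c ω ψp ψm) (extD I7 (warpedG2 0 1 c ω ψp ψm)) :
      Form E7 (M × Circle) 3) =
      lift6 (-(star6 ω ψp ψm (extD (𝓡 6) ω) : Form E6 M 3)) +
        c • wedge (lift6 (-(star6 ω ψp ψm (extD (𝓡 6) ψm) : Form E6 M 2))) ds := by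
    rw [hd]
    refine (star7_lift6_add_wedge_ds hS hc (k := 3) (l := 2) rfl rfl rfl _ _).trans ?_
    rw [star6_neg hS, show (-1 : ℝ) ^ (2 + 1) = -1 by norm_num]
    exact congrArg (fun β => lift6 β + _) (neg_one_smul ℝ (star6 ω ψp ψm (extD (𝓡 6) ω) _))
  have hc3 : codiff I7 (warpedG2 0 1 c ω ψp ψm) (k := 3) (l := 3) rfl
      (star7 (warpedG2 0 1 c ω ψp ψm) (warpedG2 0 1 c ω ψp ψm)) =
      lift6 (-(star6 ω ψp ψm (extD (𝓡 6) ω) : Form E6 M 3)) +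
        c • wedge (lift6 (-(star6 ω ψp ψm (extD (𝓡 6) ψm) : Form E6 M 2))) ds := by
    rw [codiff, star7_star7_warpedG2 hS hc, ← hs]
    norm_num
  have hc4 : codiff I7 (warpedG2 0 1 c ω ψp ψm) (k := 4) (l := 2) rfl
      (extD I7 (star7 (warpedG2 0 1 c ω ψp ψm) (warpedG2 0 1 c ω ψp ψm))) = 0 := by
    rw [codiff, hco, star7_zero, extD_zero, star7_zero, smul_zero]
  rw [laplacian4, hc4, add_zero, hc3]
  refine (congrArg _ (extD_lift6_add_wedge_ds c rfl rfl (fun x => (h2 x).neg)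
    fun x => (h1 x).neg)).trans ?_
  rw [extD_neg, extD_neg, ← neg_one_smul ℝ (extD (𝓡 6) (star6 ω ψp ψm (extD (𝓡 6) ω) _)),
    ← neg_one_smul ℝ (extD (𝓡 6) (star6 ω ψp ψm (extD (𝓡 6) ψm) _)), lift6_smul, lift6_smul,
    wedge_smul_left]
  module

end Warped

/-! ### Torsion of a coclosed structure -/

section Torsion

variable {M : Type*} [TopologicalSpace M] [ChartedSpace E6 M] [IsManifold (𝓡 6) 1 M]
  {ω : Form E6 M 2} {ψp ψm : Form E6 M 3} {c : ℝ} {π₀ σ₀ : M → ℝ} {π₁ ν₁ : Form E6 M 1}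
  {π₂ σ₂ : Form E6 M 2} {ν₃ : Form E6 M 3}

theorem extD_omega_sq (hS : IsSU3Structure ω ψp ψm) (x : M) :
    extD (𝓡 6) ((1 / 2 : ℝ) • wedge ω ω : Form E6 M 4) x =
      altWedge (by norm_num) (extD (𝓡 6) ω x) (ω x) := by
  have hω := (hS.formDiffAt x).1
  have h1 : extD (𝓡 6) (wedge ω ω : Form E6 M 4) x = _ :=
    extD_wedge (n := 4) rfl (by norm_num) (by norm_num) hω hω
  rw [extD_const_smul, h1, altWedge_comm (p := 2) (q := 2 + 1) _ (by norm_num)]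
  rw [show (-1 : ℝ) ^ (2 * (2 + 1)) = 1 by norm_num, show (-1 : ℝ) ^ 2 = 1 by norm_num, one_smul,
    one_smul, ← two_smul ℝ, smul_smul]
  norm_num

/-- The components of d(½ω² + c ψ₊ ∧ ds) vanish separately, and c can be cancelled. -/
theorem extD_eq_zero_of_isCoclosed (hS : IsSU3Structure ω ψp ψm) (hc : c ≠ 0)
    (hco : IsCoclosed I7 (warpedG2 0 1 c ω ψp ψm)) (x : M) :
    extD (𝓡 6) ((1 / 2 : ℝ) • wedge ω ω : Form E6 M 4) x = 0 ∧ extD (𝓡 6) ψp x = 0 := by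
  rw [IsCoclosed, star7_warpedG2_self hS hc, extD_lift6_add_wedge_ds (k := 3) c rfl rfl
    (fun x => ((hS.formDiffAt x).1.wedge rfl (hS.formDiffAt x).1).const_smul _)
    (fun x => (hS.formDiffAt x).2.1), ← wedge_smul_left _ c (lift6 _), ← lift6_smul c] at hco
  have h := eq_zero_of_lift6_add_wedge_ds_apply_eq_zero (k := 4) (m := 5) (by norm_num)
    (congrFun hco (x, (1 : Circle)))
  have h2 : c • extD (𝓡 6) ψp x = 0 := h.2
  exact ⟨h.1, (smul_eq_zero.1 h2).resolve_left hc⟩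

theorem IsTorsion.eq_zero_of_isCoclosed (htor : IsTorsion ω ψp ψm π₀ σ₀ π₁ ν₁ π₂ σ₂ ν₃)
    (hS : IsSU3Structure ω ψp ψm) (hc : c ≠ 0)
    (hco : IsCoclosed I7 (warpedG2 0 1 c ω ψp ψm)) :
    π₀ = 0 ∧ π₁ = 0 ∧ π₂ = 0 ∧ ν₁ = 0 := by
  have h1 : ∀ x, π₀ x = 0 ∧ π₁ x = 0 ∧ π₂ x = 0 := by
    intro x
    obtain ⟨e, he⟩ := hS.exists_coframe x
    have hd := (extD_eq_zero_of_isCoclosed hS hc hco x).2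
    rw [htor.d_ψp] at hd
    have hσ := congrFun htor.mem_π₂.2.2 x
    rw [star6, he.su3Hodge_eq] at hσ
    exact he.eq_zero_of_torsion_eq_zero rfl rfl rfl hσ hd
  have hπ₀ : π₀ = 0 := funext fun x => (h1 x).1
  refine ⟨hπ₀, funext fun x => (h1 x).2.1, funext fun x => (h1 x).2.2, funext fun x => ?_⟩
  obtain ⟨e, he⟩ := hS.exists_coframe x
  have hd := (extD_eq_zero_of_isCoclosed hS hc hco x).1
  have hν₃ : altWedge rfl (ν₃ x) (ω x) = 0 := congrFun htor.mem_ν₃.2.1 x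
  have hx : extD (𝓡 6) ω x = (-(3 / 2 * σ₀ x)) • ψp x + (3 / 2 * π₀ x) • ψm x +
      altWedge rfl (ν₁ x) (ω x) + ν₃ x := by
    rw [htor.d_ω]
    simp only [Pi.add_apply, Pi.neg_apply, Pi.smul_apply, mulForm, wedge]
    module
  -- With π₀ = 0, ψ₊ ∧ ω = 0 and ν₃ ∧ ω = 0, the condition dω ∧ ω = 0 reduces to ν₁ ∧ ω² = 0.
  rw [extD_omega_sq hS, hx, hπ₀, Pi.zero_apply, mul_zero, zero_smul, add_zero] at hd
  simp only [altWedge_add_left, altWedge_smul_left, he.psiP_wedge_omega, hν₃, smul_zero,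
    zero_add, add_zero] at hd
  rw [altWedge_assoc (q := 2) (r := 2) (l := 4) _ _ (by norm_num) (by norm_num)] at hd
  exact he.eq_zero_of_wedge_omega_wedge_omega rfl rfl hd

theorem IsTorsion.d_omega_of_isCoclosed (htor : IsTorsion ω ψp ψm π₀ σ₀ π₁ ν₁ π₂ σ₂ ν₃)
    (hS : IsSU3Structure ω ψp ψm) (hc : c ≠ 0)
    (hco : IsCoclosed I7 (warpedG2 0 1 c ω ψp ψm)) :
    extD (𝓡 6) ω = (-(3 / 2) : ℝ) • mulForm σ₀ ψp + ν₃ := by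
  obtain ⟨h0, -, -, h1⟩ := htor.eq_zero_of_isCoclosed hS hc hco
  rw [htor.d_ω, h0, h1]
  funext x
  simp only [Pi.add_apply, Pi.neg_apply, Pi.smul_apply, mulForm, wedge, Pi.zero_apply,
    altWedge_zero_left]
  module

theorem IsTorsion.d_psiM_of_isCoclosed (htor : IsTorsion ω ψp ψm π₀ σ₀ π₁ ν₁ π₂ σ₂ ν₃)
    (hS : IsSU3Structure ω ψp ψm) (hc : c ≠ 0)
    (hco : IsCoclosed I7 (warpedG2 0 1 c ω ψp ψm)) :
    extD (𝓡 6) ψm = mulForm σ₀ (wedge ω ω) + -wedge σ₂ ω := by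
  obtain ⟨-, h0, -, -⟩ := htor.eq_zero_of_isCoclosed hS hc hco
  rw [htor.d_ψm, h0]
  funext x
  simp only [Pi.add_apply, Pi.neg_apply, Pi.sub_apply, wedge, Pi.zero_apply,
    altWedge_zero_left]
  module

theorem IsTorsion.star6_d_omega (htor : IsTorsion ω ψp ψm π₀ σ₀ π₁ ν₁ π₂ σ₂ ν₃)
    (hS : IsSU3Structure ω ψp ψm) (hc : c ≠ 0)
    (hco : IsCoclosed I7 (warpedG2 0 1 c ω ψp ψm)) :
    (star6 ω ψp ψm (extD (𝓡 6) ω) : Form E6 M 3) =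
      (-(3 / 2) : ℝ) • mulForm σ₀ ψm + star6 ω ψp ψm ν₃ := by
  rw [htor.d_omega_of_isCoclosed hS hc hco]
  refine (star6_add hS _ _ _).trans ?_
  refine congrArg (· + _) ((star6_smul hS _ _ _).trans (congrArg _ ?_))
  rw [star6_mulForm hS]
  exact congrArg _ (star6_psiP hS)

theorem IsTorsion.star6_d_psiM (htor : IsTorsion ω ψp ψm π₀ σ₀ π₁ ν₁ π₂ σ₂ ν₃)
    (hS : IsSU3Structure ω ψp ψm) (hc : c ≠ 0)
    (hco : IsCoclosed I7 (warpedG2 0 1 c ω ψp ψm)) :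
    (star6 ω ψp ψm (extD (𝓡 6) ψm) : Form E6 M 2) = (2 : ℝ) • mulForm σ₀ ω + σ₂ := by
  rw [htor.d_psiM_of_isCoclosed hS hc hco]
  refine (star6_add hS _ _ _).trans ?_
  have h1 : (star6 ω ψp ψm (mulForm σ₀ (wedge ω ω : Form E6 M 4)) : Form E6 M 2) =
      (2 : ℝ) • mulForm σ₀ ω := by
    rw [star6_mulForm hS, star6_omega_wedge_omega hS]
    funext x
    exact smul_comm (σ₀ x) (2 : ℝ) (ω x)
  -- On Ω²₈ the form -σ₂ ∧ ω is ⋆₆σ₂, and ⋆₆⋆₆ = 1 on 2-forms.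
  have h2 : (star6 ω ψp ψm (-wedge σ₂ ω : Form E6 M 4) : Form E6 M 2) = σ₂ := by
    rw [← htor.mem_σ₂.2.2, star6_star6_two hS]
  exact congrArg₂ (· + ·) h1 h2

/-- Leibniz rule on -3/2 σ₀ψ₋ + ⋆₆ν₃, with dψ₋ replaced by its torsion expression;
`IsTorsion.d_star6_d_psiM` does the same for 2σ₀ω + σ₂ and dω. -/
theorem IsTorsion.d_star6_d_omega (htor : IsTorsion ω ψp ψm π₀ σ₀ π₁ ν₁ π₂ σ₂ ν₃)
    (hS : IsSU3Structure ω ψp ψm) (hc : c ≠ 0)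
    (hco : IsCoclosed I7 (warpedG2 0 1 c ω ψp ψm)) (x : M) :
    FormDiffAt (𝓡 6) (star6 ω ψp ψm (extD (𝓡 6) ω) : Form E6 M 3) x ∧
    extD (𝓡 6) (star6 ω ψp ψm (extD (𝓡 6) ω) : Form E6 M 3) x =
      (-(3 / 2) : ℝ) • (altWedge rfl (diffFun (𝓡 6) σ₀ x) (ψm x) +
        σ₀ x • (σ₀ x • altWedge rfl (ω x) (ω x) - altWedge rfl (σ₂ x) (ω x))) +
      extD (𝓡 6) (star6 ω ψp ψm ν₃ : Form E6 M 3) x := by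
  have hσ : MDifferentiableAt (𝓡 6) 𝓘(ℝ, ℝ) σ₀ x :=
    (htor.smooth_σ₀ x).mdifferentiableAt (by simp)
  have h1 := (hS.formDiffAt x).2.2
  have h2 : FormDiffAt (𝓡 6) (star6 ω ψp ψm ν₃ : Form E6 M 3) x :=
    hS.formDiffAt_star6 (htor.mem_ν₃.1.formDiffAt x) _
  rw [htor.star6_d_omega hS hc hco]
  refine ⟨((h1.mulForm hσ).const_smul _).add h2, ?_⟩
  rw [extD_add ((h1.mulForm hσ).const_smul _) h2, extD_const_smul, extD_mulForm (k := 3)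
      (by norm_num) hσ h1,
    htor.d_psiM_of_isCoclosed hS hc hco]
  simp only [Pi.add_apply, Pi.neg_apply, mulForm, wedge, sub_eq_add_neg]

theorem IsTorsion.d_star6_d_psiM (htor : IsTorsion ω ψp ψm π₀ σ₀ π₁ ν₁ π₂ σ₂ ν₃)
    (hS : IsSU3Structure ω ψp ψm) (hc : c ≠ 0)
    (hco : IsCoclosed I7 (warpedG2 0 1 c ω ψp ψm)) (x : M) :
    FormDiffAt (𝓡 6) (star6 ω ψp ψm (extD (𝓡 6) ψm) : Form E6 M 2) x ∧
    extD (𝓡 6) (star6 ω ψp ψm (extD (𝓡 6) ψm) : Form E6 M 2) x =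
      (2 : ℝ) • (altWedge rfl (diffFun (𝓡 6) σ₀ x) (ω x) +
        σ₀ x • ((-(3 / 2) : ℝ) • σ₀ x • ψp x + ν₃ x)) + extD (𝓡 6) σ₂ x := by
  have hσ : MDifferentiableAt (𝓡 6) 𝓘(ℝ, ℝ) σ₀ x :=
    (htor.smooth_σ₀ x).mdifferentiableAt (by simp)
  have h1 := (hS.formDiffAt x).1
  have h2 : FormDiffAt (𝓡 6) σ₂ x := htor.mem_σ₂.1.formDiffAt x
  rw [htor.star6_d_psiM hS hc hco]
  refine ⟨((h1.mulForm hσ).const_smul _).add h2, ?_⟩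
  rw [extD_add ((h1.mulForm hσ).const_smul _) h2, extD_const_smul, extD_mulForm (k := 2)
      (by norm_num) hσ h1,
    htor.d_omega_of_isCoclosed hS hc hco]
  simp only [Pi.add_apply, Pi.smul_apply, mulForm]

end Torsion

/-! ### Time derivatives and the rearranged equations -/

section Evolution

theorem half_smul_eq_iff {V : Type*} [AddCommGroup V] [Module ℝ V] (s : ℝ) {D P Q R N : V} :
    (1 / 2 : ℝ) • D = (-(3 / 2) : ℝ) • (P + s • (s • Q - R)) + N ↔
      D = -((3 : ℝ) • s ^ 2 • Q) + (3 : ℝ) • s • R + (2 : ℝ) • N - (3 : ℝ) • P := by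
  rw [← smul_right_inj (two_ne_zero (α := ℝ))]
  refine Eq.congr (by module) (by module)

/-- Used with c = f(t) and c' = f'(t): dividing the ds-component by f produces the term (f'/f) ψ₊.
-/
theorem smul_add_smul_eq_iff {V : Type*} [AddCommGroup V] [Module ℝ V] {c c' : ℝ} (hc : c ≠ 0)
    (s : ℝ) {D ψ P N S : V} :
    c • D + c' • ψ = c • ((2 : ℝ) • (P + s • ((-(3 / 2) : ℝ) • s • ψ + N)) + S) ↔
      (c' / c) • ψ + D = -((3 : ℝ) • s ^ 2 • ψ) + (2 : ℝ) • s • N + S + (2 : ℝ) • P := by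
  have h : c • D + c' • ψ = c • ((c' / c) • ψ + D) := by
    rw [smul_add, smul_smul, mul_div_cancel₀ _ hc, add_comm]
  rw [h, smul_right_inj hc]
  exact Eq.congr rfl (by module)

variable {M : Type*} [TopologicalSpace M] [ChartedSpace E6 M] {T : Set ℝ} {t : ℝ}

theorem hasDerivWithinAt_lift6_add_wedge_ds {k m : ℕ} (h : k + 1 = m) {X : ℝ → Form E6 M m}
    {Y : ℝ → Form E6 M k} {X' : Form E6 M m} {Y' : Form E6 M k} {p : M × Circle}
    (hX : HasDerivWithinAt (fun s => X s p.1) (X' p.1) T t)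
    (hY : HasDerivWithinAt (fun s => Y s p.1) (Y' p.1) T t) :
    HasDerivWithinAt (fun s => (lift6 (X s) + wedge (lift6 (Y s)) ds h) p)
      ((lift6 X' + wedge (lift6 Y') ds h) p) T t := by
  have hl : ∀ {j : ℕ} {Z : ℝ → Form E6 M j} {Z' : Form E6 M j},
      HasDerivWithinAt (fun s => Z s p.1) (Z' p.1) T t →
      HasDerivWithinAt (fun s => lift6 (Z s) p) (lift6 Z' p) T t := by
    intro j Z Z' hZ
    have h1 := (ContinuousAlternatingMap.compContinuousLinearMapCLM (𝕜 := ℝ) (F := ℝ) (ι := Fin j)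
      (ContinuousLinearMap.fst ℝ E6 (EuclideanSpace ℝ (Fin 1)))).hasFDerivAt.comp_hasDerivWithinAt
        t hZ
    simp only [lift6_apply]
    exact h1
  have h2 :=
      ((altWedgeL h).flip ((ds : Form E7 (M × Circle) 1) p)).hasFDerivAt.comp_hasDerivWithinAt
    t (hl hY)
  exact (hl hX).add h2

/-- A nontrivial interval has nonempty interior, so derivatives within it are unique, also at
endpoints. -/
theorem uniqueDiffWithinAt_of_ordConnected (hT : T.OrdConnected) (hT' : T.Nontrivial)
    (ht : t ∈ T) : UniqueDiffWithinAt ℝ T t :=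
  uniqueDiffOn_convex hT.convex (hT.convex.nontrivial_iff_nonempty_interior.1 hT') t ht

end Evolution

end G2Coflow

end

/-! ### The main theorem -/

open G2Coflow in
theorem mainTheorem7 {M : Type*} [TopologicalSpace M] [ChartedSpace E6 M]
    [IsManifold (𝓡 6) ((⊤ : ℕ∞) : WithTop ℕ∞) M]
    (T : Set ℝ) (hT : T.OrdConnected) (hT' : T.Nontrivial)
    (f : ℝ → ℝ) (hf : DifferentiableOn ℝ f T) (hf0 : ∀ t ∈ T, f t ≠ 0)
    (ω : ℝ → Form E6 M 2) (ψp ψm : ℝ → Form E6 M 3)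
    (hSU3 : ∀ t ∈ T, IsSU3Structure (ω t) (ψp t) (ψm t))
    (hω : ∀ x, DifferentiableOn ℝ (fun t => ω t x) T)
    (hψp : ∀ x, DifferentiableOn ℝ (fun t => ψp t x) T)
    (hψm : ∀ x, DifferentiableOn ℝ (fun t => ψm t x) T)
    (π₀ σ₀ : ℝ → M → ℝ) (π₁ ν₁ : ℝ → Form E6 M 1) (π₂ σ₂ : ℝ → Form E6 M 2)
    (ν₃ : ℝ → Form E6 M 3)
    (htor : ∀ t ∈ T, IsTorsion (ω t) (ψp t) (ψm t) (π₀ t) (σ₀ t) (π₁ t) (ν₁ t) (π₂ t) (σ₂ t) (ν₃ t))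
    (hco : ∀ t ∈ T, IsCoclosed I7 (warpedG2 0 1 (f t) (ω t) (ψp t) (ψm t))) :
    ∀ t ∈ T, π₀ t = 0 ∧ π₂ t = 0 ∧
      (CoflowEquationAt I7 T (fun s => warpedG2 0 1 (f s) (ω s) (ψp s) (ψm s)) t ↔
        ((∀ x, derivWithin (fun s => (wedge (ω s) (ω s) : Form E6 M 4) x) T t =
          (- ((3 : ℝ) • mulForm (σ₀ t ^ 2) (wedge (ω t) (ω t)))
            + (3 : ℝ) • mulForm (σ₀ t) (wedge (σ₂ t) (ω t))
            + (2 : ℝ) • extD (𝓡 6) (star6 (ω t) (ψp t) (ψm t) (ν₃ t))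
            - (3 : ℝ) • wedge (diffFun (𝓡 6) (σ₀ t)) (ψm t) : Form E6 M 4) x) ∧
        (∀ x, (derivWithin f T t / f t) • ψp t x + derivWithin (fun s => ψp s x) T t =
          (- ((3 : ℝ) • mulForm (σ₀ t ^ 2) (ψp t))
            + (2 : ℝ) • mulForm (σ₀ t) (ν₃ t)
            + extD (𝓡 6) (σ₂ t)
            + (2 : ℝ) • wedge (diffFun (𝓡 6) (σ₀ t)) (ω t) : Form E6 M 3) x))) := by
  intro t ht
  have : IsManifold (𝓡 6) 1 M := IsManifold.of_le (n := ((⊤ : ℕ∞) : WithTop ℕ∞)) (by simp)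
  have hS := hSU3 t ht
  have hc := hf0 t ht
  obtain ⟨h0, -, h2, -⟩ := (htor t ht).eq_zero_of_isCoclosed hS hc (hco t ht)
  refine ⟨h0, h2, ?_⟩
  have hA := (htor t ht).d_star6_d_omega hS hc (hco t ht)
  have hB := (htor t ht).d_star6_d_psiM hS hc (hco t ht)
  have hL := laplacian4_warpedG2 hS hc (hco t ht) (fun x => (hB x).1) fun x => (hA x).1
  have hU := uniqueDiffWithinAt_of_ordConnected hT hT' ht
  set A : Form E6 M 4 := extD (𝓡 6) (star6 (ω t) (ψp t) (ψm t) (extD (𝓡 6) (ω t)) : Form E6 M 3)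
  set B : Form E6 M 3 := extD (𝓡 6) (star6 (ω t) (ψp t) (ψm t) (extD (𝓡 6) (ψm t)) : Form E6 M 2)
  rw [← wedge_smul_left, ← lift6_smul] at hL
  -- X and Y are the time derivatives of ½ω² and fψ₊, the components of ∂(⋆φ)/∂t; A and f B are
  -- those of -Δ(⋆φ).
  set X : Form E6 M 4 := fun x =>
    (1 / 2 : ℝ) • derivWithin (fun s => (wedge (ω s) (ω s) : Form E6 M 4) x) T t with hX
  set Y : Form E6 M 3 := fun x =>
    f t • derivWithin (fun s => ψp s x) T t + derivWithin f T t • ψp t x with hY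
  have hXd : ∀ x, HasDerivWithinAt
      (fun s => ((1 / 2 : ℝ) • wedge (ω s) (ω s) : Form E6 M 4) x) (X x) T t := by
    intro x
    have h1 : DifferentiableWithinAt ℝ (fun s => (wedge (ω s) (ω s) : Form E6 M 4) x) T t := by
      have h2 := (hω x t ht).hasFDerivWithinAt
      exact ((altWedgeL (E := E6) (p := 2) (q := 2) rfl).hasFDerivWithinAt_of_bilinear
        h2 h2).differentiableWithinAt
    exact h1.hasDerivWithinAt.const_smul (1 / 2 : ℝ)
  have hYd : ∀ x, HasDerivWithinAt (fun s => (f s • ψp s) x) (Y x) T t := fun x =>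
    (hf t ht).hasDerivWithinAt.smul (hψp x t ht).hasDerivWithinAt
  have hstar : ∀ s ∈ T, (star7 (warpedG2 0 1 (f s) (ω s) (ψp s) (ψm s))
      (warpedG2 0 1 (f s) (ω s) (ψp s) (ψm s)) : Form E7 (M × Circle) 4) =
      lift6 ((1 / 2 : ℝ) • wedge (ω s) (ω s)) + wedge (lift6 (f s • ψp s)) ds := by
    intro s hs
    rw [star7_warpedG2_self (hSU3 s hs) (hf0 s hs), lift6_smul (f s), wedge_smul_left]
  have hderiv : ∀ p : M × Circle, HasDerivWithinAt (fun s => (star7 (warpedG2 0 1 (f s) (ω s) (ψp s)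
      (ψm s)) (warpedG2 0 1 (f s) (ω s) (ψp s) (ψm s)) : Form E7 (M × Circle) 4) p)
      ((lift6 X + wedge (lift6 Y) ds : Form E7 (M × Circle) 4) p) T t := fun p =>
    (hasDerivWithinAt_lift6_add_wedge_ds rfl (hXd p.1) (hYd p.1)).congr
      (fun s hs => congrFun (hstar s hs) p) (congrFun (hstar t ht) p)
  have hflow : CoflowEquationAt I7 T (fun s => warpedG2 0 1 (f s) (ω s) (ψp s) (ψm s)) t ↔
      ∀ x, X x = A x ∧ Y x = (f t • B) x := by
    constructor
    · intro H x
      -- All components come from M, so a single point of the circle suffices to compare them.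
      refine eq_of_lift6_add_wedge_ds_apply_eq (z := 1) rfl ?_
      rw [← hL]
      exact hU.eq_deriv _ (hderiv _) (H _)
    · intro H p
      have hXA : X = A := funext fun x => (H x).1
      have hYB : Y = f t • B := funext fun x => (H x).2
      have h1 := hderiv p
      rw [hXA, hYB, ← hL] at h1
      exact h1
  rw [hflow, forall_and]
  refine and_congr (forall_congr' fun x => ?_) (forall_congr' fun x => ?_)
  · rw [(hA x).2]
    exact half_smul_eq_iff (V := E6 [⋀^Fin 4]→L[ℝ] ℝ) (σ₀ t x)
  · rw [Pi.smul_apply, (hB x).2]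
    exact smul_add_smul_eq_iff (V := E6 [⋀^Fin 3]→L[ℝ] ℝ) hc (σ₀ t x)
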